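/- Let $\Bbbk$ be an algebraically closed field of characteristic $0$. A ribbon graph $\Gamma=(V,H,s,\iota,\rho)$ consists of finite sets $V$ (vertices) and $H$ (half-edges), a map $s:H\to V$, an involution $\iota$ of $H$ without fixed points, and a permutation $\rho$ of $H$ whose cycles are exactly the sets $H_v=s^{-1}(v)$, $v\in V$ (all non-empty). Its edges are the orbits $\bar h=\{h,\iota(h)\}$ of $\iota$, and $E$ is the set of edges; $\bar h$ joins $s(h)$ and $s(\iota(h))$. Let $(\Gamma,\mathbb m)$ be a Brauer graph, i.e. a ribbon graph with a function $\mathbb m:V\to\mathbb Z_{>0}$, and assume that $\Gamma$ is connected and bipartite (that is, $V=V_1\sqcup V_2$ and every edge joins a vertex of $V_1$ with a vertex of $V_2$). Let $Q_\Gamma$ be the quiver with vertex set $E$ and with one arrow $\alpha_h:\bar h\to\overline{\rho(h)}$ for each $h\in H$; put $\sigma(\alpha_h)=\alpha_{\rho^{-1}(h)}$ and, writing paths from right to left, $C_{\alpha_h}=\alpha_h\sigma(\alpha_h)\cdots\sigma^{l}(\alpha_h)$ with $l+1=|H_{s(h)}|$, and $\mathbb m(C_{\alpha_h})=\mathbb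 m(s(h))$. Let $I_\Gamma$ be the two-sided ideal of the path algebra $\Bbbk Q_\Gamma$ generated by all $\alpha\beta$ for composable arrows $\alpha,\beta$ with $\beta\neq\sigma(\alpha)$ and all $C_\alpha^{\mathbb m(C_\alpha)}-C_\beta^{\mathbb m(C_\beta)}$ for arrows $\alpha,\beta$ with the same terminus, and let $B_\Gamma=\Bbbk Q_\Gamma/I_\Gamma$ be the Brauer graph algebra. Let $\mathrm{HH}^2(B_\Gamma)$ be its second Hochschild cohomology over $\Bbbk$ with coefficients in $B_\Gamma$; it is finite-dimensional, and the following hold. 1. If $B_\Gamma$ is not local, then $$\dim_{\Bbbk}\mathrm{HH}^2(B_\Gamma)=2+\sum_{v\in V}(\mathbb m(v)-1)+|E|-|V|+|S_{2\text{-cyc}}|,$$ where $S_{2\text{-cyc}}$ is the set of all paths $\alpha\beta$ of length two in $Q_\Gamma$ that are $2$-cycles, with arrows $\alpha\neq\beta$ such that $\alpha\beta\in I_\Gamma$ and $\beta\alpha\in I_\Gamma$ (so $\alpha\beta$ and $\beta\alpha$ are counted separately). 2. If $B_\Gamma$ is local, then $\Gamma$ has exactly one edge and exactly two vertices; let $m_1,m_2$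 be the multiplicities of these two vertices. - If $m_1\neq1$ and $m_2\neq1$, then $\dim_{\Bbbk}\mathrm{HH}^2(B_\Gamma)=m_1+m_2+1$. - Otherwise one of the multiplicities is $1$ and the other is some $m\ge 1$; then $B_\Gamma\cong\Bbbk[x]/(x^{m+1})$ (the local Brauer tree algebra) and $\dim_{\Bbbk}\mathrm{HH}^2(B_\Gamma)=m$. -/

import Mathlib

set_option maxSynthPendingDepth 3

noncomputable section

/-! ### Path algebras -/

/-- The path algebra `k Q` of a quiver: the vector space with basis the set of all paths of `Q`
(including the trivial path at each vertex). -/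
def PathAlgebra (k Q : Type*) [Field k] [Quiver Q] : Type _ :=
  (Σ a b : Q, Quiver.Path a b) →₀ k

namespace PathAlgebra

variable {k Q : Type*} [Field k] [Quiver Q]

instance : AddCommGroup (PathAlgebra k Q) :=
  inferInstanceAs (AddCommGroup ((Σ a b : Q, Quiver.Path a b) →₀ k))

instance : Module k (PathAlgebra k Q) :=
  inferInstanceAs (Module k ((Σ a b : Q, Quiver.Path a b) →₀ k))

/-- The basis element of `k Q` given by a path. -/
def ofPath (k : Type*) {Q : Type*} [Field k] [Quiver Q] {a b : Q} (p : Quiver.Path a b) :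
    PathAlgebra k Q :=
  Finsupp.single (⟨a, b, p⟩ : Σ a b : Q, Quiver.Path a b) (1 : k)

open Classical in
/-- The product `p q` of two paths. Paths are written from right to left: `p q` is first `q`,
then `p`, if `q` ends where `p` starts, and `0` otherwise. -/
def pathMul (k : Type*) {Q : Type*} [Field k] [Quiver Q] (p q : Σ a b : Q, Quiver.Path a b) :
    PathAlgebra k Q :=
  if h : q.2.1 = p.1 then ofPath k ((q.2.2.cast rfl h).comp p.2.2) else 0

/-- The product of `k Q`, as the bilinear extension of the product of paths. -/
def mulHom (k Q : Type*) [Field k] [Quiver Q] :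
    PathAlgebra k Q →ₗ[k] PathAlgebra k Q →ₗ[k] PathAlgebra k Q :=
  Finsupp.linearCombination k fun p => Finsupp.linearCombination k fun q => pathMul k p q

instance : Mul (PathAlgebra k Q) := ⟨fun x y => mulHom k Q x y⟩

instance [Fintype Q] : One (PathAlgebra k Q) := ⟨∑ a : Q, ofPath k (Quiver.Path.nil : Quiver.Path a a)⟩

theorem mul_def (x y : PathAlgebra k Q) : x * y = mulHom k Q x y := rfl

theorem one_def [Fintype Q] :
    (1 : PathAlgebra k Q) = ∑ a : Q, ofPath k (Quiver.Path.nil : Quiver.Path a a) := rfl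

theorem ofPath_mul_ofPath {a b c d : Q} (p : Quiver.Path a b) (q : Quiver.Path c d) :
    ofPath k p * ofPath k q = pathMul k ⟨a, b, p⟩ ⟨c, d, q⟩ := by
  have h1 : mulHom k Q (ofPath k p) = Finsupp.linearCombination k fun q => pathMul k ⟨a, b, p⟩ q :=
    (Finsupp.linearCombination_single k (1 : k) _).trans (one_smul k _)
  rw [mul_def, h1]
  exact (Finsupp.linearCombination_single k (1 : k) _).trans (one_smul k _)

theorem ofPath_mul_comp {a b c : Q} (p : Quiver.Path b c) (q : Quiver.Path a b) :
    ofPath k p * ofPath k q = ofPath k (q.comp p) := by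
  rw [ofPath_mul_ofPath, pathMul, dif_pos rfl]
  rfl

theorem ofPath_mul_of_ne {a b c d : Q} (p : Quiver.Path a b) (q : Quiver.Path c d) (h : d ≠ a) :
    ofPath k p * ofPath k q = 0 := by
  rw [ofPath_mul_ofPath, pathMul, dif_neg h]

theorem induction {P : PathAlgebra k Q → Prop} (x : PathAlgebra k Q) (h0 : P 0)
    (hadd : ∀ x y, P x → P y → P (x + y))
    (hpath : ∀ (c : k) {a b : Q} (p : Quiver.Path a b), P (c • ofPath k p)) : P x := by
  refine Finsupp.induction_linear x h0 (fun f g hf hg => hadd f g hf hg) ?_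
  rintro ⟨a, b, p⟩ c
  have h := hpath c p
  have e : c • ofPath k p = (Finsupp.single (⟨a, b, p⟩ : Σ a b : Q, Quiver.Path a b) c) := by
    rw [ofPath]
    erw [Finsupp.smul_single]
    rw [smul_eq_mul, mul_one]
  exact e ▸ h

theorem ofPath_mul_assoc {a b c d e f : Q} (p : Quiver.Path a b) (q : Quiver.Path c d)
    (r : Quiver.Path e f) :
    ofPath k p * ofPath k q * ofPath k r = ofPath k p * (ofPath k q * ofPath k r) := by
  have z1 : ∀ x : PathAlgebra k Q, 0 * x = 0 := fun x => by simp [mul_def]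
  have z2 : ∀ x : PathAlgebra k Q, x * 0 = 0 := fun x => by simp [mul_def]
  by_cases h1 : d = a
  · subst h1
    by_cases h2 : f = c
    · subst h2
      simp only [ofPath_mul_comp, Quiver.Path.comp_assoc]
    · rw [ofPath_mul_comp, ofPath_mul_of_ne _ _ h2, ofPath_mul_of_ne _ _ h2, z2]
  · rw [ofPath_mul_of_ne p q h1, z1]
    by_cases h2 : f = c
    · subst h2
      rw [ofPath_mul_comp, ofPath_mul_of_ne _ _ h1]
    · rw [ofPath_mul_of_ne _ _ h2, z2]

instance [Fintype Q] : Ring (PathAlgebra k Q) :=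
  { (inferInstance : AddCommGroup (PathAlgebra k Q)) with
    mul := fun x y => x * y
    one := 1
    left_distrib := fun x y z => by
      change mulHom k Q x (y + z) = mulHom k Q x y + mulHom k Q x z
      simp
    right_distrib := fun x y z => by
      change mulHom k Q (x + y) z = mulHom k Q x z + mulHom k Q y z
      simp
    zero_mul := fun x => by
      change mulHom k Q 0 x = 0
      simp
    mul_zero := fun x => by
      change mulHom k Q x 0 = 0
      simp
    mul_assoc := fun x y z => by
      change mulHom k Q (mulHom k Q x y) z = mulHom k Q x (mulHom k Q y z)
      induction x using PathAlgebra.induction with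
      | h0 => simp
      | hadd x x' hx hx' => simp [hx, hx']
      | hpath c p =>
        induction y using PathAlgebra.induction with
        | h0 => simp
        | hadd y y' hy hy' => simp only [map_add, LinearMap.add_apply, hy, hy']
        | hpath c' q =>
          induction z using PathAlgebra.induction with
          | h0 => simp
          | hadd z z' hz hz' => simp only [map_add, hz, hz']
          | hpath c'' r =>
            have h := ofPath_mul_assoc (k := k) p q r
            simp only [mul_def] at h
            simp only [map_smul, LinearMap.smul_apply, h]
    one_mul := fun x => by
      change mulHom k Q (∑ a : Q, ofPath k (Quiver.Path.nil : Quiver.Path a a)) x = x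
      induction x using PathAlgebra.induction with
      | h0 => simp
      | hadd x y hx hy => rw [map_add, hx, hy]
      | @hpath c a b p =>
        rw [map_smul, map_sum, LinearMap.sum_apply, Finset.sum_eq_single b]
        · exact congrArg (c • ·) (ofPath_mul_comp (k := k) Quiver.Path.nil p)
        · intro d _ hd
          exact ofPath_mul_of_ne _ _ (Ne.symm hd)
        · intro h
          exact absurd (Finset.mem_univ b) h
    mul_one := fun x => by
      change mulHom k Q x (∑ a : Q, ofPath k (Quiver.Path.nil : Quiver.Path a a)) = x
      induction x using PathAlgebra.induction with
      | h0 => simp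
      | hadd x y hx hy => rw [map_add, LinearMap.add_apply, hx, hy]
      | @hpath c a b p =>
        rw [map_smul, LinearMap.smul_apply, map_sum, Finset.sum_eq_single a]
        · refine congrArg (c • ·) ((ofPath_mul_comp (k := k) p Quiver.Path.nil).trans ?_)
          rw [Quiver.Path.nil_comp]
        · intro d _ hd
          exact ofPath_mul_of_ne _ _ hd
        · intro h
          exact absurd (Finset.mem_univ a) h }

instance [Fintype Q] : Algebra k (PathAlgebra k Q) :=
  Algebra.ofModule
    (fun c x y => by
      change mulHom k Q (c • x) y = c • mulHom k Q x y
      simp)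
    (fun c x y => by
      change mulHom k Q x (c • y) = c • mulHom k Q x y
      simp)

end PathAlgebra

/-! ### Ribbon graphs and Brauer graphs -/

/-- A ribbon graph with vertex set `V` and set of half-edges `H`. -/
structure RibbonGraph (V H : Type*) where
  /-- the vertex at which a half-edge is attached -/
  s : H → V
  /-- the involution without fixed points whose orbits are the edges -/
  ι : H → H
  ι_involutive : Function.Involutive ι
  ι_ne : ∀ h, ι h ≠ h
  /-- the permutation `h ↦ h⁺` -/
  ρ : Equiv.Perm H
  /-- The cycles of `ρ` are the fibres of `s`, and every vertex has a (non-empty) cycle. -/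
  sameCycle_iff : ∀ h h', ρ.SameCycle h h' ↔ s h = s h'
  s_surjective : Function.Surjective s

/-- A Brauer graph: a ribbon graph with a positive multiplicity at every vertex. -/
structure BrauerGraph (V H : Type*) extends RibbonGraph V H where
  m : V → ℕ
  m_pos : ∀ v, 0 < m v

namespace RibbonGraph

variable {V H : Type*} (Γ : RibbonGraph V H)

/-- The set `E` of edges, i.e. of the orbits `{h, ι h}`. -/
def Edge : Type _ := Set.range fun h : H => s(h, Γ.ι h)

/-- The edge `{h, ι h}` of a half-edge `h`. -/
def edge (h : H) : Γ.Edge := ⟨s(h, Γ.ι h), h, rfl⟩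

instance [Finite H] : Fintype Γ.Edge :=
  haveI : Finite Γ.Edge := inferInstanceAs (Finite (Set.range fun h : H => s(h, Γ.ι h)))
  Fintype.ofFinite _

/-- The valency of a vertex. -/
def val (v : V) : ℕ := Nat.card {h : H // Γ.s h = v}

/-- The underlying graph is connected (parallel edges and loops do not matter here). -/
def Connected : Prop :=
  (SimpleGraph.fromRel fun v w : V => ∃ h, Γ.s h = v ∧ Γ.s (Γ.ι h) = w).Connected

/-- The vertices split into `V₁` and its complement, such that every edge joins a vertex of `V₁`
with a vertex outside `V₁`. -/
def IsBipartite : Prop :=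
  ∃ V₁ : Set V, ∀ h, Γ.s h ∈ V₁ ↔ Γ.s (Γ.ι h) ∉ V₁

/-- The quiver `Q_Γ`: its vertices are the edges of `Γ`, and every half-edge `h` gives an arrow
`α_h` from the edge of `h` to the edge of `h⁺`. -/
instance quiver : Quiver Γ.Edge where
  Hom a b := {h : H // Γ.edge h = a ∧ Γ.edge (Γ.ρ h) = b}

/-- The arrow `α_h`, as an element of the path algebra. -/
def arrow (k : Type*) [Field k] (h : H) : PathAlgebra k Γ.Edge :=
  PathAlgebra.ofPath k
    (Quiver.Hom.toPath (⟨h, rfl, rfl⟩ : Γ.edge h ⟶ Γ.edge (Γ.ρ h)))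

/-- The cycle `C_α = α σ(α) ⋯ σˡ(α)` for `α = α_h`, where `σ(α_h) = α_{h⁻}` and `l + 1` is the
valency of the vertex of `h`. -/
def cycle (k : Type*) [Field k] [Finite H] (h : H) : PathAlgebra k Γ.Edge :=
  ((List.range (Γ.val (Γ.s h))).map fun i => Γ.arrow k ((Γ.ρ⁻¹ ^ i) h)).prod

end RibbonGraph

namespace BrauerGraph

variable {V H : Type*} (k : Type*) [Field k] [Finite H] (Γ : BrauerGraph V H)

/-- The generators of the ideal `I_Γ`. -/
inductive Relation : PathAlgebra k Γ.Edge → Prop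
  /-- `αβ` for arrows with `t(β) = o(α)` and `β ≠ σ(α)` -/
  | zero (h h' : H) (hcomp : Γ.edge (Γ.ρ h') = Γ.edge h) (hne : h' ≠ Γ.ρ⁻¹ h) :
      Relation (Γ.arrow k h * Γ.arrow k h')
  /-- `C_α ^ m(C_α) - C_β ^ m(C_β)` for arrows with `t(α) = t(β)` -/
  | comm (h h' : H) (ht : Γ.edge (Γ.ρ h) = Γ.edge (Γ.ρ h')) :
      Relation (Γ.cycle k h ^ Γ.m (Γ.s h) - Γ.cycle k h' ^ Γ.m (Γ.s h'))

/-- The two-sided ideal `I_Γ` of `k Q_Γ`. -/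
def relIdeal : TwoSidedIdeal (PathAlgebra k Γ.Edge) :=
  TwoSidedIdeal.span {x | Relation k Γ x}

/-- The Brauer graph algebra `B_Γ = k Q_Γ / I_Γ`. -/
abbrev Alg : Type _ := (Γ.relIdeal k).ringCon.Quotient

/-- The set of the `2`-cycles `αβ` of `Q_Γ` with `α ≠ β` and `αβ, βα ∈ I_Γ`; the path
`α_h α_{h'}` of length two is recorded as the pair `(h, h')`. -/
def twoCycles : Set (H × H) :=
  {x | x.1 ≠ x.2 ∧ Γ.edge (Γ.ρ x.2) = Γ.edge x.1 ∧ Γ.edge (Γ.ρ x.1) = Γ.edge x.2 ∧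
    Γ.arrow k x.1 * Γ.arrow k x.2 ∈ Γ.relIdeal k ∧ Γ.arrow k x.2 * Γ.arrow k x.1 ∈ Γ.relIdeal k}

end BrauerGraph

/-! ### The second Hochschild cohomology -/

namespace Hochschild

variable (k A : Type*) [Field k] [Ring A] [Algebra k A]

/-- Hochschild `2`-cocycles of `A` with coefficients in `A`. -/
def Z2 : Submodule k (A →ₗ[k] A →ₗ[k] A) where
  carrier := {f | ∀ a b c : A, a * f b c - f (a * b) c + f a (b * c) - f a b * c = 0}
  zero_mem' := by
    intro a b c
    simp
  add_mem' := by
    intro f g hf hg a b c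
    have h := congrArg₂ (· + ·) (hf a b c) (hg a b c)
    simp only [add_zero] at h
    rw [← h]
    simp only [LinearMap.add_apply, mul_add, add_mul]
    abel
  smul_mem' := by
    intro r f hf a b c
    have h := congrArg (r • ·) (hf a b c)
    simp only [smul_zero] at h
    rw [← h]
    simp only [LinearMap.smul_apply, mul_smul_comm, smul_mul_assoc, smul_sub, smul_add]

/-- Hochschild `2`-coboundaries of `A` with coefficients in `A`. -/
def B2 : Submodule k (A →ₗ[k] A →ₗ[k] A) where
  carrier := {f | ∃ g : A →ₗ[k] A, ∀ a b : A, f a b = a * g b - g (a * b) + g a * b}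
  zero_mem' := ⟨0, by simp⟩
  add_mem' := by
    rintro f f' ⟨g, hg⟩ ⟨g', hg'⟩
    refine ⟨g + g', fun a b => ?_⟩
    simp only [LinearMap.add_apply, mul_add, add_mul, hg, hg']
    abel
  smul_mem' := by
    rintro r f ⟨g, hg⟩
    refine ⟨r • g, fun a b => ?_⟩
    simp only [LinearMap.smul_apply, mul_smul_comm, smul_mul_assoc, smul_sub, smul_add, hg]

theorem B2_le_Z2 : B2 k A ≤ Z2 k A := by
  rintro f ⟨g, hg⟩ a b c
  simp only [hg, mul_add, mul_sub, add_mul, sub_mul, mul_assoc]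
  abel

/-- The second Hochschild cohomology `HH²(A) = HH²(A, A)` of the `k`-algebra `A`. -/
abbrev HH2 : Type _ := Z2 k A ⧸ (B2 k A).submoduleOf (Z2 k A)

end Hochschild

end

/-! Write B = T/I with T the path algebra. T is quasi-free over B: a Hochschild 2-cocycle of B,
pulled back to T, is a coboundary (`liftsCocycles_proj`). Hence HH²(B) is the cokernel of the
restriction map from derivations T → B to bimodule maps I/I² → B (`nonempty_HH2_equiv`). A bimodule
map on I is known by its values on generators, and one generator of each kind per half-edge suffices
(`relIdeal_le_iff`): the zero relation of `h` and `face h`, where `face` = ρ⁻¹ι, and the difference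
of the maximal paths at the two ends of the edge of `h`.

B carries a non-degenerate symmetric trace form, built from an explicit model of its left regular
representation. The resulting expansion `p_zero_mul_eq_sum` turns statements about coefficients of
paths into statements about traces.

Derivations can remove the values on the zero relations except at faces of length two (digons),
where two numbers survive: an idempotent coefficient and a difference of two socle coefficients
(`exists_derivation_relVal_fst`). A bimodule map vanishing on the zero relations takes, up to the
sign of the bipartition, the components of a central element as values on the commutativity
relations (`exists_central_of_relVal_fst_eq_zero`). Conversely explicit operators realise every
central element and every pair of functions on the set D of digons. So HH²(B) is a quotient of Z(B)
⊕ k^D ⊕ k^D.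

What is divided out lies in Z(B). A derivation that vanishes on the zero relations scales the
maximal paths at each vertex by a number, which yields the image of a map from k^V to the socle; in
characteristic 0 all of this image occurs. Its kernel is the line spanned by the bipartition sign,
because the graph is connected. Therefore dim HH² = dim Z(B) + 2|D| - (|V| - 1), where dim Z(B) = 1
+ Σ(m(v) - 1) + |E| (`finrank_center`) and 2|D| is the number of 2-cycles counted in the theorem
(`ncard_twoCycles`).

The argument needs the arrows of digons to lie outside the socle. This fails only for a single edge
with an end of multiplicity 1; then B is a truncated polynomial algebra, and the same cokernel
description with T = k[X] gives the answer. -/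

set_option linter.unusedSectionVars false

/-! ### Second Hochschild cohomology as a cokernel -/

noncomputable section

namespace Hochschild

variable {k T B : Type*} [Field k] [Ring T] [Algebra k T] [Ring B] [Algebra k B]

/-- Linear maps `T → B` whose restriction to the kernel of `π : T → B` is a map of bimodules. -/
def kernelBimodule (π : T →ₐ[k] B) : Submodule k (T →ₗ[k] B) where
  carrier := {t | ∀ x y, π y = 0 → t (x * y) = π x * t y ∧ t (y * x) = t y * π x}
  zero_mem' := by intro x y _; simp
  add_mem' := by
    intro t u ht hu x y hy
    simp only [LinearMap.add_apply, mul_add, add_mul, (ht x y hy).1, (ht x y hy).2,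
      (hu x y hy).1, (hu x y hy).2, and_self]
  smul_mem' := by
    intro c t ht x y hy
    simp only [LinearMap.smul_apply, (ht x y hy).1, (ht x y hy).2, mul_smul_comm, smul_mul_assoc,
      and_self]

/-- Derivations of `T` with values in `B`, where `T` acts through `π : T → B`. -/
def derivations (π : T →ₐ[k] B) : Submodule k (T →ₗ[k] B) where
  carrier := {t | ∀ x y, t (x * y) = π x * t y + t x * π y}
  zero_mem' := by intro x y; simp
  add_mem' := by
    intro t u ht hu x y
    simp only [LinearMap.add_apply, mul_add, add_mul, ht x y, hu x y]
    abel
  smul_mem' := by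
    intro c t ht x y
    simp only [LinearMap.smul_apply, ht x y, mul_smul_comm, smul_mul_assoc, smul_add]

theorem derivations_le_kernelBimodule (π : T →ₐ[k] B) : derivations π ≤ kernelBimodule π := by
  intro t ht x y hy
  simp [ht x y, ht y x, hy]

/-- The algebra `T` over `B` satisfies the lifting property of quasi-free algebras: Hochschild
`2`-cocycles of `B` become coboundaries on `T`. -/
def LiftsCocycles (π : T →ₐ[k] B) : Prop :=
  ∀ f ∈ Z2 k B, ∃ t : T →ₗ[k] B, ∀ x y, f (π x) (π y) = π x * t y - t (x * y) + t x * π y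

/-- The coboundary of a linear map `t`, transported to `B` along a linear section `σ`. -/
def sectionCoboundary (σ : B →ₗ[k] T) : (T →ₗ[k] B) →ₗ[k] (B →ₗ[k] B →ₗ[k] B) where
  toFun t := LinearMap.mk₂ k (fun a b => a * t (σ b) - t (σ a * σ b) + t (σ a) * b)
    (by intro a a' b; simp only [map_add, add_mul]; abel)
    (by intro c a b; simp only [map_smul, smul_mul_assoc, smul_sub, smul_add])
    (by intro a b b'; simp only [map_add, mul_add]; abel)
    (by intro c a b; simp only [map_smul, mul_smul_comm, smul_sub, smul_add])
  map_add' := by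
    intro t u
    ext a b
    simp only [LinearMap.mk₂_apply, LinearMap.add_apply, mul_add, add_mul]
    abel
  map_smul' := by
    intro c t
    ext a b
    simp only [LinearMap.mk₂_apply, LinearMap.smul_apply, mul_smul_comm, smul_mul_assoc, smul_sub,
      smul_add, RingHom.id_apply]

/-- Replacing a lift by another one changes it by an element of `ker π`, on which `t` is a bimodule
map, so the changes of the three terms cancel. Hence the coboundary of `t` descends to B and does
not depend on the section. -/
theorem sectionCoboundary_apply {π : T →ₐ[k] B} {σ : B →ₗ[k] T} (hσ : ∀ b, π (σ b) = b)
    {t : T →ₗ[k] B} (ht : t ∈ kernelBimodule π) (x y : T) :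
    sectionCoboundary σ t (π x) (π y) = π x * t y - t (x * y) + t x * π y := by
  change π x * t (σ (π y)) - t (σ (π x) * σ (π y)) + t (σ (π x)) * π y = _
  have hx : π (σ (π x) - x) = 0 := by rw [map_sub, hσ, sub_self]
  have hy : π (σ (π y) - y) = 0 := by rw [map_sub, hσ, sub_self]
  have h1 := (ht (σ (π x)) _ hy).1
  have h2 := (ht y _ hx).2
  simp only [mul_sub, sub_mul, map_sub, hσ] at h1 h2
  have e : t (σ (π x) * σ (π y)) =
      t (σ (π x) * y) + (π x * t (σ (π y)) - π x * t y) := by rw [← h1]; abel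
  have e' : t (σ (π x) * y) = t (x * y) + (t (σ (π x)) * π y - t x * π y) := by rw [← h2]; abel
  rw [e, e']
  abel

theorem sectionCoboundary_mem_Z2 {π : T →ₐ[k] B} {σ : B →ₗ[k] T} (hσ : ∀ b, π (σ b) = b)
    {t : T →ₗ[k] B} (ht : t ∈ kernelBimodule π) : sectionCoboundary σ t ∈ Z2 k B := by
  intro a b c
  obtain ⟨x, rfl⟩ : ∃ x, π x = a := ⟨_, hσ a⟩
  obtain ⟨y, rfl⟩ : ∃ y, π y = b := ⟨_, hσ b⟩
  obtain ⟨z, rfl⟩ : ∃ z, π z = c := ⟨_, hσ c⟩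
  rw [← map_mul π x y, ← map_mul π y z]
  simp only [sectionCoboundary_apply hσ ht]
  simp only [map_mul, mul_add, mul_sub, add_mul, sub_mul, mul_assoc]
  abel

/-- If the descended cocycle is the coboundary of `g`, then `t - g ∘ π` has zero coboundary on T,
that is, it is a derivation, and it agrees with `t` on the kernel. Conversely `t - D` vanishes on
the kernel and so descends to a suitable `g`. -/
theorem sectionCoboundary_mem_B2 {π : T →ₐ[k] B} {σ : B →ₗ[k] T} (hσ : ∀ b, π (σ b) = b)
    {t : T →ₗ[k] B} (ht : t ∈ kernelBimodule π) :
    sectionCoboundary σ t ∈ B2 k B ↔ ∃ D ∈ derivations π, ∀ y, π y = 0 → t y = D y := by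
  constructor
  · rintro ⟨g, hg⟩
    refine ⟨t - g ∘ₗ π.toLinearMap, ?_, ?_⟩
    · intro x y
      have h := hg (π x) (π y)
      rw [sectionCoboundary_apply hσ ht] at h
      have e : t (x * y) = π x * t y + t x * π y -
          (π x * g (π y) - g (π x * π y) + g (π x) * π y) := by rw [← h]; abel
      simp only [LinearMap.sub_apply, LinearMap.comp_apply, AlgHom.toLinearMap_apply, e, map_mul,
        mul_sub, sub_mul]
      abel
    · intro y hy
      simp [hy]
  · rintro ⟨D, hD, h⟩
    have hDk := derivations_le_kernelBimodule π hD
    refine ⟨(t - D) ∘ₗ σ, fun a b => ?_⟩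
    obtain ⟨x, rfl⟩ : ∃ x, π x = a := ⟨_, hσ a⟩
    obtain ⟨y, rfl⟩ : ∃ y, π y = b := ⟨_, hσ b⟩
    have key : ∀ z, (t - D) (σ (π z)) = (t - D) z := by
      intro z
      have hz : π (σ (π z) - z) = 0 := by rw [map_sub, hσ, sub_self]
      have := h _ hz
      rw [← sub_eq_zero, ← map_sub]
      simp only [LinearMap.sub_apply, this, sub_self]
    rw [sectionCoboundary_apply hσ ht, ← map_mul]
    simp only [LinearMap.comp_apply, key]
    simp only [LinearMap.sub_apply, hD x y, mul_sub, sub_mul]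
    abel

/-- If the values of linear maps on generators of `ker π` are recorded by `val`, and those of
bimodule maps are, up to derivations, parametrised by `θ`, then `HH²(B)` is the quotient of the
space of parameters by the parameters of derivations. -/
theorem nonempty_HH2_equiv {π : T →ₐ[k] B} (hπ : Function.Surjective π) (hfree : LiftsCocycles π)
    {P Q : Type*} [AddCommGroup P] [Module k P] [AddCommGroup Q] [Module k Q]
    (val : (T →ₗ[k] B) →ₗ[k] P) (θ : Q →ₗ[k] P)
    (hval : ∀ t ∈ kernelBimodule π, val t = 0 ↔ ∀ y, π y = 0 → t y = 0)
    (hθ : ∀ q, ∃ t ∈ kernelBimodule π, val t = θ q)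
    (hred : ∀ t ∈ kernelBimodule π, ∃ D ∈ derivations π, ∃ q, val t = val D + θ q) :
    Nonempty (HH2 k B ≃ₗ[k] (Q ⧸ ((derivations π).map val).comap θ)) := by
  obtain ⟨σ, hσ'⟩ := LinearMap.exists_rightInverse_of_surjective π.toLinearMap
    (LinearMap.range_eq_top.2 hπ)
  have hσ : ∀ b, π (σ b) = b := fun b => LinearMap.congr_fun hσ' b
  let toZ : kernelBimodule π →ₗ[k] Z2 k B :=
    (sectionCoboundary σ ∘ₗ (kernelBimodule π).subtype).codRestrict _
      fun t => sectionCoboundary_mem_Z2 hσ t.2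
  let F : kernelBimodule π →ₗ[k] HH2 k B := Submodule.mkQ _ ∘ₗ toZ
  let G : kernelBimodule π →ₗ[k] P ⧸ (derivations π).map val :=
    Submodule.mkQ _ ∘ₗ val ∘ₗ (kernelBimodule π).subtype
  let θ' : Q →ₗ[k] P ⧸ (derivations π).map val := Submodule.mkQ _ ∘ₗ θ
  have hF : Function.Surjective F := by
    intro c
    obtain ⟨⟨f, hf⟩, rfl⟩ := Submodule.mkQ_surjective _ c
    obtain ⟨t, ht⟩ := hfree f hf
    have htk : t ∈ kernelBimodule π := by
      intro x y hy
      have h1 := ht x y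
      have h2 := ht y x
      simp only [hy, map_zero, mul_zero, zero_mul, LinearMap.zero_apply, add_zero,
        zero_sub] at h1 h2
      exact ⟨(sub_eq_zero.1 h1.symm).symm, (neg_add_eq_zero.1 h2.symm)⟩
    refine ⟨⟨t, htk⟩, ?_⟩
    change Submodule.mkQ _ (toZ ⟨t, htk⟩) = _
    congr 1
    ext a b
    obtain ⟨x, rfl⟩ := hπ a
    obtain ⟨y, rfl⟩ := hπ b
    change sectionCoboundary σ t (π x) (π y) = f (π x) (π y)
    rw [sectionCoboundary_apply hσ htk, ht]
  have hker : LinearMap.ker F = LinearMap.ker G := by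
    ext ⟨t, ht⟩
    rw [LinearMap.mem_ker, LinearMap.mem_ker]
    change Submodule.mkQ _ (toZ ⟨t, ht⟩) = 0 ↔ Submodule.mkQ _ (val t) = 0
    rw [Submodule.mkQ_apply, Submodule.Quotient.mk_eq_zero, Submodule.mkQ_apply,
      Submodule.Quotient.mk_eq_zero]
    change sectionCoboundary σ t ∈ B2 k B ↔ _
    rw [sectionCoboundary_mem_B2 hσ ht, Submodule.mem_map]
    refine exists_congr fun D => and_congr_right fun hD => ?_
    have hDk := derivations_le_kernelBimodule π hD
    have := hval (t - D) (sub_mem ht hDk)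
    rw [map_sub, sub_eq_zero] at this
    rw [eq_comm (a := val D), this]
    simp only [LinearMap.sub_apply, sub_eq_zero]
  have hrange : LinearMap.range G = LinearMap.range θ' := by
    apply le_antisymm
    · rintro _ ⟨⟨t, ht⟩, rfl⟩
      obtain ⟨D, hD, q, hq⟩ := hred t ht
      refine ⟨q, ?_⟩
      change Submodule.mkQ _ (θ q) = Submodule.mkQ _ (val t)
      rw [eq_comm, ← sub_eq_zero, ← map_sub, Submodule.mkQ_apply, Submodule.Quotient.mk_eq_zero, hq,
        add_sub_cancel_right]
      exact ⟨D, hD, rfl⟩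
    · rintro _ ⟨q, rfl⟩
      obtain ⟨t, ht, h⟩ := hθ q
      refine ⟨⟨t, ht⟩, ?_⟩
      change Submodule.mkQ _ (val t) = Submodule.mkQ _ (θ q)
      rw [h]
  have hker' : LinearMap.ker θ' = ((derivations π).map val).comap θ := by
    rw [LinearMap.ker_comp, Submodule.ker_mkQ]
  exact ⟨(F.quotKerEquivOfSurjective hF).symm ≪≫ₗ Submodule.quotEquivOfEq _ _ hker ≪≫ₗ
    G.quotKerEquivRange ≪≫ₗ LinearEquiv.ofEq _ _ hrange ≪≫ₗ θ'.quotKerEquivRange.symm ≪≫ₗ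
    Submodule.quotEquivOfEq _ _ hker'⟩

end Hochschild

end

/-! ### Paths around a vertex in the path algebra -/

noncomputable section

namespace RibbonGraph

variable {V H : Type*} (Γ : RibbonGraph V H)

theorem edge_eq_edge_iff {h h' : H} : Γ.edge h = Γ.edge h' ↔ h' = h ∨ h' = Γ.ι h := by
  refine (Subtype.ext_iff (p := fun x => x ∈ Set.range fun h : H => s(h, Γ.ι h))
    (a1 := Γ.edge h) (a2 := Γ.edge h')).trans (Sym2.eq_iff.trans ?_)
  constructor
  · rintro (⟨rfl, _⟩ | ⟨rfl, h2⟩)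
    · exact Or.inl rfl
    · exact Or.inr h2.symm
  · rintro (rfl | rfl)
    · exact Or.inl ⟨rfl, rfl⟩
    · exact Or.inr ⟨(Γ.ι_involutive h).symm, rfl⟩

theorem edge_ι (h : H) : Γ.edge (Γ.ι h) = Γ.edge h :=
  (Γ.edge_eq_edge_iff.2 (Or.inr rfl)).symm

theorem edge_surjective : Function.Surjective Γ.edge := by
  rintro ⟨_, h, rfl⟩
  exact ⟨h, rfl⟩

theorem s_ρ (h : H) : Γ.s (Γ.ρ h) = Γ.s h :=
  ((Γ.sameCycle_iff _ _).1
    (Equiv.Perm.sameCycle_apply_right.2 (Equiv.Perm.SameCycle.refl _ _))).symm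

theorem s_ρ_pow (h : H) (j : ℕ) : Γ.s ((Γ.ρ ^ j) h) = Γ.s h := by
  induction j with
  | zero => rfl
  | succ j ih => rw [pow_succ', Equiv.Perm.mul_apply, s_ρ, ih]

section Algebra

variable (k : Type*) [Field k]

/-- The idempotent of `k Q_Γ` at an edge. -/
def idem (i : Γ.Edge) : PathAlgebra k Γ.Edge :=
  PathAlgebra.ofPath k (Quiver.Path.nil : Quiver.Path i i)

theorem arrow_mul_ofPath {a b : Γ.Edge} (q : Quiver.Path a b) (h : H) (hb : b = Γ.edge h) :
    Γ.arrow k h * PathAlgebra.ofPath k q =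
      PathAlgebra.ofPath k (q.cons (⟨h, hb.symm, rfl⟩ : b ⟶ Γ.edge (Γ.ρ h))) := by
  subst hb
  exact PathAlgebra.ofPath_mul_comp _ _

variable [Finite H]

theorem idem_mul_self (i : Γ.Edge) : Γ.idem k i * Γ.idem k i = Γ.idem k i :=
  PathAlgebra.ofPath_mul_comp _ _

theorem idem_mul_of_ne {i j : Γ.Edge} (h : i ≠ j) : Γ.idem k i * Γ.idem k j = 0 :=
  PathAlgebra.ofPath_mul_of_ne _ _ h.symm

theorem sum_idem : ∑ i, Γ.idem k i = 1 := rfl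

theorem idem_mul_arrow (h : H) : Γ.idem k (Γ.edge (Γ.ρ h)) * Γ.arrow k h = Γ.arrow k h :=
  PathAlgebra.ofPath_mul_comp _ _

theorem arrow_mul_idem (h : H) : Γ.arrow k h * Γ.idem k (Γ.edge h) = Γ.arrow k h :=
  PathAlgebra.ofPath_mul_comp _ _

variable {k}

theorem pathAlgebra_induction {P : PathAlgebra k Γ.Edge → Prop}
    (hzero : P 0) (hadd : ∀ x y, P x → P y → P (x + y)) (hsmul : ∀ (c : k) x, P x → P (c • x))
    (hidem : ∀ i, P (Γ.idem k i)) (harrow : ∀ h x, P x → P (Γ.arrow k h * x))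
    (x : PathAlgebra k Γ.Edge) : P x := by
  induction x using PathAlgebra.induction with
  | h0 => exact hzero
  | hadd x y hx hy => exact hadd x y hx hy
  | @hpath c a b p =>
    refine hsmul c _ ?_
    induction p with
    | nil => exact hidem a
    | cons q α ih =>
      obtain ⟨h, h1, rfl⟩ := α
      rw [← Γ.arrow_mul_ofPath k q h h1.symm]
      exact harrow h _ ih

/-- A function on paths, given by its values on trivial paths and by an operator for every
arrow. -/
def pathRec {N : Type*} (v : Γ.Edge → N) (A : H → N → N) {a : Γ.Edge} :
    ∀ {b : Γ.Edge}, Quiver.Path a b → N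
  | _, .nil => v a
  | _, .cons q α => A (show {_h : H // _} from α).1 (pathRec v A q)

/-- Linear maps out of the path algebra, defined by recursion on paths. -/
theorem exists_rec {N : Type*} [AddCommGroup N] [Module k N] (v : Γ.Edge → N) (A : H → N →ₗ[k] N)
    (E : Γ.Edge → N →ₗ[k] N) (hE : ∀ i j x, i ≠ j → E i (E j x) = 0) (hv : ∀ i, E i (v i) = v i)
    (hA : ∀ h x, E (Γ.edge (Γ.ρ h)) (A h x) = A h x)
    (hA' : ∀ h i x, i ≠ Γ.edge h → A h (E i x) = 0) :
    ∃ F : PathAlgebra k Γ.Edge →ₗ[k] N, (∀ i, F (Γ.idem k i) = v i) ∧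
      (∀ h x, F (Γ.arrow k h * x) = A h (F x)) ∧ ∀ i x, F (Γ.idem k i * x) = E i (F x) := by
  let F : PathAlgebra k Γ.Edge →ₗ[k] N :=
    Finsupp.linearCombination k fun q : (Σ a b : Γ.Edge, Quiver.Path a b) =>
      Γ.pathRec v (fun h => A h) q.2.2
  have hF : ∀ {a b : Γ.Edge} (q : Quiver.Path a b),
      F (PathAlgebra.ofPath k q) = Γ.pathRec v (fun h => A h) q :=
    fun q => (Finsupp.linearCombination_single k (1 : k) _).trans (one_smul k _)
  -- The value at a path lies in the image of the operator `E` of its terminus. Together with `hE`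
  -- and `hA'` this makes the recursion give zero when the next factor is not composable.
  have hS : ∀ {a b : Γ.Edge} (q : Quiver.Path a b),
      E b (Γ.pathRec v (fun h => A h) q) = Γ.pathRec v (fun h => A h) q := by
    intro a b q
    cases q with
    | nil => exact hv a
    | cons q α =>
      obtain ⟨h, h1, rfl⟩ := α
      exact hA h _
  refine ⟨F, fun i => hF _, fun h x => ?_, fun i x => ?_⟩
  · induction x using PathAlgebra.induction with
    | h0 => rw [mul_zero, map_zero, map_zero]
    | hadd x y hx hy => rw [mul_add, map_add, map_add, map_add, hx, hy]
    | @hpath c a b q =>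
      rw [mul_smul_comm, map_smul, map_smul, map_smul]
      congr 1
      by_cases hb : b = Γ.edge h
      · rw [Γ.arrow_mul_ofPath k q h hb, hF, hF]
        rfl
      · rw [show Γ.arrow k h * PathAlgebra.ofPath k q = 0 from
          PathAlgebra.ofPath_mul_of_ne _ _ hb, map_zero, hF, ← hS, hA' h b _ hb]
  · induction x using PathAlgebra.induction with
    | h0 => rw [mul_zero, map_zero, map_zero]
    | hadd x y hx hy => rw [mul_add, map_add, map_add, map_add, hx, hy]
    | @hpath c a b q =>
      rw [mul_smul_comm, map_smul, map_smul, map_smul]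
      congr 1
      by_cases hb : b = i
      · subst hb
        rw [show Γ.idem k b * PathAlgebra.ofPath k q = PathAlgebra.ofPath k q from
          PathAlgebra.ofPath_mul_comp _ _, hF, hS]
      · rw [show Γ.idem k i * PathAlgebra.ofPath k q = 0 from
          PathAlgebra.ofPath_mul_of_ne _ _ hb, map_zero, hF, ← hS, hE i b _ (Ne.symm hb)]

variable (k)

/-- The path of length `j` around a vertex which starts with the arrow of `h`. -/
def path (h : H) : ℕ → PathAlgebra k Γ.Edge
  | 0 => Γ.idem k (Γ.edge h)
  | j + 1 => Γ.arrow k ((Γ.ρ ^ j) h) * path h j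

theorem path_zero (h : H) : Γ.path k h 0 = Γ.idem k (Γ.edge h) := rfl

theorem path_succ (h : H) (j : ℕ) :
    Γ.path k h (j + 1) = Γ.arrow k ((Γ.ρ ^ j) h) * Γ.path k h j := rfl

theorem path_one (h : H) : Γ.path k h 1 = Γ.arrow k h := Γ.arrow_mul_idem k h

theorem idem_mul_path (h : H) (j : ℕ) :
    Γ.idem k (Γ.edge ((Γ.ρ ^ j) h)) * Γ.path k h j = Γ.path k h j := by
  cases j with
  | zero => exact Γ.idem_mul_self k _
  | succ j => rw [path_succ, ← mul_assoc, pow_succ', Equiv.Perm.mul_apply, idem_mul_arrow]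

theorem path_mul_path (h : H) (i j : ℕ) :
    Γ.path k ((Γ.ρ ^ i) h) j * Γ.path k h i = Γ.path k h (i + j) := by
  induction j with
  | zero => rw [path_zero, idem_mul_path, add_zero]
  | succ j ih =>
    rw [path_succ, mul_assoc, ih, ← add_assoc, path_succ, ← Equiv.Perm.mul_apply, ← pow_add,
      add_comm j i]

theorem path_mul_arrow (h : H) (j : ℕ) :
    Γ.path k (Γ.ρ h) j * Γ.arrow k h = Γ.path k h (j + 1) := by
  rw [← path_one, add_comm j 1, ← path_mul_path, pow_one]

theorem path_mul_idem (h : H) (j : ℕ) :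
    Γ.path k h j * Γ.idem k (Γ.edge h) = Γ.path k h j := by
  rw [← path_zero]
  simpa using Γ.path_mul_path k h 0 j

theorem ρ_pow_eq_self_iff {h : H} {j : ℕ} : (Γ.ρ ^ j) h = h ↔ Γ.val (Γ.s h) ∣ j := by
  classical
  have := Fintype.ofFinite H
  have hc : Γ.ρ.IsCycleOn ((Finset.univ.filter fun x => Γ.s x = Γ.s h : Finset H) : Set H) := by
    refine ⟨⟨?_, Γ.ρ.injective.injOn, ?_⟩, ?_⟩
    · intro x hx
      simpa [Γ.s_ρ] using hx
    · intro x hx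
      refine ⟨Γ.ρ.symm x, ?_, Γ.ρ.apply_symm_apply x⟩
      have e := Γ.s_ρ (Γ.ρ.symm x)
      rw [Γ.ρ.apply_symm_apply] at e
      simpa [← e] using hx
    · intro x hx y hy
      rw [Γ.sameCycle_iff]
      simp only [Finset.coe_filter, Finset.mem_univ, true_and, Set.mem_ofPred_eq] at hx hy
      rw [hx, hy]
  rw [hc.pow_apply_eq (by simp), val, Nat.card_eq_fintype_card, Fintype.card_subtype]

theorem ρ_pow_val (h : H) : (Γ.ρ ^ Γ.val (Γ.s h)) h = h := Γ.ρ_pow_eq_self_iff.2 dvd_rfl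

theorem val_pos (h : H) : 0 < Γ.val (Γ.s h) :=
  have : Nonempty {h' : H // Γ.s h' = Γ.s h} := ⟨⟨h, rfl⟩⟩
  Nat.card_pos

theorem cycle_eq_path (h : H) : Γ.cycle k h = Γ.path k (Γ.ρ h) (Γ.val (Γ.s h)) := by
  -- The idempotent in front is needed for the induction: an empty product is 1, whereas the path of
  -- length 0 is the idempotent of one edge.
  have key : ∀ l, Γ.idem k (Γ.edge (Γ.ρ h)) *
      ((List.range l).map fun i => Γ.arrow k ((Γ.ρ⁻¹ ^ i) h)).prod =
        Γ.path k ((Γ.ρ⁻¹ ^ l) (Γ.ρ h)) l := by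
    intro l
    induction l with
    | zero => simp [path_zero]
    | succ l ih =>
      rw [List.range_succ, List.map_append, List.prod_append, ← mul_assoc, ih, List.map_singleton,
        List.prod_singleton]
      have e : (Γ.ρ⁻¹ ^ l) (Γ.ρ h) = Γ.ρ ((Γ.ρ⁻¹ ^ l) h) := by
        rw [← Equiv.Perm.mul_apply, ← Equiv.Perm.mul_apply]
        congr 1
        exact ((Commute.refl Γ.ρ).inv_left.pow_left l).eq
      have e' : (Γ.ρ⁻¹ ^ (l + 1)) (Γ.ρ h) = (Γ.ρ⁻¹ ^ l) h := by
        rw [pow_succ, Equiv.Perm.mul_apply]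
        simp
      rw [e, e', path_mul_arrow]
  have h1 := key (Γ.val (Γ.s h))
  have e : (Γ.ρ⁻¹ ^ Γ.val (Γ.s h)) (Γ.ρ h) = Γ.ρ h := by
    rw [inv_pow, Equiv.Perm.inv_eq_iff_eq]
    conv_rhs => rw [← Γ.s_ρ h, ρ_pow_val]
  rw [e] at h1
  rw [← h1, cycle]
  obtain ⟨l, hl⟩ := Nat.exists_eq_succ_of_ne_zero (Γ.val_pos h).ne'
  rw [hl, List.range_succ_eq_map, List.map_cons, List.prod_cons, ← mul_assoc, pow_zero,
    Equiv.Perm.one_apply, idem_mul_arrow]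

end Algebra

end RibbonGraph

end

/-! ### Generators of the ideal and multiplication of paths in the quotient -/

noncomputable section

namespace BrauerGraph

variable {V H : Type*} (k : Type*) [Field k] [Finite H] (Γ : BrauerGraph V H)

/-- The length of the cycles `C_α ^ m(C_α)` at the vertex of `h`. -/
def len (h : H) : ℕ := Γ.val (Γ.s h) * Γ.m (Γ.s h)

theorem len_pos (h : H) : 0 < Γ.len h := Nat.mul_pos (Γ.val_pos h) (Γ.m_pos _)

theorem len_eq_of_s_eq {h h' : H} (e : Γ.s h = Γ.s h') : Γ.len h = Γ.len h' := by
  rw [len, len, e]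

theorem len_ρ (h : H) : Γ.len (Γ.ρ h) = Γ.len h := Γ.len_eq_of_s_eq (Γ.s_ρ h)

theorem len_ρ_pow (h : H) (j : ℕ) : Γ.len ((Γ.ρ ^ j) h) = Γ.len h :=
  Γ.len_eq_of_s_eq (Γ.s_ρ_pow h j)

theorem ρ_pow_len (h : H) : (Γ.ρ ^ Γ.len h) h = h := Γ.ρ_pow_eq_self_iff.2 (Dvd.intro _ rfl)

/-- The permutation of the half-edges whose cycles are the faces. -/
def face (h : H) : H := Γ.ρ.symm (Γ.ι h)

theorem ρ_face (h : H) : Γ.ρ (Γ.face h) = Γ.ι h := Γ.ρ.apply_symm_apply _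

theorem ι_ρ_face (h : H) : Γ.ι (Γ.ρ (Γ.face h)) = h := by rw [ρ_face, Γ.ι_involutive]

theorem face_ι_ρ (h : H) : Γ.face (Γ.ι (Γ.ρ h)) = h := by
  rw [face, Γ.ι_involutive, Equiv.symm_apply_apply]

theorem face_injective : Function.Injective Γ.face :=
  Γ.ρ.symm.injective.comp Γ.ι_involutive.injective

theorem face_eq_iff {h h' : H} : Γ.face h = h' ↔ Γ.ι h = Γ.ρ h' := Γ.ρ.symm_apply_eq

theorem len_face (h : H) : Γ.len (Γ.face h) = Γ.len (Γ.ι h) := by rw [← len_ρ, ρ_face]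

theorem cycle_pow_eq_path (h : H) (l : ℕ) :
    Γ.cycle k h ^ (l + 1) = Γ.path k (Γ.ρ h) (Γ.val (Γ.s h) * (l + 1)) := by
  induction l with
  | zero => rw [zero_add, pow_one, mul_one, Γ.cycle_eq_path]
  | succ l ih =>
    rw [pow_succ', ih, Γ.cycle_eq_path, mul_add _ (l + 1) 1, mul_one, ← Γ.path_mul_path]
    congr 2
    rw [eq_comm, Γ.ρ_pow_eq_self_iff, Γ.s_ρ]
    exact Dvd.intro _ rfl

theorem cycle_pow_m (h : H) : Γ.cycle k h ^ Γ.m (Γ.s h) = Γ.path k (Γ.ρ h) (Γ.len (Γ.ρ h)) := by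
  obtain ⟨l, hl⟩ := Nat.exists_eq_succ_of_ne_zero (Γ.m_pos (Γ.s h)).ne'
  rw [len, Γ.s_ρ, hl, cycle_pow_eq_path]

/-- The projection from the path algebra to the Brauer graph algebra. -/
def proj : PathAlgebra k Γ.Edge →ₐ[k] Γ.Alg k := (Γ.relIdeal k).ringCon.mkₐ k

theorem proj_surjective : Function.Surjective (Γ.proj k) := RingCon.mkₐ_surjective _

variable {k} in
theorem proj_eq_zero_iff {x : PathAlgebra k Γ.Edge} : Γ.proj k x = 0 ↔ x ∈ Γ.relIdeal k := by
  rw [TwoSidedIdeal.mem_iff]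
  exact (Γ.relIdeal k).ringCon.eq

/-- The elements of the ideal `I_Γ`, from generators attached to half-edges. -/
theorem relIdeal_le_iff {K : TwoSidedIdeal (PathAlgebra k Γ.Edge)} :
    Γ.relIdeal k ≤ K ↔ (∀ h, Γ.arrow k h * Γ.arrow k (Γ.face h) ∈ K) ∧
      ∀ h, Γ.path k h (Γ.len h) - Γ.path k (Γ.ι h) (Γ.len (Γ.ι h)) ∈ K := by
  rw [relIdeal, TwoSidedIdeal.span_le]
  constructor
  · intro hK
    refine ⟨fun h => hK ?_, fun h => hK ?_⟩
    · refine Relation.zero h _ (by rw [ρ_face, Γ.edge_ι]) fun e => ?_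
      have := congrArg Γ.ρ e
      rw [ρ_face] at this
      exact Γ.ι_ne h (by simpa using this)
    · have := Relation.comm (k := k) (Γ := Γ) (Γ.ρ.symm h) (Γ.ρ.symm (Γ.ι h))
        (by simp [Γ.edge_ι])
      rw [cycle_pow_m, cycle_pow_m] at this
      simpa using this
  · rintro ⟨h1, h2⟩ x hx
    cases hx with
    | zero h h' hcomp hne =>
      rcases Γ.edge_eq_edge_iff.1 hcomp with e | e
      · refine absurd ?_ hne
        rw [e]
        simp
      · have : h' = Γ.face h := by
          rw [eq_comm, face_eq_iff, e, Γ.ι_involutive]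
        rw [this]
        exact h1 h
    | comm h h' ht =>
      rw [cycle_pow_m, cycle_pow_m]
      rcases Γ.edge_eq_edge_iff.1 ht with e | e
      · rw [e, sub_self]
        exact zero_mem K
      · rw [e]
        exact h2 _

/-- The image in `B_Γ` of the path of length `j` around a vertex starting with the arrow of `h`. -/
def p (h : H) (j : ℕ) : Γ.Alg k := Γ.proj k (Γ.path k h j)

theorem proj_path (h : H) (j : ℕ) : Γ.proj k (Γ.path k h j) = Γ.p k h j := rfl

theorem proj_arrow (h : H) : Γ.proj k (Γ.arrow k h) = Γ.p k h 1 := by rw [p, Γ.path_one]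

theorem proj_idem (h : H) : Γ.proj k (Γ.idem k (Γ.edge h)) = Γ.p k h 0 := rfl

theorem p_zero_congr {h h' : H} (e : Γ.edge h = Γ.edge h') : Γ.p k h 0 = Γ.p k h' 0 := by
  rw [p, p, Γ.path_zero, Γ.path_zero, e]

theorem p_ι_zero (h : H) : Γ.p k (Γ.ι h) 0 = Γ.p k h 0 := Γ.p_zero_congr k (Γ.edge_ι h)

theorem p_mul_p {h h' : H} {i : ℕ} (e : (Γ.ρ ^ i) h' = h) (j : ℕ) :
    Γ.p k h j * Γ.p k h' i = Γ.p k h' (i + j) := by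
  subst e
  rw [p, p, ← map_mul, Γ.path_mul_path, p]

theorem p_one_mul {h h' : H} {i : ℕ} (e : (Γ.ρ ^ i) h' = h) :
    Γ.p k h 1 * Γ.p k h' i = Γ.p k h' (i + 1) := Γ.p_mul_p k e 1

theorem p_zero_mul_of_edge_eq {h h' : H} {i : ℕ} (e : Γ.edge h = Γ.edge ((Γ.ρ ^ i) h')) :
    Γ.p k h 0 * Γ.p k h' i = Γ.p k h' i := by
  rw [Γ.p_zero_congr k e, Γ.p_mul_p k rfl, add_zero]

theorem p_zero_mul_of_edge_ne {h h' : H} {i : ℕ} (e : Γ.edge h ≠ Γ.edge ((Γ.ρ ^ i) h')) :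
    Γ.p k h 0 * Γ.p k h' i = 0 := by
  rw [← Γ.p_zero_mul_of_edge_eq k (h := (Γ.ρ ^ i) h') rfl, ← mul_assoc]
  rw [show Γ.p k h 0 * Γ.p k ((Γ.ρ ^ i) h') 0 = 0 by
    rw [p, p, ← map_mul, Γ.path_zero, Γ.path_zero, Γ.idem_mul_of_ne k e, map_zero], zero_mul]

theorem p_mul_zero_of_edge_eq {h h' : H} (e : Γ.edge h = Γ.edge h') (j : ℕ) :
    Γ.p k h j * Γ.p k h' 0 = Γ.p k h j := by
  rw [← Γ.p_zero_congr k e, Γ.p_mul_p k (show (Γ.ρ ^ 0) h = h from rfl), zero_add]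

theorem p_mul_zero_of_edge_ne {h h' : H} (e : Γ.edge h ≠ Γ.edge h') (j : ℕ) :
    Γ.p k h j * Γ.p k h' 0 = 0 := by
  rw [← Γ.p_mul_zero_of_edge_eq k (h' := h) rfl, mul_assoc,
    Γ.p_zero_mul_of_edge_ne k (i := 0) e, mul_zero]

theorem p_one_mul_p_one {h h' : H} (e : Γ.ρ h' ≠ h) : Γ.p k h 1 * Γ.p k h' 1 = 0 := by
  by_cases h1 : Γ.edge h = Γ.edge (Γ.ρ h')
  · rcases Γ.edge_eq_edge_iff.1 h1 with h2 | h2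
    · exact absurd h2 e
    · have : h' = Γ.face h := by rw [eq_comm, face_eq_iff, h2]
      rw [this, ← proj_arrow, ← proj_arrow, ← map_mul, proj_eq_zero_iff]
      exact ((Γ.relIdeal_le_iff k).1 le_rfl).1 h
  · rw [← Γ.p_mul_zero_of_edge_eq k (h := h) rfl, mul_assoc,
      Γ.p_zero_mul_of_edge_ne k (i := 1) h1, mul_zero]

theorem p_mul_p_of_ne {h h' : H} {i j : ℕ} (e : (Γ.ρ ^ i) h' ≠ h) (hi : 0 < i) (hj : 0 < j) :
    Γ.p k h j * Γ.p k h' i = 0 := by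
  obtain ⟨i, rfl⟩ := Nat.exists_eq_succ_of_ne_zero hi.ne'
  obtain ⟨j, rfl⟩ := Nat.exists_eq_succ_of_ne_zero hj.ne'
  rw [Nat.succ_eq_add_one, Nat.succ_eq_add_one, add_comm j 1, ← Γ.p_mul_p k (i := 1) rfl,
    ← Γ.p_one_mul k (i := i) rfl, mul_assoc, ← mul_assoc (Γ.p k h 1), p_one_mul_p_one, zero_mul,
    mul_zero]
  rwa [← Equiv.Perm.mul_apply, ← pow_succ']

theorem p_len (h : H) : Γ.p k (Γ.ι h) (Γ.len (Γ.ι h)) = Γ.p k h (Γ.len h) := by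
  rw [eq_comm, ← sub_eq_zero, p, p, ← map_sub, proj_eq_zero_iff]
  exact ((Γ.relIdeal_le_iff k).1 le_rfl).2 h

/-- The maximal path at `h` equals the one at `ι h`; continuing it by an arrow around the vertex of
`h` then meets a zero relation. -/
theorem p_eq_zero {h : H} {j : ℕ} (hj : Γ.len h < j) : Γ.p k h j = 0 := by
  obtain ⟨i, rfl⟩ := Nat.exists_eq_add_of_lt hj
  rw [add_assoc, ← Γ.p_mul_p k (Γ.ρ_pow_len h), ← p_len,
    p_mul_p_of_ne k Γ _ (Γ.len_pos _) (Nat.succ_pos _)]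
  rw [ρ_pow_len]
  exact Γ.ι_ne h

theorem sum_idem_eq_one : ∑ i, Γ.proj k (Γ.idem k i) = 1 := by
  rw [← map_sum, Γ.sum_idem, map_one]

variable {k} in
theorem alg_induction {P : Γ.Alg k → Prop} (hzero : P 0) (hadd : ∀ x y, P x → P y → P (x + y))
    (hsmul : ∀ (c : k) x, P x → P (c • x)) (hp : ∀ h j, j ≤ Γ.len h → P (Γ.p k h j))
    (b : Γ.Alg k) : P b := by
  have hp' : ∀ h j, P (Γ.p k h j) := by
    intro h j
    rcases le_or_gt j (Γ.len h) with hj | hj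
    · exact hp h j hj
    · rwa [Γ.p_eq_zero k hj]
  have key : b ∈ Submodule.span k {x | ∃ h j, x = Γ.p k h j} := by
    obtain ⟨x, rfl⟩ := Γ.proj_surjective k b
    induction x using Γ.pathAlgebra_induction with
    | hzero => rw [map_zero]; exact zero_mem _
    | hadd x y hx hy => rw [map_add]; exact add_mem hx hy
    | hsmul c x hx => rw [map_smul]; exact Submodule.smul_mem _ _ hx
    | hidem i =>
      obtain ⟨h, rfl⟩ := Γ.edge_surjective i
      exact Submodule.subset_span ⟨h, 0, rfl⟩
    | harrow h x hx =>
      rw [map_mul, proj_arrow]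
      refine Submodule.span_induction ?_ ?_ ?_ ?_ hx
      · rintro _ ⟨h', j, rfl⟩
        rcases Nat.eq_zero_or_pos j with rfl | hj
        · by_cases e : Γ.edge h = Γ.edge h'
          · rw [p_mul_zero_of_edge_eq k Γ e]
            exact Submodule.subset_span ⟨h, 1, rfl⟩
          · rw [p_mul_zero_of_edge_ne k Γ e]
            exact zero_mem _
        · by_cases e : (Γ.ρ ^ j) h' = h
          · rw [p_one_mul k Γ e]
            exact Submodule.subset_span ⟨h', _, rfl⟩
          · rw [p_mul_p_of_ne k Γ e hj one_pos]
            exact zero_mem _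
      · rw [mul_zero]; exact zero_mem _
      · intro x y _ _ hx hy; rw [mul_add]; exact add_mem hx hy
      · intro c x _ hx; rw [mul_smul_comm]; exact Submodule.smul_mem _ _ hx
  refine Submodule.span_induction ?_ hzero (fun x y _ _ => hadd x y) (fun c x _ => hsmul c x) key
  rintro _ ⟨h, j, rfl⟩
  exact hp' h j

end BrauerGraph

end

/-! ### An explicit model of the left regular representation -/

noncomputable section

namespace BrauerGraph

variable {V H : Type*} (k : Type*) [Field k] [Finite H] (Γ : BrauerGraph V H)

/-- Linear functionals on the path algebra which vanish on `I_Γ` descend to `B_Γ`. -/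
theorem exists_factor {N : Type*} [AddCommGroup N] [Module k N]
    (f : PathAlgebra k Γ.Edge →ₗ[k] N) (hf : ∀ x ∈ Γ.relIdeal k, f x = 0) :
    ∃ g : Γ.Alg k →ₗ[k] N, ∀ x, g (Γ.proj k x) = f x := by
  obtain ⟨σ, hσ⟩ := LinearMap.exists_rightInverse_of_surjective (Γ.proj k).toLinearMap
    (LinearMap.range_eq_top.2 (Γ.proj_surjective k))
  refine ⟨f ∘ₗ σ, fun x => ?_⟩
  have h1 : Γ.proj k (σ (Γ.proj k x)) = Γ.proj k x := LinearMap.congr_fun hσ _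
  rw [LinearMap.comp_apply, ← sub_eq_zero, ← map_sub]
  exact hf _ (Γ.proj_eq_zero_iff.1 (by rw [map_sub, h1, sub_self]))

section Regular

open Classical in
/-- The basis vector of the left regular representation given by a path around a vertex. The index
set consists of the trivial paths, the socle elements and the paths in between. -/
def regVec (h : H) (j : ℕ) : Γ.Edge ⊕ Γ.Edge ⊕ H × ℕ →₀ k :=
  if j = 0 then Finsupp.single (.inl (Γ.edge h)) 1
  else if j < Γ.len h then Finsupp.single (.inr (.inr (h, j))) 1
  else if j = Γ.len h then Finsupp.single (.inr (.inl (Γ.edge h))) 1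
  else 0

open Classical in
/-- The action of an arrow in the left regular representation. -/
def regArrow (h : H) :
    (Γ.Edge ⊕ Γ.Edge ⊕ H × ℕ →₀ k) →ₗ[k] (Γ.Edge ⊕ Γ.Edge ⊕ H × ℕ →₀ k) :=
  Finsupp.linearCombination k fun
    | .inl i => if i = Γ.edge h then Γ.regVec k h 1 else 0
    | .inr (.inl _) => 0
    | .inr (.inr (h', j)) => if (Γ.ρ ^ j) h' = h then Γ.regVec k h' (j + 1) else 0

open Classical in
theorem regArrow_regVec_zero (h h' : H) : Γ.regArrow k h (Γ.regVec k h' 0) =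
    if Γ.edge h' = Γ.edge h then Γ.regVec k h 1 else 0 := by
  rw [regVec, if_pos rfl, regArrow, Finsupp.linearCombination_single, one_smul]

theorem regVec_of_len_lt {h : H} {j : ℕ} (hj : Γ.len h < j) : Γ.regVec k h j = 0 := by
  rw [regVec, if_neg (by omega), if_neg (by omega), if_neg (by omega)]

open Classical in
theorem regArrow_regVec_of_pos (h h' : H) {j : ℕ} (hj : 0 < j) :
    Γ.regArrow k h (Γ.regVec k h' j) =
      if (Γ.ρ ^ j) h' = h then Γ.regVec k h' (j + 1) else 0 := by
  rcases lt_trichotomy j (Γ.len h') with h1 | h1 | h1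
  · rw [regVec, if_neg hj.ne', if_pos h1, regArrow, Finsupp.linearCombination_single, one_smul]
  · rw [regVec, if_neg hj.ne', if_neg h1.not_lt, if_pos h1, regArrow,
      Finsupp.linearCombination_single, smul_zero, Γ.regVec_of_len_lt k (by omega), ite_self]
  · rw [Γ.regVec_of_len_lt k h1, map_zero, Γ.regVec_of_len_lt k (by omega), ite_self]

theorem regArrow_regVec_self (h : H) (j : ℕ) :
    Γ.regArrow k ((Γ.ρ ^ j) h) (Γ.regVec k h j) = Γ.regVec k h (j + 1) := by
  rcases Nat.eq_zero_or_pos j with rfl | hj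
  · rw [regArrow_regVec_zero]
    exact if_pos rfl
  · rw [Γ.regArrow_regVec_of_pos k _ _ hj, if_pos rfl]

open Classical in
/-- The action of an idempotent in the left regular representation. -/
def regIdem (i : Γ.Edge) :
    (Γ.Edge ⊕ Γ.Edge ⊕ H × ℕ →₀ k) →ₗ[k] (Γ.Edge ⊕ Γ.Edge ⊕ H × ℕ →₀ k) :=
  Finsupp.linearCombination k fun
    | .inl j => if j = i then Finsupp.single (.inl j) 1 else 0
    | .inr (.inl j) => if j = i then Finsupp.single (.inr (.inl j)) 1 else 0
    | .inr (.inr (h, j)) =>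
      if Γ.edge ((Γ.ρ ^ j) h) = i then Finsupp.single (.inr (.inr (h, j))) 1 else 0

theorem regIdem_regVec (h : H) (j : ℕ) :
    Γ.regIdem k (Γ.edge ((Γ.ρ ^ j) h)) (Γ.regVec k h j) = Γ.regVec k h j := by
  rw [regVec]
  split_ifs with h1 h2 h3
  · subst h1
    rw [regIdem, Finsupp.linearCombination_single, one_smul]
    exact if_pos rfl
  · rw [regIdem, Finsupp.linearCombination_single, one_smul]
    exact if_pos rfl
  · subst h3
    rw [ρ_pow_len, regIdem, Finsupp.linearCombination_single, one_smul]
    exact if_pos rfl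
  · exact map_zero _

/-- The action of a non-trivial path around a vertex in the left regular representation. -/
def regPath (h : H) : ℕ →
    (Γ.Edge ⊕ Γ.Edge ⊕ H × ℕ →₀ k) →ₗ[k] (Γ.Edge ⊕ Γ.Edge ⊕ H × ℕ →₀ k)
  | 0 => LinearMap.id
  | j + 1 => Γ.regArrow k ((Γ.ρ ^ j) h) ∘ₗ regPath h j

theorem regPath_succ (h : H) (j : ℕ) (x) : Γ.regPath k h (j + 1) x =
    Γ.regArrow k ((Γ.ρ ^ j) h) (Γ.regPath k h j x) := rfl

open Classical in
theorem regPath_regVec_zero (h h' : H) (j : ℕ) : Γ.regPath k h (j + 1) (Γ.regVec k h' 0) =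
    if Γ.edge h' = Γ.edge h then Γ.regVec k h (j + 1) else 0 := by
  induction j with
  | zero => exact Γ.regArrow_regVec_zero k h h'
  | succ j ih =>
    rw [regPath_succ, ih]
    split_ifs
    · exact Γ.regArrow_regVec_self k h (j + 1)
    · exact map_zero _

open Classical in
theorem regPath_regVec_of_pos (h h' : H) (j : ℕ) {i : ℕ} (hi : 0 < i) :
    Γ.regPath k h (j + 1) (Γ.regVec k h' i) =
      if (Γ.ρ ^ i) h' = h then Γ.regVec k h' (i + (j + 1)) else 0 := by
  induction j with
  | zero => exact Γ.regArrow_regVec_of_pos k h h' hi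
  | succ j ih =>
    rw [regPath_succ, ih]
    split_ifs with e
    · rw [← e, ← Equiv.Perm.mul_apply, ← pow_add, add_comm _ i, regArrow_regVec_self]
      rfl
    · exact map_zero _

/-- The restriction to the span of the vectors `regVec` matters: the index set contains all of `H ×
ℕ`, including pairs that correspond to no path strictly between a trivial path and the socle. -/
theorem regArrow_face {x} (hx : x ∈ Submodule.span k (Set.range fun y : H × ℕ =>
    Γ.regVec k y.1 y.2)) (h : H) : Γ.regArrow k h (Γ.regArrow k (Γ.face h) x) = 0 := by
  classical
  induction hx using Submodule.span_induction with
  | mem x hx =>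
    obtain ⟨⟨h', j⟩, rfl⟩ := hx
    change Γ.regArrow k h (Γ.regArrow k (Γ.face h) (Γ.regVec k h' j)) = 0
    rcases Nat.eq_zero_or_pos j with rfl | hj
    · rw [regArrow_regVec_zero]
      split_ifs with e
      · rw [Γ.regArrow_regVec_of_pos k _ _ one_pos, pow_one, ρ_face, if_neg (Γ.ι_ne h)]
      · exact map_zero _
    · rw [Γ.regArrow_regVec_of_pos k _ _ hj]
      split_ifs with e
      · rw [Γ.regArrow_regVec_of_pos k _ _ (Nat.succ_pos j), Nat.succ_eq_add_one, pow_succ',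
          Equiv.Perm.mul_apply, e, ρ_face, if_neg (Γ.ι_ne h)]
      · exact map_zero _
  | zero => rw [map_zero, map_zero]
  | add x y _ _ hx hy => rw [map_add, map_add, hx, hy, add_zero]
  | smul c x _ hx => rw [map_smul, map_smul, hx, smul_zero]

theorem regPath_len {x} (hx : x ∈ Submodule.span k (Set.range fun y : H × ℕ =>
    Γ.regVec k y.1 y.2)) (h : H) :
    Γ.regPath k h (Γ.len h) x = Γ.regPath k (Γ.ι h) (Γ.len (Γ.ι h)) x := by
  classical
  obtain ⟨n, hn⟩ := Nat.exists_eq_succ_of_ne_zero (Γ.len_pos h).ne'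
  obtain ⟨n', hn'⟩ := Nat.exists_eq_succ_of_ne_zero (Γ.len_pos (Γ.ι h)).ne'
  induction hx using Submodule.span_induction with
  | mem x hx =>
    obtain ⟨⟨h', j⟩, rfl⟩ := hx
    change Γ.regPath k h (Γ.len h) (Γ.regVec k h' j) =
      Γ.regPath k (Γ.ι h) (Γ.len (Γ.ι h)) (Γ.regVec k h' j)
    rcases Nat.eq_zero_or_pos j with rfl | hj
    · rw [hn, hn', Nat.succ_eq_add_one, Nat.succ_eq_add_one, regPath_regVec_zero,
        regPath_regVec_zero, Γ.edge_ι]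
      simp only [regVec, hn, hn', Nat.succ_eq_add_one, Γ.edge_ι]
      simp
    · have key : ∀ h'' n, Γ.len h'' = n + 1 →
          Γ.regPath k h'' (n + 1) (Γ.regVec k h' j) = 0 := by
        intro h'' n hn
        rw [Γ.regPath_regVec_of_pos k _ _ _ hj]
        split_ifs with e
        · apply regVec_of_len_lt
          rw [← Γ.len_ρ_pow h' j, e]
          omega
        · rfl
      rw [hn, hn', key _ _ hn, key _ _ hn']
  | zero => rw [map_zero, map_zero]
  | add x y _ _ hx hy => rw [map_add, map_add, hx, hy]
  | smul c x _ hx => rw [map_smul, map_smul, hx]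

/-- This supplies linear independence: paths around vertices of length at most `len` stay
independent modulo the ideal, up to the evident identifications of trivial paths and of socle
elements. The relations by themselves only give a spanning set. -/
theorem exists_regular : ∃ F : PathAlgebra k Γ.Edge →ₗ[k] (Γ.Edge ⊕ Γ.Edge ⊕ H × ℕ →₀ k),
    (∀ h j, F (Γ.path k h j) = Γ.regVec k h j) ∧ ∀ x ∈ Γ.relIdeal k, F x = 0 := by
  classical
  obtain ⟨F, hF0, hF1, hF2⟩ := Γ.exists_rec (k := k) (N := Γ.Edge ⊕ Γ.Edge ⊕ H × ℕ →₀ k)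
    (fun i => Finsupp.single (.inl i) 1) (Γ.regArrow k) (Γ.regIdem k) (by
      intro i j x hij
      induction x using Finsupp.induction_linear with
      | zero => rw [map_zero, map_zero]
      | add x y hx hy => rw [map_add, map_add, hx, hy, add_zero]
      | single x c =>
        rw [regIdem, regIdem, Finsupp.linearCombination_single, map_smul]
        rcases x with l | l | ⟨h, l⟩ <;> dsimp only <;> split_ifs with e
        all_goals first
          | rw [map_zero, smul_zero]
          | rw [Finsupp.linearCombination_single]
            dsimp only
            rw [e, if_neg hij.symm, smul_zero, smul_zero]) (by
      intro i
      rw [regIdem, Finsupp.linearCombination_single, one_smul]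
      exact if_pos rfl) (by
      intro h x
      induction x using Finsupp.induction_linear with
      | zero => rw [map_zero, map_zero]
      | add x y hx hy => rw [map_add, map_add, hx, hy]
      | single x c =>
        rw [regArrow, Finsupp.linearCombination_single, map_smul]
        congr 1
        rcases x with l | l | ⟨h', j⟩
        · dsimp only
          split_ifs
          · exact Γ.regIdem_regVec k h 1
          · exact map_zero _
        · exact map_zero _
        · dsimp only
          split_ifs with e
          · have := Γ.regIdem_regVec k h' (j + 1)
            rwa [pow_succ', Equiv.Perm.mul_apply, e] at this
          · exact map_zero _) (by
      intro h i x hi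
      induction x using Finsupp.induction_linear with
      | zero => rw [map_zero, map_zero]
      | add x y hx hy => rw [map_add, map_add, hx, hy, add_zero]
      | single x c =>
        rw [regIdem, Finsupp.linearCombination_single, map_smul]
        rcases x with l | l | ⟨h', j⟩ <;> dsimp only <;> split_ifs with e
        all_goals first
          | rw [map_zero, smul_zero]
          | rw [regArrow, Finsupp.linearCombination_single]
            dsimp only
        · rw [e, if_neg hi, smul_zero, smul_zero]
        · rw [smul_zero, smul_zero]
        · rw [if_neg, smul_zero, smul_zero]
          rintro rfl
          exact hi e.symm)
  have hpath : ∀ h j, F (Γ.path k h j) = Γ.regVec k h j := by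
    intro h j
    induction j with
    | zero => rw [Γ.path_zero, hF0, regVec, if_pos rfl]
    | succ j ih => rw [Γ.path_succ, hF1, ih, regArrow_regVec_self]
  have hpath' : ∀ h j y, F (Γ.path k h (j + 1) * y) = Γ.regPath k h (j + 1) (F y) := by
    intro h j y
    induction j with
    | zero => rw [zero_add, Γ.path_one, hF1]; rfl
    | succ j ih => rw [Γ.path_succ, mul_assoc, hF1, ih, regPath_succ k Γ h (j + 1)]
  have hmem : ∀ h x, x ∈ Submodule.span k (Set.range fun y : H × ℕ => Γ.regVec k y.1 y.2) →
      Γ.regArrow k h x ∈ Submodule.span k (Set.range fun y : H × ℕ => Γ.regVec k y.1 y.2) := by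
    intro h x hx
    induction hx using Submodule.span_induction with
    | mem x hx =>
      obtain ⟨⟨h', j⟩, rfl⟩ := hx
      change Γ.regArrow k h (Γ.regVec k h' j) ∈ _
      rcases Nat.eq_zero_or_pos j with rfl | hj
      · rw [regArrow_regVec_zero]
        split_ifs
        · exact Submodule.subset_span ⟨(h, 1), rfl⟩
        · exact zero_mem _
      · rw [Γ.regArrow_regVec_of_pos k _ _ hj]
        split_ifs
        · exact Submodule.subset_span ⟨(h', j + 1), rfl⟩
        · exact zero_mem _
    | zero => rw [map_zero]; exact zero_mem _
    | add x y _ _ hx hy => rw [map_add]; exact add_mem hx hy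
    | smul c x _ hx => rw [map_smul]; exact Submodule.smul_mem _ _ hx
  have hspan : ∀ y, F y ∈ Submodule.span k (Set.range fun y : H × ℕ => Γ.regVec k y.1 y.2) := by
    intro y
    induction y using Γ.pathAlgebra_induction with
    | hzero => rw [map_zero]; exact zero_mem _
    | hadd x y hx hy => rw [map_add]; exact add_mem hx hy
    | hsmul c x hx => rw [map_smul]; exact Submodule.smul_mem _ _ hx
    | hidem i =>
      obtain ⟨h, rfl⟩ := Γ.edge_surjective i
      rw [← Γ.path_zero, hpath]
      exact Submodule.subset_span ⟨(h, 0), rfl⟩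
    | harrow h x hx =>
      rw [hF1]
      exact hmem h _ hx
  -- Quantifying over all right factors `y` makes this set closed under right multiplication;
  -- closure on the left comes from the recursive form of `F`. Taking `y = 1` at the end gives the
  -- vanishing of `F` itself.
  let K : TwoSidedIdeal (PathAlgebra k Γ.Edge) := TwoSidedIdeal.mk' {x | ∀ y, F (x * y) = 0}
    (by intro y; rw [zero_mul, map_zero])
    (by intro x x' hx hx' y; rw [add_mul, map_add, hx, hx', add_zero])
    (by intro x hx y; rw [neg_mul, map_neg, hx, neg_zero])
    (by
      intro x x' hx y
      rw [mul_assoc]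
      have hx : F (x' * y) = 0 := hx y
      induction x using Γ.pathAlgebra_induction with
      | hzero => rw [zero_mul, map_zero]
      | hadd x y hx hy => rw [add_mul, map_add, hx, hy, add_zero]
      | hsmul c x hx => rw [smul_mul_assoc, map_smul, hx, smul_zero]
      | hidem i => rw [hF2, hx, map_zero]
      | harrow h x hx => rw [mul_assoc, hF1, hx, map_zero])
    (by intro x x' hx y; rw [mul_assoc]; exact hx _)
  have hK : Γ.relIdeal k ≤ K := by
    refine (Γ.relIdeal_le_iff k).2 ⟨fun h => ?_, fun h => ?_⟩
    · refine (TwoSidedIdeal.mem_mk' ..).2 fun y => ?_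
      rw [mul_assoc, hF1, hF1, Γ.regArrow_face k (hspan y)]
    · refine (TwoSidedIdeal.mem_mk' ..).2 fun y => ?_
      have h1 := Γ.regPath_len k (hspan y) h
      obtain ⟨n, hn⟩ := Nat.exists_eq_succ_of_ne_zero (Γ.len_pos h).ne'
      obtain ⟨n', hn'⟩ := Nat.exists_eq_succ_of_ne_zero (Γ.len_pos (Γ.ι h)).ne'
      rw [hn, hn'] at h1 ⊢
      rw [sub_mul, map_sub, Nat.succ_eq_add_one, Nat.succ_eq_add_one, hpath', hpath', ← h1,
        sub_self]
  refine ⟨F, hpath, fun x hx => ?_⟩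
  have := (TwoSidedIdeal.mem_mk' ..).1 (hK hx) 1
  rwa [mul_one] at this

end Regular

end BrauerGraph

end

/-! ### The symmetric trace form and dual bases -/

noncomputable section

namespace BrauerGraph

variable {V H : Type*} (k : Type*) [Field k] [Finite H] (Γ : BrauerGraph V H)

theorem exists_tr : ∃ τ : Γ.Alg k →ₗ[k] k, ∀ h j,
    τ (Γ.p k h j) = if j = Γ.len h then 1 else 0 := by
  classical
  obtain ⟨F, hF, hF0⟩ := Γ.exists_regular k
  let τ : (Γ.Edge ⊕ Γ.Edge ⊕ H × ℕ →₀ k) →ₗ[k] k := Finsupp.linearCombination k fun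
    | .inl _ => 0
    | .inr (.inl _) => 1
    | .inr (.inr _) => 0
  obtain ⟨g, hg⟩ := Γ.exists_factor k (τ ∘ₗ F) fun x hx => by
    rw [LinearMap.comp_apply, hF0 x hx, map_zero]
  refine ⟨g, fun h j => ?_⟩
  rw [p, hg, LinearMap.comp_apply, hF, regVec]
  have := Γ.len_pos h
  split_ifs with h1 h2 h3 h4 h5
  · omega
  · rw [Finsupp.linearCombination_single, smul_zero]
  · omega
  · rw [Finsupp.linearCombination_single, smul_zero]
  · rw [Finsupp.linearCombination_single, smul_eq_mul, one_mul]
  · exact map_zero _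

/-- The symmetrising trace form of a Brauer graph algebra: the sum of the coefficients of the socle
elements. -/
def tr : Γ.Alg k →ₗ[k] k := (Γ.exists_tr k).choose

theorem tr_p (h : H) (j : ℕ) : Γ.tr k (Γ.p k h j) = if j = Γ.len h then 1 else 0 :=
  (Γ.exists_tr k).choose_spec h j

theorem tr_p_len (h : H) : Γ.tr k (Γ.p k h (Γ.len h)) = 1 := by rw [tr_p, if_pos rfl]

theorem tr_p_of_ne {h : H} {j : ℕ} (hj : j ≠ Γ.len h) : Γ.tr k (Γ.p k h j) = 0 := by
  rw [tr_p, if_neg hj]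

theorem tr_p_mul_p_eq_one {h h' : H} {i j : ℕ} (e : (Γ.ρ ^ i) h' = h) (hl : i + j = Γ.len h') :
    Γ.tr k (Γ.p k h j * Γ.p k h' i) = 1 := by
  rw [Γ.p_mul_p k e, hl, tr_p_len]

theorem tr_p_mul_p_eq_zero_of_len {h h' : H} {i j : ℕ} (hi : 0 < i) (hl : i + j ≠ Γ.len h') :
    Γ.tr k (Γ.p k h j * Γ.p k h' i) = 0 := by
  rcases Nat.eq_zero_or_pos j with rfl | hj
  · by_cases e : Γ.edge h = Γ.edge ((Γ.ρ ^ i) h')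
    · rw [Γ.p_zero_mul_of_edge_eq k e, tr_p_of_ne k Γ (by simpa using hl)]
    · rw [Γ.p_zero_mul_of_edge_ne k e, map_zero]
  · by_cases e : (Γ.ρ ^ i) h' = h
    · rw [Γ.p_mul_p k e, tr_p_of_ne k Γ hl]
    · rw [Γ.p_mul_p_of_ne k e hi hj, map_zero]

theorem tr_p_mul_p_comm_aux {h h' : H} {i j : ℕ} (hi : 0 < i) (hj : 0 < j)
    (e : (Γ.ρ ^ i) h' = h) :
    Γ.tr k (Γ.p k h j * Γ.p k h' i) = Γ.tr k (Γ.p k h' i * Γ.p k h j) := by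
  have hl : Γ.len h = Γ.len h' := by rw [← e, len_ρ_pow]
  by_cases hij : i + j = Γ.len h'
  · rw [Γ.tr_p_mul_p_eq_one k e hij, Γ.tr_p_mul_p_eq_one k _ (by omega)]
    rw [← e, ← Equiv.Perm.mul_apply, ← pow_add, add_comm j i, hij, ρ_pow_len]
  · rw [Γ.tr_p_mul_p_eq_zero_of_len k hi hij, Γ.tr_p_mul_p_eq_zero_of_len k hj (by omega)]

theorem tr_p_zero_mul_p (h h' : H) (i : ℕ) :
    Γ.tr k (Γ.p k h 0 * Γ.p k h' i) = Γ.tr k (Γ.p k h' i * Γ.p k h 0) := by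
  by_cases hi : i = Γ.len h'
  · subst hi
    by_cases e : Γ.edge h = Γ.edge h'
    · rw [Γ.p_zero_mul_of_edge_eq k (by rwa [ρ_pow_len]), Γ.p_mul_zero_of_edge_eq k e.symm]
    · rw [Γ.p_zero_mul_of_edge_ne k (by rwa [ρ_pow_len]), Γ.p_mul_zero_of_edge_ne k (Ne.symm e)]
  · trans (0 : k)
    · by_cases e : Γ.edge h = Γ.edge ((Γ.ρ ^ i) h')
      · rw [Γ.p_zero_mul_of_edge_eq k e, tr_p_of_ne k Γ hi]
      · rw [Γ.p_zero_mul_of_edge_ne k e, map_zero]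
    · by_cases e : Γ.edge h' = Γ.edge h
      · rw [Γ.p_mul_zero_of_edge_eq k e, tr_p_of_ne k Γ hi]
      · rw [Γ.p_mul_zero_of_edge_ne k e, map_zero]

/-- On two non-trivial paths the trace is 1 exactly when they complete each other to a maximal
cycle, and this condition is invariant under rotating the cycle. -/
theorem tr_mul_comm (x y : Γ.Alg k) : Γ.tr k (x * y) = Γ.tr k (y * x) := by
  induction x using Γ.alg_induction with
  | hzero => rw [zero_mul, mul_zero]
  | hadd x x' hx hx' => rw [add_mul, mul_add, map_add, map_add, hx, hx']
  | hsmul c x hx => rw [smul_mul_assoc, mul_smul_comm, map_smul, map_smul, hx]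
  | hp h j =>
    induction y using Γ.alg_induction with
    | hzero => rw [zero_mul, mul_zero]
    | hadd x x' hx hx' => rw [add_mul, mul_add, map_add, map_add, hx, hx']
    | hsmul c x hx => rw [smul_mul_assoc, mul_smul_comm, map_smul, map_smul, hx]
    | hp h' i =>
      rcases Nat.eq_zero_or_pos j with rfl | hj
      · exact Γ.tr_p_zero_mul_p k h h' i
      rcases Nat.eq_zero_or_pos i with rfl | hi
      · exact (Γ.tr_p_zero_mul_p k h' h j).symm
      by_cases e : (Γ.ρ ^ i) h' = h
      · exact Γ.tr_p_mul_p_comm_aux k hi hj e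
      by_cases e' : (Γ.ρ ^ j) h = h'
      · exact (Γ.tr_p_mul_p_comm_aux k hj hi e').symm
      rw [Γ.p_mul_p_of_ne k e hi hj, Γ.p_mul_p_of_ne k e' hj hi]

/-- Expansion of an element with respect to the basis of paths, in terms of the trace form. -/
theorem p_zero_mul_eq_sum (h : H) (b : Γ.Alg k) : Γ.p k h 0 * b =
    ∑ j ∈ Finset.range (Γ.len h),
      Γ.tr k (Γ.p k h (j + 1) * b) • Γ.p k ((Γ.ρ ^ (j + 1)) h) (Γ.len h - (j + 1)) +
    ∑ j ∈ Finset.range (Γ.len (Γ.ι h)),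
      Γ.tr k (Γ.p k (Γ.ι h) j * b) • Γ.p k ((Γ.ρ ^ j) (Γ.ι h)) (Γ.len (Γ.ι h) - j) := by
  have hn := Γ.len_pos h
  have hn' := Γ.len_pos (Γ.ι h)
  induction b using Γ.alg_induction with
  | hzero => simp only [mul_zero, map_zero, zero_smul, Finset.sum_const_zero, add_zero]
  | hadd x y hx hy =>
    simp only [mul_add, map_add, add_smul, Finset.sum_add_distrib, hx, hy]
    abel
  | hsmul c x hx =>
    simp only [mul_smul_comm, map_smul, hx, smul_add, Finset.smul_sum, smul_assoc]
  | hp h' i hi =>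
    rcases Nat.eq_zero_or_pos i with rfl | hi0
    · by_cases e : Γ.edge h = Γ.edge h'
      · rw [Γ.p_mul_zero_of_edge_eq k e]
        -- The ranges of the two sums are shifted against each other so that the idempotent, common
        -- to both ends of the edge, is counted only in the first sum, at its last index.
        rw [Finset.sum_eq_single (Γ.len h - 1), Finset.sum_eq_zero, add_zero]
        · rw [Nat.sub_add_cancel hn, Γ.p_mul_zero_of_edge_eq k e, tr_p_len, one_smul, ρ_pow_len,
            Nat.sub_self]
        · intro j hj
          rw [Γ.p_mul_zero_of_edge_eq k (by rwa [Γ.edge_ι]),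
            tr_p_of_ne k Γ (Finset.mem_range.1 hj).ne, zero_smul]
        · intro j _ hj
          rw [Γ.p_mul_zero_of_edge_eq k e, tr_p_of_ne k Γ (by omega), zero_smul]
        · intro hj
          exact absurd (Finset.mem_range.2 (by omega)) hj
      · rw [Γ.p_mul_zero_of_edge_ne k e, Finset.sum_eq_zero, Finset.sum_eq_zero, add_zero]
        · intro j _
          rw [Γ.p_mul_zero_of_edge_ne k (by rwa [Γ.edge_ι]), map_zero, zero_smul]
        · intro j _
          rw [Γ.p_mul_zero_of_edge_ne k e, map_zero, zero_smul]
    · rcases hi.lt_or_eq with hi | rfl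
      · by_cases e : (Γ.ρ ^ i) h' = h
        · have hl : Γ.len h = Γ.len h' := by rw [← e, len_ρ_pow]
          rw [Γ.p_zero_mul_of_edge_eq k (by rw [e]), Finset.sum_eq_single (Γ.len h - i - 1),
            Finset.sum_eq_zero, add_zero, Nat.sub_add_cancel (by omega),
            Γ.tr_p_mul_p_eq_one k e (by omega), one_smul, Nat.sub_sub_self (by omega), ← e,
            ← Equiv.Perm.mul_apply, ← pow_add, len_ρ_pow, Nat.sub_add_cancel (by omega), ρ_pow_len]
          · intro j _
            rcases Nat.eq_zero_or_pos j with rfl | hj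
            · rw [Γ.tr_p_mul_p_eq_zero_of_len k hi0 (by omega), zero_smul]
            · rw [Γ.p_mul_p_of_ne k (by rw [e]; exact (Γ.ι_ne h).symm) hi0 hj, map_zero, zero_smul]
          · intro j _ hj
            rw [Γ.tr_p_mul_p_eq_zero_of_len k hi0 (by omega), zero_smul]
          · intro hj
            exact absurd (Finset.mem_range.2 (by omega)) hj
        · have h1 : ∑ j ∈ Finset.range (Γ.len h), Γ.tr k (Γ.p k h (j + 1) * Γ.p k h' i) •
              Γ.p k ((Γ.ρ ^ (j + 1)) h) (Γ.len h - (j + 1)) = 0 := by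
            refine Finset.sum_eq_zero fun j _ => ?_
            rw [Γ.p_mul_p_of_ne k e hi0 (Nat.succ_pos j), map_zero, zero_smul]
          rw [h1, zero_add]
          by_cases e' : (Γ.ρ ^ i) h' = Γ.ι h
          · have hl : Γ.len (Γ.ι h) = Γ.len h' := by rw [← e', len_ρ_pow]
            rw [Γ.p_zero_mul_of_edge_eq k (by rw [e', Γ.edge_ι]),
              Finset.sum_eq_single (Γ.len (Γ.ι h) - i),
              Γ.tr_p_mul_p_eq_one k e' (by omega), one_smul, Nat.sub_sub_self (by omega), ← e',
              ← Equiv.Perm.mul_apply, ← pow_add, len_ρ_pow, Nat.sub_add_cancel (by omega),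
              ρ_pow_len]
            · intro j _ hj
              rw [Γ.tr_p_mul_p_eq_zero_of_len k hi0 (by omega), zero_smul]
            · intro hj
              exact absurd (Finset.mem_range.2 (by omega)) hj
          · rw [Γ.p_zero_mul_of_edge_ne k fun e'' =>
              (Γ.edge_eq_edge_iff.1 e'').elim e e', Finset.sum_eq_zero]
            intro j _
            rcases Nat.eq_zero_or_pos j with rfl | hj
            · rw [Γ.tr_p_mul_p_eq_zero_of_len k hi0 (by omega), zero_smul]
            · rw [Γ.p_mul_p_of_ne k e' hi0 hj, map_zero, zero_smul]
      -- The socle element is likewise common to both ends; it is counted only in the second sum, at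
      -- index 0.
      · rw [Finset.sum_eq_zero, zero_add, Finset.sum_eq_single 0]
        · by_cases e : Γ.edge h = Γ.edge h'
          · rw [p_ι_zero, Γ.p_zero_mul_of_edge_eq k (by rwa [ρ_pow_len]), tr_p_len, one_smul,
              Nat.sub_zero, pow_zero, Equiv.Perm.one_apply, p_len]
            rcases Γ.edge_eq_edge_iff.1 e with rfl | rfl
            · rfl
            · exact Γ.p_len k h
          · rw [p_ι_zero, Γ.p_zero_mul_of_edge_ne k (by rwa [ρ_pow_len]), map_zero, zero_smul]
        · intro j _ hj
          rw [Γ.tr_p_mul_p_eq_zero_of_len k hi0 (by omega), zero_smul]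
        · intro hj
          exact absurd (Finset.mem_range.2 (by omega)) hj
        · intro j _
          rw [Γ.tr_p_mul_p_eq_zero_of_len k hi0 (by omega), zero_smul]

variable {k} in
theorem eq_of_p_zero_mul_eq {x y : Γ.Alg k} (hxy : ∀ h, Γ.p k h 0 * x = Γ.p k h 0 * y) : x = y := by
  rw [← one_mul x, ← one_mul y, ← Γ.sum_idem_eq_one k, Finset.sum_mul, Finset.sum_mul]
  refine Finset.sum_congr rfl fun i _ => ?_
  obtain ⟨h, rfl⟩ := Γ.edge_surjective i
  exact hxy h

variable {k} in
/-- The trace form is non-degenerate. -/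
theorem eq_of_tr_p_mul_eq {x y : Γ.Alg k}
    (hxy : ∀ h j, Γ.tr k (Γ.p k h j * x) = Γ.tr k (Γ.p k h j * y)) : x = y := by
  refine Γ.eq_of_p_zero_mul_eq fun h => ?_
  rw [p_zero_mul_eq_sum, p_zero_mul_eq_sum]
  simp only [hxy]

end BrauerGraph

end

/-! ### Quasi-freeness of the path algebra and bimodule maps on the ideal -/

noncomputable section

namespace Hochschild

variable {k B : Type*} [Field k] [Ring B] [Algebra k B]

/-- The Hochschild coboundary of a `1`-cochain. -/
def coboundary (g : B →ₗ[k] B) : B →ₗ[k] B →ₗ[k] B :=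
  LinearMap.mk₂ k (fun a b => a * g b - g (a * b) + g a * b)
    (by intro a a' b; simp only [map_add, add_mul]; abel)
    (by intro c a b; simp only [map_smul, smul_mul_assoc, smul_sub, smul_add])
    (by intro a b b'; simp only [map_add, mul_add]; abel)
    (by intro c a b; simp only [map_smul, mul_smul_comm, smul_sub, smul_add])

theorem coboundary_apply (g : B →ₗ[k] B) (a b : B) :
    coboundary g a b = a * g b - g (a * b) + g a * b := rfl

theorem coboundary_mem_Z2 (g : B →ₗ[k] B) : coboundary g ∈ Z2 k B :=
  B2_le_Z2 _ _ ⟨g, fun _ _ => rfl⟩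

variable {I : Type*} [Fintype I] {e : I → B}

theorem exists_normalised_left (he : ∀ i, e i * e i = e i) (hne : ∀ i j, i ≠ j → e i * e j = 0)
    (hsum : ∑ i, e i = 1) {f : B →ₗ[k] B →ₗ[k] B} (hf : f ∈ Z2 k B) :
    ∃ g : B →ₗ[k] B, ∀ j b, f (e j) b = coboundary g (e j) b := by
  -- The contracting homotopy for the separable subalgebra spanned by the idempotents: f is averaged
  -- against their separability element Σ e_i ⊗ e_i.
  let g : B →ₗ[k] B := ∑ i, LinearMap.mulLeft k (e i) ∘ₗ f (e i)
  have hg : ∀ b, g b = ∑ i, e i * f (e i) b := fun b => by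
    simp only [g, LinearMap.sum_apply, LinearMap.comp_apply, LinearMap.mulLeft_apply]
  refine ⟨g, fun j b => ?_⟩
  have h1 : e j * g b = e j * f (e j) b := by
    rw [hg, Finset.mul_sum, Finset.sum_eq_single j]
    · rw [← mul_assoc, he]
    · intro i _ hi
      rw [← mul_assoc, hne _ _ hi.symm, zero_mul]
    · exact fun hj => absurd (Finset.mem_univ j) hj
  have h2 : g (e j * b) - g (e j) * b = e j * f (e j) b - f (e j) b := by
    have h3 : ∀ i, e i * f (e i) (e j * b) - e i * f (e i) (e j) * b =
        e i * f (e i * e j) b - e i * f (e j) b := by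
      intro i
      have hc := hf (e i) (e j) b
      have : f (e i) (e j * b) - f (e i) (e j) * b = f (e i * e j) b - e i * f (e j) b := by
        rw [← sub_eq_zero, ← hc]
        abel
      rw [mul_assoc, ← mul_sub, this, mul_sub, ← mul_assoc, he]
    rw [hg, hg, Finset.sum_mul, ← Finset.sum_sub_distrib, Finset.sum_congr rfl fun i _ => h3 i,
      Finset.sum_sub_distrib, ← Finset.sum_mul, hsum, one_mul, Finset.sum_eq_single j, he]
    · intro i _ hi
      rw [hne _ _ hi, map_zero, LinearMap.zero_apply, mul_zero]
    · exact fun hj => absurd (Finset.mem_univ j) hj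
  have h4 : e j * g b - g (e j * b) + g (e j) * b = e j * g b - (g (e j * b) - g (e j) * b) := by
    abel
  rw [coboundary_apply, h4, h1, h2]
  abel

/-- The mirror image of the previous averaging. Since `f` already vanishes on idempotents in the
first slot, the coboundary of the correction vanishes there too, so the left normalisation is not
lost. -/
theorem exists_normalised_right (he : ∀ i, e i * e i = e i) (hne : ∀ i j, i ≠ j → e i * e j = 0)
    (hsum : ∑ i, e i = 1) {f : B →ₗ[k] B →ₗ[k] B} (hf : f ∈ Z2 k B) (hf0 : ∀ j b, f (e j) b = 0) :
    ∃ g : B →ₗ[k] B, (∀ j b, coboundary g (e j) b = 0) ∧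
      ∀ j b, f b (e j) = coboundary g b (e j) := by
  let g : B →ₗ[k] B := ∑ i, LinearMap.mulRight k (e i) ∘ₗ f.flip (e i)
  have hg : ∀ b, g b = ∑ i, f b (e i) * e i := fun b => by
    simp only [g, LinearMap.sum_apply, LinearMap.comp_apply, LinearMap.mulRight_apply,
      LinearMap.flip_apply]
  have hg0 : ∀ j, g (e j) = 0 := fun j => by
    rw [hg]
    exact Finset.sum_eq_zero fun i _ => by rw [hf0, zero_mul]
  refine ⟨g, fun j b => ?_, fun j b => ?_⟩
  · rw [coboundary_apply, hg0, zero_mul, add_zero, hg, hg, Finset.mul_sum, sub_eq_zero]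
    refine Finset.sum_congr rfl fun i _ => ?_
    have hc := hf (e j) b (e i)
    rw [hf0, hf0, zero_mul, sub_zero, add_zero, sub_eq_zero] at hc
    rw [← mul_assoc, hc]
  · have h1 : g b * e j = f b (e j) * e j := by
      rw [hg, Finset.sum_mul, Finset.sum_eq_single j]
      · rw [mul_assoc, he]
      · intro i _ hi
        rw [mul_assoc, hne _ _ hi, mul_zero]
      · exact fun hj => absurd (Finset.mem_univ j) hj
    have h2 : g (b * e j) = f b (e j) * e j - f b (e j) := by
      have h3 : ∀ i, f (b * e j) (e i) * e i = f b (e j * e i) * e i - f b (e j) * e i := by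
        intro i
        have hc := hf b (e j) (e i)
        rw [hf0, mul_zero, zero_sub, neg_add_eq_sub] at hc
        have : f (b * e j) (e i) = f b (e j * e i) - f b (e j) * e i := by
          rw [← sub_eq_zero, ← neg_eq_zero, ← hc]
          abel
        rw [this, sub_mul, mul_assoc, he]
      rw [hg, Finset.sum_congr rfl fun i _ => h3 i, Finset.sum_sub_distrib, ← Finset.mul_sum, hsum,
        mul_one, Finset.sum_eq_single j, he]
      · intro i _ hi
        rw [hne _ _ hi.symm, map_zero, zero_mul]
      · exact fun hj => absurd (Finset.mem_univ j) hj
    rw [coboundary_apply, hg0, mul_zero, h1, h2]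
    abel

/-- Every Hochschild cocycle is cohomologous to one which vanishes if one of its arguments is among
given orthogonal idempotents. -/
theorem exists_normalised (he : ∀ i, e i * e i = e i) (hne : ∀ i j, i ≠ j → e i * e j = 0)
    (hsum : ∑ i, e i = 1) {f : B →ₗ[k] B →ₗ[k] B} (hf : f ∈ Z2 k B) :
    ∃ g : B →ₗ[k] B, ∀ j b, (f - coboundary g) (e j) b = 0 ∧ (f - coboundary g) b (e j) = 0 := by
  obtain ⟨g, hg⟩ := exists_normalised_left he hne hsum hf
  obtain ⟨g', hg1, hg2⟩ := exists_normalised_right he hne hsum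
    (sub_mem hf (coboundary_mem_Z2 g)) fun j b => by
      rw [LinearMap.sub_apply, LinearMap.sub_apply, hg, sub_self]
  have hadd : coboundary (g + g') = coboundary g + coboundary g' := by
    ext a b
    simp only [coboundary_apply, LinearMap.add_apply, mul_add, add_mul]
    abel
  refine ⟨g + g', fun j b => ⟨?_, ?_⟩⟩
  · rw [hadd, LinearMap.sub_apply, LinearMap.sub_apply, LinearMap.add_apply, LinearMap.add_apply,
      hg1, hg, add_zero, sub_self]
  · rw [hadd, ← sub_sub, LinearMap.sub_apply, LinearMap.sub_apply, hg2, sub_self]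

end Hochschild

namespace BrauerGraph

open Hochschild

variable {V H : Type*} {k : Type*} [Field k] [Finite H] (Γ : BrauerGraph V H)

/-- Linear maps `t` on the path algebra which fail to be left linear by given operators `Δ`. -/
theorem exists_twisted (Δ : H → Γ.Alg k →ₗ[k] Γ.Alg k)
    (hl : ∀ h b, Γ.p k (Γ.ρ h) 0 * Δ h b = Δ h b) (hr : ∀ h b, Δ h (Γ.p k h 0 * b) = Δ h b) :
    ∃ t : PathAlgebra k Γ.Edge →ₗ[k] Γ.Alg k, (∀ i, t (Γ.idem k i) = 0) ∧
      (∀ h x, t (Γ.arrow k h * x) = Γ.p k h 1 * t x + Δ h (Γ.proj k x)) ∧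
      ∀ i x, t (Γ.idem k i * x) = Γ.proj k (Γ.idem k i) * t x := by
  let M : Γ.Alg k → Γ.Alg k →ₗ[k] Γ.Alg k := fun a => LinearMap.mulLeft k a
  let fst' : Γ.Alg k × Γ.Alg k →ₗ[k] Γ.Alg k := LinearMap.fst k _ _
  let snd' : Γ.Alg k × Γ.Alg k →ₗ[k] Γ.Alg k := LinearMap.snd k _ _
  -- The recursion needs `Γ.proj k x` next to `t x`, so it runs on pairs: an arrow acts by a block
  -- triangular operator with its left multiplication on the diagonal and Δ below it. In effect the
  -- left regular action is deformed over the dual numbers.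
  obtain ⟨F, hF0, hF1, hF2⟩ := Γ.exists_rec (k := k) (N := Γ.Alg k × Γ.Alg k)
    (fun i => (Γ.proj k (Γ.idem k i), 0))
    (fun h => (M (Γ.p k h 1) ∘ₗ fst').prod (M (Γ.p k h 1) ∘ₗ snd' + Δ h ∘ₗ fst'))
    (fun i => (M (Γ.proj k (Γ.idem k i)) ∘ₗ fst').prod (M (Γ.proj k (Γ.idem k i)) ∘ₗ snd'))
    (by
      rintro i j ⟨x, y⟩ hij
      change (Γ.proj k (Γ.idem k i) * (Γ.proj k (Γ.idem k j) * x),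
        Γ.proj k (Γ.idem k i) * (Γ.proj k (Γ.idem k j) * y)) = 0
      rw [← mul_assoc, ← mul_assoc, ← map_mul, Γ.idem_mul_of_ne k hij, map_zero, zero_mul, zero_mul]
      rfl)
    (by
      intro i
      change (Γ.proj k (Γ.idem k i) * Γ.proj k (Γ.idem k i), Γ.proj k (Γ.idem k i) * 0) = _
      rw [← map_mul, Γ.idem_mul_self, mul_zero])
    (by
      rintro h ⟨x, y⟩
      change (Γ.p k (Γ.ρ h) 0 * (Γ.p k h 1 * x), Γ.p k (Γ.ρ h) 0 * (Γ.p k h 1 * y + Δ h x)) =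
        (Γ.p k h 1 * x, Γ.p k h 1 * y + Δ h x)
      rw [mul_add, ← mul_assoc, ← mul_assoc, Γ.p_zero_mul_of_edge_eq k (by rfl), hl])
    (by
      rintro h i ⟨x, y⟩ hi
      obtain ⟨h', rfl⟩ := Γ.edge_surjective i
      change (Γ.p k h 1 * (Γ.p k h' 0 * x), Γ.p k h 1 * (Γ.p k h' 0 * y) + Δ h (Γ.p k h' 0 * x)) = 0
      rw [← hr, ← mul_assoc, ← mul_assoc, ← mul_assoc, Γ.p_mul_zero_of_edge_ne k (Ne.symm hi),
        Γ.p_mul_zero_of_edge_ne k (Ne.symm hi), zero_mul, zero_mul, map_zero, add_zero]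
      rfl)
  have hproj : ∀ x, (F x).1 = Γ.proj k x := by
    intro x
    induction x using Γ.pathAlgebra_induction with
    | hzero => rw [map_zero, map_zero]; rfl
    | hadd x y hx hy => rw [map_add, map_add, ← hx, ← hy]; rfl
    | hsmul c x hx => rw [map_smul, map_smul, ← hx]; rfl
    | hidem i => rw [hF0]
    | harrow h x hx => rw [hF1, map_mul, ← hx, proj_arrow]; rfl
  refine ⟨snd' ∘ₗ F, fun i => ?_, fun h x => ?_, fun i x => ?_⟩
  · change (F _).2 = 0
    rw [hF0]
  · change (F _).2 = Γ.p k h 1 * (F x).2 + Δ h (Γ.proj k x)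
    rw [hF1, ← hproj]
    rfl
  · change (F _).2 = _ * (F x).2
    rw [hF2]
    rfl

/-- After normalising `f` on the idempotents of the edges, the desired equation with an arrow as
first argument prescribes `t (α x)` from `t x`. Paths being free on arrows, this recursion defines
`t`; the cocycle identity extends the equation from arrows to all first arguments. -/
theorem liftsCocycles_proj : LiftsCocycles (Γ.proj k) := by
  intro f₀ hf₀
  obtain ⟨g, hg⟩ := exists_normalised (e := fun i => Γ.proj k (Γ.idem k i))
    (fun i => by rw [← map_mul, Γ.idem_mul_self])
    (fun i j hij => by rw [← map_mul, Γ.idem_mul_of_ne k hij, map_zero])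
    (Γ.sum_idem_eq_one k) hf₀
  obtain ⟨f, hfdef⟩ : ∃ f, f = f₀ - coboundary g := ⟨_, rfl⟩
  rw [← hfdef] at hg
  have hf : f ∈ Z2 k (Γ.Alg k) := hfdef ▸ sub_mem hf₀ (coboundary_mem_Z2 g)
  have hf0 : ∀ h b, f (Γ.p k h 0) b = 0 := fun h b => (hg (Γ.edge h) b).1
  have hf0' : ∀ h b, f b (Γ.p k h 0) = 0 := fun h b => (hg (Γ.edge h) b).2
  have hleft : ∀ h a b, Γ.p k h 0 * f a b = f (Γ.p k h 0 * a) b := by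
    intro h a b
    have := hf (Γ.p k h 0) a b
    rwa [hf0, hf0, zero_mul, sub_zero, add_zero, sub_eq_zero] at this
  obtain ⟨t, ht0, ht1, ht2⟩ := Γ.exists_twisted (fun h => -f (Γ.p k h 1))
    (by
      intro h b
      rw [LinearMap.neg_apply, mul_neg, hleft, Γ.p_zero_mul_of_edge_eq k (by rfl)])
    (by
      intro h b
      have := hf (Γ.p k h 1) (Γ.p k h 0) b
      rw [Γ.p_mul_zero_of_edge_eq k rfl, hf0, hf0', zero_mul, mul_zero, sub_zero, zero_sub,
        neg_add_eq_zero] at this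
      rw [LinearMap.neg_apply, LinearMap.neg_apply, this])
  have ht : ∀ x y, f (Γ.proj k x) (Γ.proj k y) =
      Γ.proj k x * t y - t (x * y) + t x * Γ.proj k y := by
    intro x y
    induction x using Γ.pathAlgebra_induction with
    | hzero => simp
    | hadd x x' hx hx' =>
      simp only [map_add, LinearMap.add_apply, hx, hx', add_mul]
      abel
    | hsmul c x hx =>
      simp only [map_smul, LinearMap.smul_apply, hx, smul_mul_assoc, smul_sub, smul_add]
    | hidem i => rw [(hg i _).1, ht2, ht0, zero_mul, sub_self, add_zero]
    | harrow h x hx =>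
      have hc := hf (Γ.p k h 1) (Γ.proj k x) (Γ.proj k y)
      have hc' : f (Γ.p k h 1 * Γ.proj k x) (Γ.proj k y) =
          Γ.p k h 1 * f (Γ.proj k x) (Γ.proj k y) + f (Γ.p k h 1) (Γ.proj k x * Γ.proj k y) -
            f (Γ.p k h 1) (Γ.proj k x) * Γ.proj k y := by
        rw [← sub_eq_zero, ← neg_eq_zero, ← hc]
        abel
      rw [mul_assoc, ht1, ht1, map_mul (Γ.proj k), map_mul (Γ.proj k), proj_arrow,
        LinearMap.neg_apply, LinearMap.neg_apply, hc', hx]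
      simp only [mul_add, mul_sub, add_mul, neg_mul, mul_assoc]
      abel
  refine ⟨t + g ∘ₗ (Γ.proj k).toLinearMap, fun x y => ?_⟩
  have h1 : f₀ (Γ.proj k x) (Γ.proj k y) = f (Γ.proj k x) (Γ.proj k y) +
      coboundary g (Γ.proj k x) (Γ.proj k y) := by
    rw [hfdef, LinearMap.sub_apply, LinearMap.sub_apply, sub_add_cancel]
  rw [h1, ht, coboundary_apply]
  simp only [LinearMap.add_apply, LinearMap.comp_apply, AlgHom.toLinearMap_apply, map_mul, mul_add,
    add_mul]
  abel

/-- The values of a linear map on the generators of `I_Γ`. -/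
def relVal : (PathAlgebra k Γ.Edge →ₗ[k] Γ.Alg k) →ₗ[k] (H → Γ.Alg k) × (H → Γ.Alg k) where
  toFun t := (fun h => t (Γ.arrow k h * Γ.arrow k (Γ.face h)),
    fun h => t (Γ.path k h (Γ.len h) - Γ.path k (Γ.ι h) (Γ.len (Γ.ι h))))
  map_add' _ _ := rfl
  map_smul' _ _ := rfl

theorem proj_arrow_mul_arrow_face (h : H) :
    Γ.proj k (Γ.arrow k h * Γ.arrow k (Γ.face h)) = 0 :=
  Γ.proj_eq_zero_iff.2 (((Γ.relIdeal_le_iff k).1 le_rfl).1 h)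

theorem proj_path_len_sub (h : H) :
    Γ.proj k (Γ.path k h (Γ.len h) - Γ.path k (Γ.ι h) (Γ.len (Γ.ι h))) = 0 :=
  Γ.proj_eq_zero_iff.2 (((Γ.relIdeal_le_iff k).1 le_rfl).2 h)

theorem relVal_eq_zero_iff (t : PathAlgebra k Γ.Edge →ₗ[k] Γ.Alg k)
    (ht : t ∈ kernelBimodule (Γ.proj k)) :
    Γ.relVal t = 0 ↔ ∀ y, Γ.proj k y = 0 → t y = 0 := by
  constructor
  · intro h0
    let K : TwoSidedIdeal (PathAlgebra k Γ.Edge) :=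
      TwoSidedIdeal.mk' {y | Γ.proj k y = 0 ∧ t y = 0}
        ⟨map_zero _, map_zero _⟩
        (by
          rintro x y ⟨hx, hx'⟩ ⟨hy, hy'⟩
          exact ⟨by rw [map_add, hx, hy, add_zero], by rw [map_add, hx', hy', add_zero]⟩)
        (by
          rintro x ⟨hx, hx'⟩
          exact ⟨by rw [map_neg, hx, neg_zero], by rw [map_neg, hx', neg_zero]⟩)
        (by
          rintro x y ⟨hy, hy'⟩
          exact ⟨by rw [map_mul, hy, mul_zero], by rw [(ht x y hy).1, hy', mul_zero]⟩)
        (by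
          rintro x y ⟨hx, hx'⟩
          exact ⟨by rw [map_mul, hx, zero_mul], by rw [(ht y x hx).2, hx', zero_mul]⟩)
    have hK : Γ.relIdeal k ≤ K := by
      refine (Γ.relIdeal_le_iff k).2 ⟨fun h => ?_, fun h => ?_⟩
      · exact (TwoSidedIdeal.mem_mk' ..).2 ⟨Γ.proj_arrow_mul_arrow_face h,
          congrFun (congrArg Prod.fst h0) h⟩
      · exact (TwoSidedIdeal.mem_mk' ..).2 ⟨Γ.proj_path_len_sub h,
          congrFun (congrArg Prod.snd h0) h⟩
    intro y hy
    exact ((TwoSidedIdeal.mem_mk' ..).1 (hK (Γ.proj_eq_zero_iff.1 hy))).2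
  · intro h0
    exact Prod.ext (funext fun h => h0 _ (Γ.proj_arrow_mul_arrow_face h))
      (funext fun h => h0 _ (Γ.proj_path_len_sub h))

/-- The operator of the path of length `j` starting at `h` obtained from operators `Δ` of the arrows
by the Leibniz rule. -/
def pathOp (Δ : H → Γ.Alg k →ₗ[k] Γ.Alg k) (h : H) (j : ℕ) (b : Γ.Alg k) : Γ.Alg k :=
  ∑ i ∈ Finset.range j,
    Γ.p k ((Γ.ρ ^ (i + 1)) h) (j - (i + 1)) * Δ ((Γ.ρ ^ i) h) (Γ.p k h i * b)

theorem pathOp_succ (Δ : H → Γ.Alg k →ₗ[k] Γ.Alg k)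
    (hl : ∀ h b, Γ.p k (Γ.ρ h) 0 * Δ h b = Δ h b) (h : H) (j : ℕ) (b : Γ.Alg k) :
    Γ.pathOp Δ h (j + 1) b = Γ.p k ((Γ.ρ ^ j) h) 1 * Γ.pathOp Δ h j b +
      Δ ((Γ.ρ ^ j) h) (Γ.p k h j * b) := by
  rw [pathOp, Finset.sum_range_succ, pathOp, Finset.mul_sum]
  congr 1
  · refine Finset.sum_congr rfl fun i hi => ?_
    have hi := Finset.mem_range.1 hi
    rw [← mul_assoc, Γ.p_one_mul k, show j - (i + 1) + 1 = j + 1 - (i + 1) by omega]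
    rw [← Equiv.Perm.mul_apply, ← pow_add, Nat.sub_add_cancel (by omega)]
  · rw [Nat.sub_self, pow_succ', Equiv.Perm.mul_apply, hl]

/-- A family of operators `Δ` satisfying the relations of `B_Γ` up to left multiplications defines a
bimodule map on `I_Γ`. -/
theorem exists_kernelBimodule_of_operators (Δ : H → Γ.Alg k →ₗ[k] Γ.Alg k)
    (hl : ∀ h b, Γ.p k (Γ.ρ h) 0 * Δ h b = Δ h b) (hr : ∀ h b, Δ h (Γ.p k h 0 * b) = Δ h b)
    (g c : H → Γ.Alg k)
    (hg : ∀ h b, Γ.p k h 1 * Δ (Γ.face h) b + Δ h (Γ.p k (Γ.face h) 1 * b) = g h * b)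
    (hc : ∀ h b, Γ.pathOp Δ h (Γ.len h) b - Γ.pathOp Δ (Γ.ι h) (Γ.len (Γ.ι h)) b = c h * b) :
    ∃ t ∈ kernelBimodule (Γ.proj k), Γ.relVal t = (g, c) := by
  obtain ⟨t, ht0, ht1, ht2⟩ := Γ.exists_twisted Δ hl hr
  have hleft : ∀ x y, Γ.proj k y = 0 → t (x * y) = Γ.proj k x * t y := by
    intro x y hy
    induction x using Γ.pathAlgebra_induction with
    | hzero => rw [zero_mul, map_zero, map_zero, zero_mul]
    | hadd x x' hx hx' => rw [add_mul, map_add, map_add, add_mul, hx, hx']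
    | hsmul c x hx => rw [smul_mul_assoc, map_smul, map_smul, smul_mul_assoc, hx]
    | hidem i => exact ht2 i y
    | harrow h x hx =>
      rw [mul_assoc, ht1, hx, map_mul (Γ.proj k), map_mul (Γ.proj k), hy, mul_zero, map_zero,
        add_zero, proj_arrow,
        mul_assoc]
  have hpath : ∀ h j x, t (Γ.path k h j * x) =
      Γ.p k h j * t x + Γ.pathOp Δ h j (Γ.proj k x) := by
    intro h j x
    induction j with
    | zero => rw [Γ.path_zero, ht2, pathOp, Finset.sum_range_zero, add_zero]; rfl
    | succ j ih =>
      rw [Γ.path_succ, mul_assoc, ht1, ih, Γ.pathOp_succ Δ hl, map_mul, proj_path, mul_add,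
        ← mul_assoc, Γ.p_one_mul k rfl, add_assoc]
  have hg' : ∀ h x, t (Γ.arrow k h * Γ.arrow k (Γ.face h) * x) = g h * Γ.proj k x := by
    intro h x
    rw [mul_assoc, ht1, ht1, mul_add, ← mul_assoc, ← proj_arrow, ← proj_arrow, ← map_mul,
      proj_arrow_mul_arrow_face, zero_mul, zero_add, proj_arrow, ← hg, map_mul, proj_arrow]
  have hc' : ∀ h x, t ((Γ.path k h (Γ.len h) - Γ.path k (Γ.ι h) (Γ.len (Γ.ι h))) * x) =
      c h * Γ.proj k x := by
    intro h x
    rw [sub_mul, map_sub, hpath, hpath, p_len, ← hc]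
    abel
  have hg1 : ∀ h, t (Γ.arrow k h * Γ.arrow k (Γ.face h)) = g h := fun h => by
    simpa using hg' h 1
  have hc1 : ∀ h, t (Γ.path k h (Γ.len h) - Γ.path k (Γ.ι h) (Γ.len (Γ.ι h))) = c h := fun h => by
    simpa using hc' h 1
  -- Right linearity is the real condition. The elements of the kernel on which `t` is right linear
  -- form a two-sided ideal, and by `hg` and `hc` it contains the generators, on which the deformed
  -- action is a left multiplication.
  let K : TwoSidedIdeal (PathAlgebra k Γ.Edge) :=
    TwoSidedIdeal.mk' {y | Γ.proj k y = 0 ∧ ∀ x, t (y * x) = t y * Γ.proj k x}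
      ⟨map_zero _, fun x => by rw [zero_mul, map_zero, zero_mul]⟩
      (by
        rintro x y ⟨hx, hx'⟩ ⟨hy, hy'⟩
        exact ⟨by rw [map_add, hx, hy, add_zero], fun z => by
          rw [add_mul, map_add, map_add, hx', hy', add_mul]⟩)
      (by
        rintro x ⟨hx, hx'⟩
        exact ⟨by rw [map_neg, hx, neg_zero], fun z => by
          rw [neg_mul, map_neg, map_neg, hx', neg_mul]⟩)
      (by
        rintro x y ⟨hy, hy'⟩
        exact ⟨by rw [map_mul, hy, mul_zero], fun z => by
          rw [mul_assoc, hleft _ _ (by rw [map_mul, hy, zero_mul]), hleft _ _ hy, hy', mul_assoc]⟩)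
      (by
        rintro x y ⟨hx, hx'⟩
        exact ⟨by rw [map_mul, hx, zero_mul], fun z => by
          rw [mul_assoc, hx', hx', map_mul, mul_assoc]⟩)
  have hK : Γ.relIdeal k ≤ K := by
    refine (Γ.relIdeal_le_iff k).2 ⟨fun h => ?_, fun h => ?_⟩
    · exact (TwoSidedIdeal.mem_mk' ..).2 ⟨Γ.proj_arrow_mul_arrow_face h, fun x => by
        rw [hg', hg1]⟩
    · exact (TwoSidedIdeal.mem_mk' ..).2 ⟨Γ.proj_path_len_sub h, fun x => by rw [hc', hc1]⟩
  refine ⟨t, fun x y hy => ⟨hleft x y hy, ?_⟩, ?_⟩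
  · exact ((TwoSidedIdeal.mem_mk' ..).1 (hK (Γ.proj_eq_zero_iff.1 hy))).2 x
  · exact Prod.ext (funext hg1) (funext hc1)

/-- Derivations of the path algebra, given by their values on arrows. -/
theorem exists_derivation (d : H → Γ.Alg k) (hl : ∀ h, Γ.p k (Γ.ρ h) 0 * d h = d h)
    (hr : ∀ h, d h * Γ.p k h 0 = d h) :
    ∃ D ∈ derivations (Γ.proj k), (∀ i, D (Γ.idem k i) = 0) ∧ ∀ h, D (Γ.arrow k h) = d h := by
  obtain ⟨t, ht0, ht1, ht2⟩ := Γ.exists_twisted (fun h => LinearMap.mulLeft k (d h))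
    (fun h b => by rw [LinearMap.mulLeft_apply, ← mul_assoc, hl])
    (fun h b => by rw [LinearMap.mulLeft_apply, LinearMap.mulLeft_apply, ← mul_assoc, hr])
  refine ⟨t, fun x y => ?_, ht0, fun h => ?_⟩
  · induction x using Γ.pathAlgebra_induction with
    | hzero => simp
    | hadd x x' hx hx' => rw [add_mul, map_add, map_add, map_add, hx, hx', add_mul, add_mul]; abel
    | hsmul c x hx =>
      rw [smul_mul_assoc, map_smul, map_smul, map_smul, hx, smul_add, smul_mul_assoc,
        smul_mul_assoc]
    | hidem i => rw [ht2, ht0, zero_mul, add_zero]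
    | harrow h x hx =>
      rw [mul_assoc, ht1, ht1, hx, map_mul (Γ.proj k), map_mul (Γ.proj k), proj_arrow,
        LinearMap.mulLeft_apply, LinearMap.mulLeft_apply, mul_add, add_mul, mul_assoc, mul_assoc,
        mul_assoc, add_assoc]
  · rw [← Γ.arrow_mul_idem k h, ht1, ht0, mul_zero, zero_add, LinearMap.mulLeft_apply, proj_idem,
      hr]

end BrauerGraph

end

/-! ### Explicit deformations of the relations -/

noncomputable section

namespace BrauerGraph

open Hochschild

variable {V H : Type*} {k : Type*} [Field k] [Finite H] (Γ : BrauerGraph V H)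

/-- Since ρ maps `face h` to `ι h`, the half-edge `face h` is the last one on the maximal cycle
starting at `ι h`: its arrow completes a path of length one less to a socle element. -/
theorem ρ_pow_len_sub_one (h : H) : (Γ.ρ ^ (Γ.len (Γ.ι h) - 1)) (Γ.ι h) = Γ.face h := by
  rw [eq_comm, face_eq_iff, ← Equiv.Perm.mul_apply, ← pow_succ', Nat.sub_add_cancel (Γ.len_pos _),
    ρ_pow_len]

theorem ρ_pow_len_sub {h : H} {i : ℕ} (hi : i < Γ.len (Γ.ι h)) :
    (Γ.ρ ^ (Γ.len (Γ.ι h) - (i + 1))) ((Γ.ρ ^ i) (Γ.ι h)) = Γ.face h := by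
  rw [← Equiv.Perm.mul_apply, ← pow_add, show Γ.len (Γ.ι h) - (i + 1) + i = Γ.len (Γ.ι h) - 1 by
    omega, ρ_pow_len_sub_one]

theorem p_len_congr {h h' : H} (e : Γ.edge h = Γ.edge h') :
    Γ.p k h (Γ.len h) = Γ.p k h' (Γ.len h') := by
  rcases Γ.edge_eq_edge_iff.1 e with rfl | rfl
  · rfl
  · exact (Γ.p_len k h).symm

/-- The socle elements span one-dimensional ideals. -/
theorem p_len_mul (h : H) (b : Γ.Alg k) :
    Γ.p k h (Γ.len h) * b = Γ.tr k (Γ.p k h (Γ.len h) * b) • Γ.p k h (Γ.len h) := by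
  induction b using Γ.alg_induction with
  | hzero => simp
  | hadd x y hx hy => rw [mul_add, map_add, add_smul, ← hx, ← hy]
  | hsmul c x hx => rw [mul_smul_comm, map_smul, smul_assoc, ← hx]
  | hp h' i =>
    rcases Nat.eq_zero_or_pos i with rfl | hi
    · by_cases e : Γ.edge h = Γ.edge h'
      · rw [Γ.p_mul_zero_of_edge_eq k e, tr_p_len, one_smul]
      · rw [Γ.p_mul_zero_of_edge_ne k e, map_zero, zero_smul]
    · have : Γ.p k h (Γ.len h) * Γ.p k h' i = 0 := by
        by_cases e : (Γ.ρ ^ i) h' = h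
        · rw [Γ.p_mul_p k e, Γ.p_eq_zero k]
          rw [← e, len_ρ_pow]
          omega
        · rw [Γ.p_mul_p_of_ne k e hi (Γ.len_pos h)]
      rw [this, map_zero, zero_smul]

theorem p_mul_p_len (h h' : H) {i : ℕ} (hi : 0 < i) : Γ.p k h' i * Γ.p k h (Γ.len h) = 0 := by
  by_cases e : (Γ.ρ ^ Γ.len h) h = h'
  · rw [Γ.p_mul_p k e, Γ.p_eq_zero k (by omega)]
  · rw [Γ.p_mul_p_of_ne k e (Γ.len_pos h) hi]

variable {V₁ : Set V}

theorem side_face (hV : ∀ h, Γ.s h ∈ V₁ ↔ Γ.s (Γ.ι h) ∉ V₁) {h : H} :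
    Γ.s (Γ.face h) ∈ V₁ ↔ Γ.s h ∉ V₁ := by
  rw [← Γ.s_ρ, ρ_face, hV (Γ.ι h), Γ.ι_involutive]

theorem face_ne_ρ (hV : ∀ h, Γ.s h ∈ V₁ ↔ Γ.s (Γ.ι h) ∉ V₁) (h : H) : Γ.face h ≠ Γ.ρ h := by
  intro e
  have := Γ.side_face hV (h := h)
  rw [e, Γ.s_ρ] at this
  tauto

theorem ι_face_eq_iff {h : H} : Γ.ι (Γ.face h) = Γ.ρ h ↔ Γ.face (Γ.face h) = h :=
  (Γ.face_eq_iff).symm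

theorem edge_face_eq_iff (hV : ∀ h, Γ.s h ∈ V₁ ↔ Γ.s (Γ.ι h) ∉ V₁) {h : H} :
    Γ.edge (Γ.face h) = Γ.edge (Γ.ρ h) ↔ Γ.face (Γ.face h) = h := by
  rw [Γ.edge_eq_edge_iff, ← ι_face_eq_iff]
  constructor
  · rintro (e | e)
    · exact absurd e.symm (Γ.face_ne_ρ hV h)
    · exact e.symm
  · exact fun e => Or.inr e.symm

section Central

variable (V₁) in
open Classical in
/-- The operators of the deformation of the commutativity relations by a central element. -/
def centralOp (z : Γ.Alg k) (h : H) : Γ.Alg k →ₗ[k] Γ.Alg k :=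
  if Γ.s h ∈ V₁ then
    (Γ.tr k ∘ₗ LinearMap.mulLeft k (Γ.p k h 1)).smulRight (z * Γ.p k (Γ.ρ h) 0)
  else -(Γ.tr k ∘ₗ LinearMap.mulLeft k (Γ.p k h 0)).smulRight (z * Γ.p k h 1)

theorem centralOp_of_mem {z : Γ.Alg k} {h : H} (hh : Γ.s h ∈ V₁) (b : Γ.Alg k) :
    Γ.centralOp V₁ z h b = Γ.tr k (Γ.p k h 1 * b) • (z * Γ.p k (Γ.ρ h) 0) := by
  rw [centralOp, if_pos hh]
  rfl

theorem centralOp_of_notMem {z : Γ.Alg k} {h : H} (hh : Γ.s h ∉ V₁) (b : Γ.Alg k) :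
    Γ.centralOp V₁ z h b = -(Γ.tr k (Γ.p k h 0 * b) • (z * Γ.p k h 1)) := by
  rw [centralOp, if_neg hh]
  rfl

theorem pathOp_centralOp_of_mem {z : Γ.Alg k} (hz : ∀ b, b * z = z * b) {h : H} (hh : Γ.s h ∈ V₁)
    (b : Γ.Alg k) : Γ.pathOp (Γ.centralOp V₁ z) h (Γ.len h) b =
    z * ∑ j ∈ Finset.range (Γ.len h),
      Γ.tr k (Γ.p k h (j + 1) * b) • Γ.p k ((Γ.ρ ^ (j + 1)) h) (Γ.len h - (j + 1)) := by
  rw [pathOp, Finset.mul_sum]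
  refine Finset.sum_congr rfl fun i _ => ?_
  rw [Γ.centralOp_of_mem (by rwa [Γ.s_ρ_pow]), ← mul_assoc (Γ.p k ((Γ.ρ ^ i) h) 1),
    Γ.p_one_mul k rfl, mul_smul_comm, ← mul_assoc, hz, mul_assoc, pow_succ', Equiv.Perm.mul_apply,
    Γ.p_mul_zero_of_edge_eq k rfl, mul_smul_comm]

theorem pathOp_centralOp_of_notMem {z : Γ.Alg k} (hz : ∀ b, b * z = z * b) {h : H}
    (hh : Γ.s h ∉ V₁) (b : Γ.Alg k) : Γ.pathOp (Γ.centralOp V₁ z) h (Γ.len h) b =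
    -(z * ∑ j ∈ Finset.range (Γ.len h),
      Γ.tr k (Γ.p k h j * b) • Γ.p k ((Γ.ρ ^ j) h) (Γ.len h - j)) := by
  rw [pathOp, Finset.mul_sum, ← Finset.sum_neg_distrib]
  refine Finset.sum_congr rfl fun i hi => ?_
  have hi := Finset.mem_range.1 hi
  rw [Γ.centralOp_of_notMem (by rwa [Γ.s_ρ_pow]), ← mul_assoc (Γ.p k ((Γ.ρ ^ i) h) 0),
    Γ.p_mul_p k rfl, add_zero, mul_neg, mul_smul_comm, ← mul_assoc, hz, mul_assoc,
    Γ.p_mul_p k (i := 1) (by rw [pow_one, pow_succ', Equiv.Perm.mul_apply]), mul_smul_comm,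
    show 1 + (Γ.len h - (i + 1)) = Γ.len h - i by omega]

variable (V₁) in
open Classical in
/-- The sign of a half-edge with respect to a bipartition. -/
def sign (h : H) : ℤˣ := if Γ.s h ∈ V₁ then 1 else -1

/-- The maximal path at the end in V₁ contributes `z` times one of the two sums of
`p_zero_mul_eq_sum`, and the path at the other end minus `z` times the other sum. Their difference
is therefore multiplication by a component of `z`, up to sign. This division of labour is why the
operators differ on the two sides of the bipartition. -/
theorem exists_kernelBimodule_of_central (hV : ∀ h, Γ.s h ∈ V₁ ↔ Γ.s (Γ.ι h) ∉ V₁)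
    {z : Γ.Alg k} (hz : ∀ b, b * z = z * b) :
    ∃ t ∈ kernelBimodule (Γ.proj k),
      Γ.relVal t = (0, fun h => ((Γ.sign V₁ h : ℤ) : k) • (Γ.p k h 0 * z)) := by
  refine Γ.exists_kernelBimodule_of_operators (Γ.centralOp V₁ z) ?_ ?_ _ _ ?_ ?_
  · intro h b
    by_cases hh : Γ.s h ∈ V₁
    · rw [Γ.centralOp_of_mem hh, mul_smul_comm, ← mul_assoc, hz, mul_assoc,
        Γ.p_mul_zero_of_edge_eq k rfl]
    · rw [Γ.centralOp_of_notMem hh, mul_neg, mul_smul_comm, ← mul_assoc, hz, mul_assoc,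
        Γ.p_zero_mul_of_edge_eq k (by rfl)]
  · intro h b
    by_cases hh : Γ.s h ∈ V₁
    · rw [Γ.centralOp_of_mem hh, Γ.centralOp_of_mem hh, ← mul_assoc,
        Γ.p_mul_zero_of_edge_eq k rfl]
    · rw [Γ.centralOp_of_notMem hh, Γ.centralOp_of_notMem hh, ← mul_assoc,
        Γ.p_mul_zero_of_edge_eq k rfl]
  · intro h b
    have h0 : Γ.p k h 1 * Γ.p k (Γ.face h) 1 = 0 :=
      Γ.p_one_mul_p_one k (by rw [ρ_face]; exact Γ.ι_ne h)
    by_cases hh : Γ.s h ∈ V₁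
    · rw [Γ.centralOp_of_mem hh, Γ.centralOp_of_notMem ((Γ.side_face hV).not.2 (not_not.2 hh)),
        mul_neg, mul_smul_comm, ← mul_assoc, hz, mul_assoc, h0, ← mul_assoc, h0]
      simp
    · rw [Γ.centralOp_of_notMem hh, Γ.centralOp_of_mem ((Γ.side_face hV).2 hh),
        mul_smul_comm, ← mul_assoc, hz, mul_assoc, ← mul_assoc (Γ.p k h 0),
        Γ.p_zero_mul_of_edge_eq k (by rw [pow_one, ρ_face, Γ.edge_ι]),
        Γ.p_mul_zero_of_edge_eq k (by rw [ρ_face, Γ.edge_ι])]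
      simp
  · intro h b
    by_cases hh : Γ.s h ∈ V₁
    · rw [Γ.pathOp_centralOp_of_mem hz hh, Γ.pathOp_centralOp_of_notMem hz ((hV h).1 hh),
        sub_neg_eq_add, ← mul_add, ← p_zero_mul_eq_sum, sign, if_pos hh, hz]
      simp [mul_assoc]
    · have hh' : Γ.s (Γ.ι h) ∈ V₁ := by rwa [hV, Γ.ι_involutive]
      have := Γ.p_zero_mul_eq_sum k (Γ.ι h) b
      rw [Γ.ι_involutive] at this
      rw [Γ.pathOp_centralOp_of_notMem hz hh, Γ.pathOp_centralOp_of_mem hz hh',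
        ← neg_add', ← mul_add, add_comm, ← this, sign, if_neg hh, hz, p_ι_zero]
      simp [mul_assoc]

end Central

section Digon

/-- The operators of the deformation of the zero relations at faces of length two by idempotents. -/
def digonOp (a : H → k) (h : H) : Γ.Alg k →ₗ[k] Γ.Alg k :=
  a h • ∑ i ∈ Finset.range (Γ.len (Γ.ι h)),
    (Γ.tr k ∘ₗ LinearMap.mulLeft k (Γ.p k (Γ.ι h) i)).smulRight
      (Γ.p k ((Γ.ρ ^ i) (Γ.ι h)) (Γ.len (Γ.ι h) - (i + 1)))

theorem digonOp_apply (a : H → k) (h : H) (b : Γ.Alg k) : Γ.digonOp a h b =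
    a h • ∑ i ∈ Finset.range (Γ.len (Γ.ι h)), Γ.tr k (Γ.p k (Γ.ι h) i * b) •
      Γ.p k ((Γ.ρ ^ i) (Γ.ι h)) (Γ.len (Γ.ι h) - (i + 1)) := by
  rw [digonOp, LinearMap.smul_apply, LinearMap.sum_apply]
  rfl

variable {a : H → k}

theorem p_zero_mul_digonOp (ha : ∀ h, a h ≠ 0 → Γ.face (Γ.face h) = h) (h : H) (b : Γ.Alg k) :
    Γ.p k (Γ.ρ h) 0 * Γ.digonOp a h b = Γ.digonOp a h b := by
  by_cases h0 : a h = 0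
  · rw [digonOp_apply, h0, zero_smul, mul_zero]
  · rw [digonOp_apply, mul_smul_comm, Finset.mul_sum]
    congr 1
    refine Finset.sum_congr rfl fun i hi => ?_
    rw [mul_smul_comm, Γ.p_zero_mul_of_edge_eq k]
    rw [Γ.ρ_pow_len_sub (Finset.mem_range.1 hi), ← Γ.ι_face_eq_iff.2 (ha h h0), Γ.edge_ι]

theorem digonOp_p_zero_mul (h : H) (b : Γ.Alg k) :
    Γ.digonOp a h (Γ.p k h 0 * b) = Γ.digonOp a h b := by
  rw [digonOp_apply, digonOp_apply]
  congr 1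
  refine Finset.sum_congr rfl fun i _ => ?_
  rw [← mul_assoc, Γ.p_mul_zero_of_edge_eq k (Γ.edge_ι h)]

/-- Up to the factor `a h`, `digonOp` strips the arrow of `face h` from paths that end with it. At a
digon one summand strips and restores the arrow of `h`, the other adds and strips that of `face h`;
these project onto complementary sets of basis paths ending at the common edge. -/
theorem digonOp_face (ha : ∀ h, a h ≠ 0 → Γ.face (Γ.face h) = h)
    (ha' : ∀ h, a (Γ.face h) = a h) (h : H) (b : Γ.Alg k) :
    Γ.p k h 1 * Γ.digonOp a (Γ.face h) b + Γ.digonOp a h (Γ.p k (Γ.face h) 1 * b) =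
      a h • Γ.p k (Γ.face h) 0 * b := by
  by_cases h0 : a h = 0
  · rw [digonOp_apply, digonOp_apply, ha', h0]
    simp
  rw [digonOp_apply, digonOp_apply, ha', mul_smul_comm, ← smul_add, smul_mul_assoc,
    p_zero_mul_eq_sum, add_comm, len_face]
  congr 2
  · refine Finset.sum_congr rfl fun i _ => ?_
    rw [← mul_assoc, Γ.p_mul_p k (i := 1) (by rw [pow_one, ρ_face]), add_comm 1 i, pow_succ,
      Equiv.Perm.mul_apply, ρ_face]
  · rw [Finset.mul_sum]
    refine Finset.sum_congr rfl fun i hi => ?_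
    have hi := Finset.mem_range.1 hi
    rw [mul_smul_comm, Γ.p_one_mul k (by rw [Γ.ρ_pow_len_sub hi, ha h h0]),
      show Γ.len (Γ.ι (Γ.face h)) - (i + 1) + 1 = Γ.len (Γ.ι (Γ.face h)) - i by omega]

/-- The contribution of a face of length two to the deformed commutativity relations. -/
theorem pathOp_digonOp (hV : ∀ h, Γ.s h ∈ V₁ ↔ Γ.s (Γ.ι h) ∉ V₁)
    (hlen : ∀ h, Γ.face (Γ.face h) = h → 2 ≤ Γ.len h)
    (ha : ∀ h, a h ≠ 0 → Γ.face (Γ.face h) = h) (ha' : ∀ h, a (Γ.face h) = a h)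
    (h : H) (b : Γ.Alg k) : Γ.pathOp (Γ.digonOp a) h (Γ.len h) b =
    (a h * Γ.tr k (Γ.p k (Γ.ι h) (Γ.len (Γ.ι h) - 1) * b)) • Γ.p k (Γ.ρ h) (Γ.len h - 1) +
    (a (Γ.ι h) * Γ.tr k (Γ.p k h (Γ.len h - 1) * b)) •
      Γ.p k (Γ.ρ (Γ.ι h)) (Γ.len (Γ.ι h) - 1) := by
  have hlen2 : ∀ h, a h ≠ 0 → 2 ≤ Γ.len h := fun h h0 => hlen h (ha h h0)
  have hlen2' : ∀ h, a h ≠ 0 → 2 ≤ Γ.len (Γ.ι h) := fun h h0 => by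
    rw [← len_face]
    exact hlen2 _ (by rwa [ha'])
  have hpos := Γ.len_pos h
  have hlast : Γ.face (Γ.ι h) = (Γ.ρ ^ (Γ.len h - 1)) h := by
    have := Γ.ρ_pow_len_sub_one (Γ.ι h)
    rw [Γ.ι_involutive] at this
    exact this.symm
  rcases (show Γ.len h = 1 ∨ 2 ≤ Γ.len h by omega) with h1 | h2
  · have h3 : a h = 0 := by
      by_contra h0
      have := hlen2 h h0
      omega
    have h4 : a (Γ.ι h) = 0 := by
      by_contra h0
      have := hlen2' _ h0
      rw [Γ.ι_involutive] at this
      omega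
    rw [h3, h4, pathOp, h1, Finset.sum_range_one, digonOp_apply, pow_zero, Equiv.Perm.one_apply, h3]
    simp
  obtain ⟨n, hn⟩ := Nat.exists_eq_add_of_le' h2
  -- Only the first and the last arrow of the maximal path contribute. For a middle one, both the
  -- path before it and the path after it are non-trivial, and every term of the operator fails to
  -- compose with one of them.
  rw [pathOp, hn, Finset.sum_range_succ, Finset.sum_range_succ', Finset.sum_eq_zero, zero_add]
  · congr 1
    · rw [zero_add, pow_one, pow_zero, Equiv.Perm.one_apply, digonOp_apply, mul_smul_comm, mul_smul]
      by_cases h0 : a h = 0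
      · rw [h0, zero_smul, zero_smul]
      congr 1
      have h2' := hlen2' h h0
      rw [Finset.mul_sum, Finset.sum_eq_single (Γ.len (Γ.ι h) - 1)]
      · rw [mul_smul_comm, ← mul_assoc, Γ.p_mul_zero_of_edge_eq k (Γ.edge_ι h),
          Nat.sub_add_cancel (by omega), Nat.sub_self, ρ_pow_len_sub_one,
          Γ.p_mul_zero_of_edge_eq k ((Γ.edge_face_eq_iff hV).2 (ha h h0)).symm]
      · intro i hi hi'
        have hi := Finset.mem_range.1 hi
        rw [mul_smul_comm, Γ.p_mul_p_of_ne k _ (by omega) (by omega), smul_zero]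
        rw [Γ.ρ_pow_len_sub hi]
        exact Γ.face_ne_ρ hV h
      · intro hi
        exact absurd (Finset.mem_range.2 (by omega)) hi
    · have e1 : (Γ.ρ ^ (n + 1)) h = Γ.face (Γ.ι h) := by
        rw [hlast, hn, show n + 2 - 1 = n + 1 by omega]
      have e2 : (Γ.ρ ^ (n + 1 + 1)) h = h := by
        have := Γ.ρ_pow_len h
        rwa [hn] at this
      rw [e1, e2, Nat.sub_self, digonOp_apply, ha', mul_smul_comm, mul_smul,
        show n + 2 - 1 = n + 1 by omega]
      by_cases h0 : a (Γ.ι h) = 0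
      · rw [h0, zero_smul, zero_smul]
      congr 1
      have e3 : Γ.ι (Γ.face (Γ.ι h)) = Γ.ρ (Γ.ι h) := Γ.ι_face_eq_iff.2 (ha _ h0)
      have e4 : Γ.face (Γ.face (Γ.ι h)) = Γ.ι h := ha _ h0
      have e5 : Γ.len (Γ.ι (Γ.face (Γ.ι h))) = Γ.len (Γ.ι h) := by rw [e3, len_ρ]
      have h2' := hlen2 _ h0
      rw [Finset.mul_sum, Finset.sum_eq_single 0]
      · rw [mul_smul_comm, pow_zero, Equiv.Perm.one_apply, ← mul_assoc,
          Γ.p_zero_mul_of_edge_eq k (by rw [e1, Γ.edge_ι]), e5, zero_add, e3,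
          Γ.p_zero_mul_of_edge_eq k]
        have := Γ.ρ_pow_len_sub_one (Γ.face (Γ.ι h))
        rw [e5, e4, e3] at this
        rw [this, Γ.edge_ι]
      · intro i hi hi'
        rw [← mul_assoc, Γ.p_mul_p_of_ne k (by rw [e1]; exact (Γ.ι_ne _).symm) (by omega)
          (by omega), zero_mul, map_zero, zero_smul, mul_zero]
      · intro hi
        exact absurd (Finset.mem_range.2 (by omega)) hi
  · intro j hj
    have hj := Finset.mem_range.1 hj
    rw [digonOp_apply, mul_smul_comm]
    by_cases h0 : a ((Γ.ρ ^ (j + 1)) h) = 0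
    · rw [h0, zero_smul]
    have h2' := hlen2' _ h0
    rw [Finset.mul_sum, Finset.sum_eq_zero, smul_zero]
    intro i hi
    have hi := Finset.mem_range.1 hi
    rcases Nat.eq_zero_or_pos i with rfl | hi0
    · rw [mul_smul_comm, Γ.p_mul_p_of_ne k _ (by omega) (by omega), smul_zero]
      rw [Γ.ρ_pow_len_sub hi, pow_succ' _ (j + 1), Equiv.Perm.mul_apply]
      exact Γ.face_ne_ρ hV _
    · rw [← mul_assoc, Γ.p_mul_p_of_ne k (Γ.ι_ne _).symm (by omega) hi0, zero_mul, map_zero,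
        zero_smul, mul_zero]

/-- The contribution to a maximal path has two terms, which exchanging the ends of the edge merely
swaps. They cancel in the commutativity relation, so only the zero relations are deformed. -/
theorem exists_kernelBimodule_of_digon (hV : ∀ h, Γ.s h ∈ V₁ ↔ Γ.s (Γ.ι h) ∉ V₁)
    (hlen : ∀ h, Γ.face (Γ.face h) = h → 2 ≤ Γ.len h)
    (ha : ∀ h, a h ≠ 0 → Γ.face (Γ.face h) = h) (ha' : ∀ h, a (Γ.face h) = a h) :
    ∃ t ∈ kernelBimodule (Γ.proj k),
      Γ.relVal t = (fun h => a h • Γ.p k (Γ.face h) 0, 0) := by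
  refine Γ.exists_kernelBimodule_of_operators (Γ.digonOp a) (Γ.p_zero_mul_digonOp ha)
    Γ.digonOp_p_zero_mul _ _ (Γ.digonOp_face ha ha') fun h b => ?_
  rw [Γ.pathOp_digonOp hV hlen ha ha', Γ.pathOp_digonOp hV hlen ha ha', Γ.ι_involutive,
    add_comm, sub_self, Pi.zero_apply, zero_mul]

/-- The operators of the deformation of the zero relations at faces of length two by socle
elements. -/
def digonSocleOp (a : H → k) (h : H) : Γ.Alg k →ₗ[k] Γ.Alg k :=
  a h • (Γ.tr k ∘ₗ LinearMap.mulLeft k (Γ.p k (Γ.ι h) (Γ.len (Γ.ι h) - 1))).smulRight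
    (Γ.p k (Γ.ρ h) (Γ.len (Γ.ρ h)))

theorem digonSocleOp_apply (a : H → k) (h : H) (b : Γ.Alg k) : Γ.digonSocleOp a h b =
    a h • Γ.tr k (Γ.p k (Γ.ι h) (Γ.len (Γ.ι h) - 1) * b) • Γ.p k (Γ.ρ h) (Γ.len (Γ.ρ h)) :=
  rfl

/-- The operator replaces the arrow of `face h` by a socle element. It leaves maximal paths
unaffected: a further arrow kills the socle, and at the last arrow two paths of positive length fail
to compose, for which `hlen` is needed. -/
theorem exists_kernelBimodule_of_digon_socle (hV : ∀ h, Γ.s h ∈ V₁ ↔ Γ.s (Γ.ι h) ∉ V₁)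
    (hlen : ∀ h, Γ.face (Γ.face h) = h → 2 ≤ Γ.len h)
    (ha : ∀ h, a h ≠ 0 → Γ.face (Γ.face h) = h) :
    ∃ t ∈ kernelBimodule (Γ.proj k),
      Γ.relVal t = (fun h => a h • Γ.p k (Γ.ρ h) (Γ.len (Γ.ρ h)), 0) := by
  have hop : ∀ h b, Γ.pathOp (Γ.digonSocleOp a) h (Γ.len h) b = 0 := by
    intro h b
    refine Finset.sum_eq_zero fun i hi => ?_
    have hi := Finset.mem_range.1 hi
    rw [digonSocleOp_apply]
    by_cases h0 : a ((Γ.ρ ^ i) h) = 0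
    · rw [h0, zero_smul, mul_zero]
    rcases (show i + 1 < Γ.len h ∨ i + 1 = Γ.len h by omega) with h1 | h1
    · rw [mul_smul_comm, mul_smul_comm, p_mul_p_len _ _ _ (by omega), smul_zero, smul_zero]
    · have h2 := hlen _ (ha _ h0)
      have h3 := hlen (Γ.face ((Γ.ρ ^ i) h)) (by rw [ha _ h0])
      rw [len_face] at h3
      rw [len_ρ_pow] at h2
      rw [← mul_assoc, Γ.p_mul_p_of_ne k (Γ.ι_ne _).symm (by omega) (by omega), zero_mul, map_zero,
        zero_smul, smul_zero, mul_zero]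
  refine Γ.exists_kernelBimodule_of_operators (Γ.digonSocleOp a) ?_ ?_ _ _ ?_ ?_
  · intro h b
    rw [digonSocleOp_apply, mul_smul_comm, mul_smul_comm,
      Γ.p_zero_mul_of_edge_eq k (by rw [ρ_pow_len])]
  · intro h b
    rw [digonSocleOp_apply, digonSocleOp_apply, ← mul_assoc,
      Γ.p_mul_zero_of_edge_eq k (Γ.edge_ι h)]
  · intro h b
    rw [digonSocleOp_apply, digonSocleOp_apply, mul_smul_comm, mul_smul_comm,
      p_mul_p_len _ _ _ one_pos, smul_zero, smul_zero, zero_add, smul_mul_assoc, p_len_mul]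
    by_cases h0 : a h = 0
    · rw [h0, zero_smul, zero_smul]
    rw [← mul_assoc, Γ.p_mul_p k (i := 1) (by rw [pow_one, ρ_face]),
      add_comm 1, Nat.sub_add_cancel (Γ.len_pos _), ← len_face,
      Γ.p_len_congr ((Γ.edge_face_eq_iff hV).2 (ha h h0))]
  · intro h b
    rw [hop, hop, sub_self, Pi.zero_apply, zero_mul]

end Digon

end BrauerGraph

end

/-! ### Removing the values on the zero relations by derivations -/

noncomputable section

namespace BrauerGraph

open Hochschild

variable {V H : Type*} {k : Type*} [Field k] [Finite H] (Γ : BrauerGraph V H) {V₁ : Set V}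

section Overlaps

variable {t : PathAlgebra k Γ.Edge →ₗ[k] Γ.Alg k}

theorem p_zero_mul_relVal (ht : t ∈ kernelBimodule (Γ.proj k)) (h : H) :
    Γ.p k (Γ.ρ h) 0 * (Γ.relVal t).1 h = (Γ.relVal t).1 h := by
  change Γ.p k (Γ.ρ h) 0 * t _ = t _
  rw [← proj_idem, ← (ht _ _ (Γ.proj_arrow_mul_arrow_face h)).1, ← mul_assoc, Γ.idem_mul_arrow]

theorem relVal_mul_p_zero (ht : t ∈ kernelBimodule (Γ.proj k)) (h : H) :
    (Γ.relVal t).1 h * Γ.p k (Γ.face h) 0 = (Γ.relVal t).1 h := by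
  change t _ * Γ.p k (Γ.face h) 0 = t _
  rw [← proj_idem, ← (ht _ _ (Γ.proj_arrow_mul_arrow_face h)).2, mul_assoc, Γ.arrow_mul_idem]

/-- The overlap relation between consecutive zero relations along a face. -/
theorem relVal_overlap (ht : t ∈ kernelBimodule (Γ.proj k)) (h : H) :
    (Γ.relVal t).1 h * Γ.p k (Γ.face (Γ.face h)) 1 = Γ.p k h 1 * (Γ.relVal t).1 (Γ.face h) := by
  change t _ * _ = _ * t _
  rw [← proj_arrow, ← proj_arrow, ← (ht _ _ (Γ.proj_arrow_mul_arrow_face h)).2,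
    ← (ht _ _ (Γ.proj_arrow_mul_arrow_face (Γ.face h))).1, mul_assoc]

theorem tr_mul_relVal_eq_zero (ht : t ∈ kernelBimodule (Γ.proj k)) {h h' : H} {j : ℕ}
    (e : Γ.edge (Γ.face h) ≠ Γ.edge ((Γ.ρ ^ j) h')) :
    Γ.tr k (Γ.p k h' j * (Γ.relVal t).1 h) = 0 := by
  rw [← Γ.relVal_mul_p_zero ht, ← mul_assoc, tr_mul_comm, ← mul_assoc,
    Γ.p_zero_mul_of_edge_ne k e, zero_mul, map_zero]

theorem tr_relVal_eq_zero (ht : t ∈ kernelBimodule (Γ.proj k))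
    (hV : ∀ h, Γ.s h ∈ V₁ ↔ Γ.s (Γ.ι h) ∉ V₁) {h : H} (e : Γ.face (Γ.face h) ≠ h) :
    Γ.tr k ((Γ.relVal t).1 h) = 0 := by
  rw [← Γ.p_zero_mul_relVal ht]
  exact Γ.tr_mul_relVal_eq_zero ht ((Γ.edge_face_eq_iff hV).not.2 e)

theorem tr_socle_mul_relVal_eq_zero (ht : t ∈ kernelBimodule (Γ.proj k))
    (hV : ∀ h, Γ.s h ∈ V₁ ↔ Γ.s (Γ.ι h) ∉ V₁) {h : H} (e : Γ.face (Γ.face h) ≠ h) :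
    Γ.tr k (Γ.p k (Γ.ρ h) (Γ.len h) * (Γ.relVal t).1 h) = 0 := by
  refine Γ.tr_mul_relVal_eq_zero ht ?_
  rw [← Γ.len_ρ, ρ_pow_len]
  exact (Γ.edge_face_eq_iff hV).not.2 e

theorem ρ_pow_len_sub_one' (h : H) : (Γ.ρ ^ (Γ.len h - 1)) (Γ.ρ h) = h := by
  rw [← Equiv.Perm.mul_apply, ← pow_succ, Nat.sub_add_cancel (Γ.len_pos _), ρ_pow_len]

/-- Along a face of length two, the coefficients of the idempotents agree. -/
theorem tr_socle_mul_relVal_face (ht : t ∈ kernelBimodule (Γ.proj k)) {h : H}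
    (e : Γ.face (Γ.face h) = h) :
    Γ.tr k (Γ.p k (Γ.ρ (Γ.face h)) (Γ.len (Γ.face h)) * (Γ.relVal t).1 (Γ.face h)) =
      Γ.tr k (Γ.p k (Γ.ρ h) (Γ.len h) * (Γ.relVal t).1 h) := by
  have h1 := Γ.relVal_overlap ht h
  rw [e] at h1
  have h2 := congrArg (fun x => Γ.tr k (Γ.p k (Γ.ρ h) (Γ.len h - 1) * x)) h1
  simp only [← mul_assoc] at h2
  rw [Γ.p_mul_p k (i := 1) (by rw [pow_one]), tr_mul_comm, ← mul_assoc,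
    Γ.p_one_mul k (Γ.ρ_pow_len_sub_one' h), add_comm 1, Nat.sub_add_cancel (Γ.len_pos h)] at h2
  rw [h2, ρ_face, len_face, p_len]

end Overlaps

/-- Derivations remove the values of a bimodule map on the zero relations, up to the contributions
of the faces of length two. -/
theorem exists_derivation_relVal_fst {t : PathAlgebra k Γ.Edge →ₗ[k] Γ.Alg k}
    (ht : t ∈ kernelBimodule (Γ.proj k)) (hV : ∀ h, Γ.s h ∈ V₁ ↔ Γ.s (Γ.ι h) ∉ V₁)
    (hsoc : ∀ h, Γ.face (Γ.face h) = h → Γ.s h ∈ V₁ →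
      Γ.tr k (Γ.p k (Γ.ρ h) (Γ.len h) * (Γ.relVal t).1 h) = 0)
    (htr : ∀ h, Γ.face (Γ.face h) = h → Γ.s h ∈ V₁ →
      Γ.tr k ((Γ.relVal t).1 h) = Γ.tr k ((Γ.relVal t).1 (Γ.face h))) :
    ∃ D ∈ derivations (Γ.proj k), (Γ.relVal D).1 = (Γ.relVal t).1 := by
  classical
  obtain ⟨g, hg⟩ : ∃ g, g = (Γ.relVal t).1 := ⟨_, rfl⟩
  have hsoc' : ∀ h, Γ.tr k (Γ.p k (Γ.ρ h) (Γ.len h) * g h) = 0 := by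
    intro h
    rw [hg]
    by_cases e : Γ.face (Γ.face h) = h
    · by_cases hh : Γ.s h ∈ V₁
      · exact hsoc h e hh
      · rw [← Γ.tr_socle_mul_relVal_face ht e]
        exact hsoc _ (by rw [e]) ((Γ.side_face hV).2 hh)
    · exact Γ.tr_socle_mul_relVal_eq_zero ht hV e
  -- The socle coefficient of `g q` can be produced from either factor of the zero relation. At a
  -- digon the half-edge in V₁ carries all of it; away from digons it is zero, the value running
  -- between different edges.
  let sc : H → k := fun q => if Γ.face (Γ.face q) = q ∧ Γ.s q ∈ V₁ then Γ.tr k (g q) else 0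
  -- This is the part of `g q` on paths ending with the arrow of `q`, that arrow being stripped. The
  -- idempotent term is left out because its coefficient vanishes by `hsoc'`.
  let w : H → Γ.Alg k := fun q =>
    ∑ j ∈ Finset.range (Γ.len q - 1), Γ.tr k (Γ.p k (Γ.ρ q) (j + 1) * g q) •
      Γ.p k ((Γ.ρ ^ (j + 1)) (Γ.ρ q)) (Γ.len q - (j + 2)) + sc q • Γ.p k (Γ.ρ q) (Γ.len q - 1)
  have hwl : ∀ q, Γ.p k q 0 * w q = w q := by
    intro q
    simp only [w]
    rw [mul_add, Finset.mul_sum, mul_smul_comm,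
      Γ.p_zero_mul_of_edge_eq k (by rw [ρ_pow_len_sub_one'])]
    congr 1
    refine Finset.sum_congr rfl fun j hj => ?_
    have hj := Finset.mem_range.1 hj
    rw [mul_smul_comm, Γ.p_zero_mul_of_edge_eq k]
    rw [← Equiv.Perm.mul_apply, ← pow_add, show Γ.len q - (j + 2) + (j + 1) = Γ.len q - 1 by omega,
      ρ_pow_len_sub_one']
  have hwr : ∀ q, w q * Γ.p k (Γ.face q) 0 = w q := by
    intro q
    simp only [w]
    rw [add_mul, Finset.sum_mul, smul_mul_assoc]
    congr 1
    · refine Finset.sum_congr rfl fun j hj => ?_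
      by_cases e : Γ.edge (Γ.face q) = Γ.edge ((Γ.ρ ^ (j + 1)) (Γ.ρ q))
      · rw [smul_mul_assoc, Γ.p_mul_zero_of_edge_eq k e.symm]
      · rw [hg, Γ.tr_mul_relVal_eq_zero ht e, zero_smul, zero_mul]
    · simp only [sc]
      split_ifs with e
      · rw [Γ.p_mul_zero_of_edge_eq k ((Γ.edge_face_eq_iff hV).2 e.1).symm]
      · rw [zero_smul, zero_smul]
  obtain ⟨D, hD, -, hDd⟩ := Γ.exists_derivation (fun h => w (Γ.ι (Γ.ρ h)))
    (fun h => by rw [← p_ι_zero, hwl]) (fun h => by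
      have := hwr (Γ.ι (Γ.ρ h))
      rwa [face_ι_ρ] at this)
  refine ⟨D, hD, ?_⟩
  rw [← hg]
  funext h
  change D _ = g h
  rw [hD, hDd, hDd, proj_arrow, proj_arrow, ι_ρ_face]
  obtain ⟨q, hq⟩ : ∃ q, q = Γ.ι (Γ.ρ h) := ⟨_, rfl⟩
  have hqf : Γ.face q = h := by rw [hq, face_ι_ρ]
  have hqs : Γ.s q ∈ V₁ ↔ Γ.s h ∉ V₁ := by rw [← hqf, Γ.side_face hV, not_not]
  rw [← hq]
  have hn := Γ.len_pos h
  have hn' := Γ.len_pos q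
  -- `h1` and `h2` split the trace expansion of `g h` by the last arrow of a path. The first half is
  -- divisible on the left by the arrow of `h`, by construction of `w h`.
  have h1 : ∑ j ∈ Finset.range (Γ.len h), Γ.tr k (Γ.p k (Γ.ρ h) (j + 1) * g h) •
      Γ.p k ((Γ.ρ ^ (j + 1)) (Γ.ρ h)) (Γ.len h - (j + 1)) + sc h • Γ.p k (Γ.ρ h) (Γ.len h) =
      Γ.p k h 1 * w h := by
    simp only [w]
    rw [mul_add, Finset.mul_sum, mul_smul_comm, Γ.p_one_mul k (Γ.ρ_pow_len_sub_one' h),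
      Nat.sub_add_cancel hn]
    congr 1
    obtain ⟨n, hn2⟩ := Nat.exists_eq_succ_of_ne_zero hn.ne'
    rw [hn2, Nat.succ_eq_add_one, Finset.sum_range_succ, Nat.add_sub_cancel,
      ← Nat.succ_eq_add_one n,
      ← hn2, hsoc', zero_smul, add_zero]
    refine Finset.sum_congr rfl fun j hj => ?_
    have hj := Finset.mem_range.1 hj
    rw [mul_smul_comm, Γ.p_one_mul k,
      show Γ.len h - (j + 2) + 1 = Γ.len h - (j + 1) by omega]
    rw [← Equiv.Perm.mul_apply, ← pow_add, show Γ.len h - (j + 2) + (j + 1) = Γ.len h - 1 by omega,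
      ρ_pow_len_sub_one']
  -- The second half is divisible on the right by the arrow of `face h`: `relVal_overlap` at `q`
  -- expresses its coefficients through those of `g q`, hence through `w q`. The socle term is the
  -- one shared with `h1`.
  have h2 : ∑ j ∈ Finset.range (Γ.len q), Γ.tr k (Γ.p k q j * g h) •
      Γ.p k ((Γ.ρ ^ j) q) (Γ.len q - j) - sc h • Γ.p k (Γ.ρ h) (Γ.len h) =
      w q * Γ.p k (Γ.face h) 1 := by
    simp only [w]
    rw [add_mul, Finset.sum_mul, smul_mul_assoc]
    obtain ⟨n, hn2⟩ := Nat.exists_eq_succ_of_ne_zero hn'.ne'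
    rw [hn2, Nat.succ_eq_add_one, Finset.sum_range_succ', Nat.add_sub_cancel,
      ← Nat.succ_eq_add_one n, ← hn2, add_sub_assoc]
    congr 1
    · refine Finset.sum_congr rfl fun j hj => ?_
      have hj := Finset.mem_range.1 hj
      by_cases e : (Γ.ρ ^ (j + 1)) q = Γ.face h
      · have e1 : (Γ.ρ ^ (j + 1)) (Γ.ρ q) = Γ.ρ (Γ.face h) := by
          rw [← e, ← Equiv.Perm.mul_apply, ← Equiv.Perm.mul_apply, ← pow_succ, ← pow_succ']
        have e2 := Γ.relVal_overlap ht q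
        rw [hqf, ← hg] at e2
        have e3 : (Γ.ρ ^ j) (Γ.ρ q) = Γ.face h := by
          rw [← e, ← Equiv.Perm.mul_apply, ← pow_succ]
        rw [smul_mul_assoc, e1, Γ.p_mul_p k (i := 1) (by rw [pow_one]), e,
          show 1 + (Γ.len q - (j + 2)) = Γ.len q - (j + 1) by omega]
        congr 1
        rw [add_comm j 1, ← Γ.p_mul_p k (i := 1) (h := Γ.ρ q) (by rw [pow_one]), mul_assoc, ← e2,
          ← mul_assoc, tr_mul_comm, ← mul_assoc, Γ.p_one_mul k e3, add_comm 1 j]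
      · have e1 : Γ.edge (Γ.face h) ≠ Γ.edge ((Γ.ρ ^ (j + 1)) q) := by
          intro e2
          rcases Γ.edge_eq_edge_iff.1 e2 with e3 | e3
          · exact e e3
          · have e4 : Γ.s (Γ.face h) ∈ V₁ ↔ _ := hV (Γ.face h)
            rw [← e3, Γ.side_face hV, Γ.s_ρ_pow, hqs] at e4
            tauto
        rw [hg, Γ.tr_mul_relVal_eq_zero ht e1, zero_smul, ← hg]
        have e5 : (Γ.ρ ^ (j + 1)) (Γ.ρ q) ≠ Γ.ρ (Γ.face h) := by
          rw [← Equiv.Perm.mul_apply, ← pow_succ, pow_succ', Equiv.Perm.mul_apply]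
          exact fun e6 => e (Γ.ρ.injective e6)
        rcases (show 0 < Γ.len q - (j + 2) ∨ j + 2 = Γ.len q by omega) with hl | hl
        · rw [smul_mul_assoc, Γ.p_mul_p_of_ne k (by rw [pow_one]; exact e5.symm) one_pos hl,
            smul_zero]
        · have e6 : (Γ.ρ ^ (j + 1)) (Γ.ρ q) = q := by
            rw [← Equiv.Perm.mul_apply, ← pow_succ, hl, ρ_pow_len]
          rw [hl, Nat.sub_self, smul_mul_assoc, Γ.p_zero_mul_of_edge_ne k, smul_zero]
          intro e7
          rw [e6, pow_one, ρ_face, Γ.edge_ι, hq, Γ.edge_ι] at e7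
          rcases Γ.edge_eq_edge_iff.1 e7 with e8 | e8
          · apply e
            rw [show j + 1 = Γ.len q - 1 by omega, hq, ← e8, ρ_pow_len_sub_one]
          · have e10 : Γ.s h = Γ.s q := by rw [e8, hq]
            rw [e10] at hqs
            tauto
    · have e0 : Γ.p k q 0 * g h = g h := by
        rw [hq, p_ι_zero, hg, Γ.p_zero_mul_relVal ht]
      have e1 : Γ.p k ((Γ.ρ ^ 0) q) (Γ.len q - 0) = Γ.p k (Γ.ρ h) (Γ.len h) := by
        rw [pow_zero, Equiv.Perm.one_apply, Nat.sub_zero, hq, p_len, len_ρ]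
      rw [e0, e1]
      by_cases e : Γ.face (Γ.face h) = h
      · have e2 : Γ.face h = q := Γ.face_injective (by rw [e, hqf])
        have e3 : Γ.face (Γ.face q) = q := by rw [hqf, e2]
        by_cases hh : Γ.s h ∈ V₁
        · rw [show sc h = Γ.tr k (g h) from if_pos ⟨e, hh⟩,
            show sc q = 0 from if_neg fun h' => hqs.1 h'.2 hh, sub_self, zero_smul]
        · rw [show sc h = 0 from if_neg fun h' => hh h'.2,
            show sc q = Γ.tr k (g q) from if_pos ⟨e3, hqs.2 hh⟩, zero_smul, sub_zero, e2,
            Γ.p_mul_p k (i := 1) (by rw [pow_one]), add_comm 1, ← Nat.succ_eq_add_one n,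
            ← hn2, hg, htr q e3 (hqs.2 hh), hqf, hq, p_len, len_ρ]
      · rw [show sc h = 0 from if_neg fun h' => e h'.1, show sc q = 0 from if_neg fun h' => by
          apply e
          have := congrArg Γ.face h'.1
          rwa [hqf] at this, hg, Γ.tr_relVal_eq_zero ht hV e]
        simp
  have h3 := Γ.p_zero_mul_eq_sum k (Γ.ρ h) (g h)
  rw [← hq, len_ρ] at h3
  rw [← h1, ← h2, add_add_sub_cancel, ← h3, hg, Γ.p_zero_mul_relVal ht]

end BrauerGraph

end

/-! ### Central elements and the parameters of bimodule maps -/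

noncomputable section

namespace BrauerGraph

open Hochschild

variable {V H : Type*} {k : Type*} [Field k] [Finite H] (Γ : BrauerGraph V H) {V₁ : Set V}

theorem sign_ρ (h : H) : Γ.sign V₁ (Γ.ρ h) = Γ.sign V₁ h := by rw [sign, sign, Γ.s_ρ]

theorem sign_ι (hV : ∀ h, Γ.s h ∈ V₁ ↔ Γ.s (Γ.ι h) ∉ V₁) (h : H) :
    Γ.sign V₁ (Γ.ι h) = -Γ.sign V₁ h := by
  rw [sign, sign]
  by_cases hh : Γ.s h ∈ V₁
  · rw [if_pos hh, if_neg ((hV h).1 hh)]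
  · rw [if_neg hh, if_pos (by rwa [hV, Γ.ι_involutive]), neg_neg]

theorem sign_smul_sign_smul (h : H) (x : Γ.Alg k) :
    ((Γ.sign V₁ h : ℤ) : k) • ((Γ.sign V₁ h : ℤ) : k) • x = x := by
  rw [sign]
  split_ifs <;> simp

/-- Elements of the algebra glued from their components at the edges. -/
theorem exists_p_zero_mul_eq (c : H → Γ.Alg k) (hc : ∀ h, Γ.p k h 0 * c h = c h)
    (hι : ∀ h, c (Γ.ι h) = c h) : ∃ z, ∀ h, Γ.p k h 0 * z = c h := by
  choose r hr using Γ.edge_surjective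
  refine ⟨∑ i, c (r i), fun h => ?_⟩
  rw [Finset.mul_sum, Finset.sum_eq_single (Γ.edge h)]
  · have : c (r (Γ.edge h)) = c h := by
      rcases Γ.edge_eq_edge_iff.1 (hr (Γ.edge h)).symm with e | e
      · rw [e]
      · rw [e, hι]
    rw [this, hc]
  · intro i _ hi
    rw [← hc, ← mul_assoc, Γ.p_mul_zero_of_edge_ne k, zero_mul]
    rw [hr]
    exact hi.symm
  · exact fun hi => absurd (Finset.mem_univ _) hi

/-- An element is central if its components at the edges commute with the arrows. -/
theorem central_of_arrow {z : Γ.Alg k} (hz : ∀ h, Γ.p k h 0 * z * Γ.p k h 0 = Γ.p k h 0 * z)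
    (harrow : ∀ h, Γ.p k h 1 * (Γ.p k h 0 * z) = Γ.p k (Γ.ρ h) 0 * z * Γ.p k h 1) (b : Γ.Alg k) :
    b * z = z * b := by
  have h0 : ∀ h, z * Γ.p k h 0 = Γ.p k h 0 * z := by
    intro h
    refine Γ.eq_of_p_zero_mul_eq fun h' => ?_
    by_cases e : Γ.edge h = Γ.edge h'
    · rw [Γ.p_zero_congr k e, ← mul_assoc, hz, ← mul_assoc,
        Γ.p_mul_zero_of_edge_eq k rfl]
    · rw [← mul_assoc, ← hz, mul_assoc _ (Γ.p k h' 0) (Γ.p k h 0),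
        Γ.p_mul_zero_of_edge_ne k (Ne.symm e), mul_zero, ← mul_assoc,
        Γ.p_mul_zero_of_edge_ne k (Ne.symm e), zero_mul]
  have h1 : ∀ h, Γ.p k h 1 * z = z * Γ.p k h 1 := by
    intro h
    have := harrow h
    rwa [← mul_assoc, Γ.p_mul_zero_of_edge_eq k rfl, ← h0, mul_assoc,
      Γ.p_zero_mul_of_edge_eq k (by rfl)] at this
  obtain ⟨x, rfl⟩ := Γ.proj_surjective k b
  induction x using Γ.pathAlgebra_induction with
  | hzero => rw [map_zero, zero_mul, mul_zero]
  | hadd x y hx hy => rw [map_add, add_mul, mul_add, hx, hy]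
  | hsmul c x hx => rw [map_smul, smul_mul_assoc, mul_smul_comm, hx]
  | hidem i =>
    obtain ⟨h, rfl⟩ := Γ.edge_surjective i
    exact (h0 h).symm
  | harrow h x hx => rw [map_mul, proj_arrow, mul_assoc, hx, ← mul_assoc, h1, mul_assoc]

/-- Bimodule maps on `I_Γ` which vanish on the zero relations are given by central elements. -/
theorem exists_central_of_relVal_fst_eq_zero (hV : ∀ h, Γ.s h ∈ V₁ ↔ Γ.s (Γ.ι h) ∉ V₁)
    {t : PathAlgebra k Γ.Edge →ₗ[k] Γ.Alg k} (ht : t ∈ kernelBimodule (Γ.proj k))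
    (ht0 : (Γ.relVal t).1 = 0) :
    ∃ z : Γ.Alg k, (∀ b, b * z = z * b) ∧
      ∀ h, (Γ.relVal t).2 h = ((Γ.sign V₁ h : ℤ) : k) • (Γ.p k h 0 * z) := by
  obtain ⟨c, hcdef⟩ : ∃ c, c = (Γ.relVal t).2 := ⟨_, rfl⟩
  have hct : ∀ h, c h = t (Γ.path k h (Γ.len h) - Γ.path k (Γ.ι h) (Γ.len (Γ.ι h))) := fun h => by
    rw [hcdef]
    rfl
  have hι : ∀ h, c (Γ.ι h) = -c h := by
    intro h
    rw [hct, hct, Γ.ι_involutive, ← map_neg, neg_sub]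
  have hl : ∀ h, Γ.p k h 0 * c h = c h := by
    intro h
    rw [hct, ← proj_idem, ← (ht _ _ (Γ.proj_path_len_sub h)).1, mul_sub]
    have h1 := Γ.idem_mul_path k h (Γ.len h)
    have h2 := Γ.idem_mul_path k (Γ.ι h) (Γ.len (Γ.ι h))
    rw [ρ_pow_len] at h1 h2
    rw [Γ.edge_ι] at h2
    rw [h1, h2]
  have hr : ∀ h, c h * Γ.p k h 0 = c h := by
    intro h
    have h2 := Γ.path_mul_idem k (Γ.ι h) (Γ.len (Γ.ι h))
    rw [Γ.edge_ι] at h2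
    rw [hct, ← proj_idem, ← (ht _ _ (Γ.proj_path_len_sub h)).2, sub_mul, Γ.path_mul_idem, h2]
  have hr0 : ∀ h, t (Γ.arrow k h * Γ.arrow k (Γ.face h)) = 0 := congrFun ht0
  have harr : ∀ h, Γ.p k h 1 * c h = c (Γ.ρ h) * Γ.p k h 1 := by
    intro h
    -- Composing the commutativity relations with the arrow of `h` on either side, the maximal path
    -- at the vertex of `h` gives the same element twice, while the path at the foreign end contains
    -- a zero relation, where `t` vanishes. This yields the commutation `harr`.
    have e1 : t (Γ.arrow k h * Γ.path k (Γ.ι h) (Γ.len (Γ.ι h))) = 0 := by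
      obtain ⟨n, hn⟩ := Nat.exists_eq_succ_of_ne_zero (Γ.len_pos (Γ.ι h)).ne'
      have e2 := Γ.ρ_pow_len_sub_one h
      rw [hn, Nat.succ_sub_one] at e2
      rw [hn, Nat.succ_eq_add_one, Γ.path_succ, e2, ← mul_assoc,
        (ht _ _ (Γ.proj_arrow_mul_arrow_face h)).2, hr0, zero_mul]
    have e3 : t (Γ.path k (Γ.ι (Γ.ρ h)) (Γ.len (Γ.ι (Γ.ρ h))) * Γ.arrow k h) = 0 := by
      obtain ⟨n, hn⟩ := Nat.exists_eq_succ_of_ne_zero (Γ.len_pos (Γ.ι (Γ.ρ h))).ne'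
      have e4 := hr0 (Γ.ι (Γ.ρ h))
      have e5 := Γ.proj_arrow_mul_arrow_face (k := k) (Γ.ι (Γ.ρ h))
      rw [face_ι_ρ] at e4 e5
      rw [hn, Nat.succ_eq_add_one, ← Γ.path_mul_arrow, mul_assoc, (ht _ _ e5).1, e4, mul_zero]
    have e6 : Γ.arrow k h * Γ.path k h (Γ.len h) =
        Γ.path k (Γ.ρ h) (Γ.len (Γ.ρ h)) * Γ.arrow k h := by
      rw [Γ.path_mul_arrow, Γ.path_succ, len_ρ, ρ_pow_len]
    rw [hct, hct, ← proj_arrow, ← (ht _ _ (Γ.proj_path_len_sub h)).1,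
      ← (ht _ _ (Γ.proj_path_len_sub (Γ.ρ h))).2, mul_sub, sub_mul, map_sub, map_sub, e1, e3, e6]
  -- Exchanging the ends of an edge negates both `c` and the sign, so their product depends on the
  -- edge only and glues.
  obtain ⟨z, hz⟩ := Γ.exists_p_zero_mul_eq (fun h => ((Γ.sign V₁ h : ℤ) : k) • c h)
    (fun h => by rw [mul_smul_comm, hl]) (fun h => by rw [Γ.sign_ι hV, hι]; simp)
  refine ⟨z, Γ.central_of_arrow ?_ ?_, fun h => ?_⟩
  · intro h
    rw [hz, smul_mul_assoc, hr]
  · intro h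
    rw [hz, hz, mul_smul_comm, smul_mul_assoc, harr, sign_ρ]
  · rw [hz, sign_smul_sign_smul, hcdef]

section Param

variable (V₁)

/-- One half-edge from every face of length two. -/
abbrev Digon : Type _ := {h : H // Γ.face (Γ.face h) = h ∧ Γ.s h ∈ V₁}

open Classical in
/-- Extension by zero of functions on the faces of length two. -/
def digonExt : (Γ.Digon V₁ → k) →ₗ[k] (H → k) where
  toFun a h := if hh : Γ.face (Γ.face h) = h ∧ Γ.s h ∈ V₁ then a ⟨h, hh⟩ else 0
  map_add' a b := by
    ext h
    simp only [Pi.add_apply]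
    split_ifs <;> simp
  map_smul' c a := by
    ext h
    simp only [Pi.smul_apply, RingHom.id_apply]
    split_ifs <;> simp

variable {V₁}

theorem digonExt_apply (a : Γ.Digon V₁ → k) (h : Γ.Digon V₁) : Γ.digonExt V₁ a h = a h :=
  dif_pos h.2

theorem digonExt_of_not (a : Γ.Digon V₁ → k) {h : H}
    (hh : ¬(Γ.face (Γ.face h) = h ∧ Γ.s h ∈ V₁)) : Γ.digonExt V₁ a h = 0 :=
  dif_neg hh

theorem digonExt_ne_zero {a : Γ.Digon V₁ → k} {h : H} (hh : Γ.digonExt V₁ a h ≠ 0) :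
    Γ.face (Γ.face h) = h := by
  by_contra h0
  exact hh (Γ.digonExt_of_not a fun h' => h0 h'.1)

theorem digonExt_face_face (a : Γ.Digon V₁ → k) (h : H) :
    Γ.digonExt V₁ a (Γ.face (Γ.face h)) = Γ.digonExt V₁ a h := by
  by_cases e : Γ.face (Γ.face h) = h
  · rw [e]
  · rw [Γ.digonExt_of_not a fun h' => e h'.1, Γ.digonExt_of_not a fun h' => e ?_]
    exact Γ.face_injective (Γ.face_injective h'.1)

variable (V₁ k)

/-- The values on the relations of the bimodule maps given by a central element and by functions on
the faces of length two. -/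
def relParam : (Subalgebra.center k (Γ.Alg k) × (Γ.Digon V₁ → k) × (Γ.Digon V₁ → k)) →ₗ[k]
    (H → Γ.Alg k) × (H → Γ.Alg k) where
  toFun q := (fun h => (Γ.digonExt V₁ q.2.1 h + Γ.digonExt V₁ q.2.1 (Γ.face h)) •
      Γ.p k (Γ.face h) 0 + Γ.digonExt V₁ q.2.2 h • Γ.p k (Γ.ρ h) (Γ.len (Γ.ρ h)),
    fun h => ((Γ.sign V₁ h : ℤ) : k) • (Γ.p k h 0 * q.1))
  map_add' q q' := by
    refine Prod.ext (funext fun h => ?_) (funext fun h => ?_)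
    · simp only [Prod.snd_add, Prod.fst_add, map_add, Pi.add_apply, add_smul]
      abel
    · simp only [Prod.fst_add, Pi.add_apply, Subalgebra.coe_add, mul_add, smul_add,
        Prod.snd_add]
  map_smul' c q := by
    refine Prod.ext (funext fun h => ?_) (funext fun h => ?_)
    · simp only [Prod.smul_snd, Prod.smul_fst, map_smul, Pi.smul_apply, smul_add,
        RingHom.id_apply, smul_eq_mul, ← mul_add, mul_smul]
    · simp only [Prod.smul_fst, Pi.smul_apply, Subalgebra.coe_smul, mul_smul_comm,
        RingHom.id_apply, Prod.smul_snd]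
      rw [smul_comm]

variable {V₁ k}

theorem relParam_fst (q : Subalgebra.center k (Γ.Alg k) × (Γ.Digon V₁ → k) × (Γ.Digon V₁ → k))
    (h : H) : (Γ.relParam k V₁ q).1 h =
      (Γ.digonExt V₁ q.2.1 h + Γ.digonExt V₁ q.2.1 (Γ.face h)) • Γ.p k (Γ.face h) 0 +
        Γ.digonExt V₁ q.2.2 h • Γ.p k (Γ.ρ h) (Γ.len (Γ.ρ h)) := rfl

theorem relParam_snd (q : Subalgebra.center k (Γ.Alg k) × (Γ.Digon V₁ → k) × (Γ.Digon V₁ → k))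
    (h : H) : (Γ.relParam k V₁ q).2 h = ((Γ.sign V₁ h : ℤ) : k) • (Γ.p k h 0 * q.1) := rfl

theorem exists_relVal_eq_relParam (hV : ∀ h, Γ.s h ∈ V₁ ↔ Γ.s (Γ.ι h) ∉ V₁)
    (hlen : ∀ h, Γ.face (Γ.face h) = h → 2 ≤ Γ.len h)
    (q : Subalgebra.center k (Γ.Alg k) × (Γ.Digon V₁ → k) × (Γ.Digon V₁ → k)) :
    ∃ t ∈ kernelBimodule (Γ.proj k), Γ.relVal t = Γ.relParam k V₁ q := by
  obtain ⟨⟨z, hz⟩, a, b⟩ := q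
  obtain ⟨t₁, ht₁, h₁⟩ := Γ.exists_kernelBimodule_of_central hV (z := z)
    fun x => Subalgebra.mem_center_iff.1 hz x
  -- The idempotent deformation must have equal coefficients at `h` and `face h`, whereas `digonExt`
  -- is supported on V₁; hence the sum over both.
  obtain ⟨t₂, ht₂, h₂⟩ := Γ.exists_kernelBimodule_of_digon (k := k) hV hlen
    (a := fun h => Γ.digonExt V₁ a h + Γ.digonExt V₁ a (Γ.face h)) (fun h h0 => by
      by_cases h1 : Γ.digonExt V₁ a h = 0
      · rw [h1, zero_add] at h0
        exact Γ.face_injective (Γ.digonExt_ne_zero h0)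
      · exact Γ.digonExt_ne_zero h1) (fun h => by
      rw [digonExt_face_face, add_comm])
  obtain ⟨t₃, ht₃, h₃⟩ := Γ.exists_kernelBimodule_of_digon_socle (k := k) hV hlen
    (a := Γ.digonExt V₁ b) fun h h0 => Γ.digonExt_ne_zero h0
  refine ⟨t₁ + t₂ + t₃, add_mem (add_mem ht₁ ht₂) ht₃, ?_⟩
  rw [map_add, map_add, h₁, h₂, h₃]
  refine Prod.ext (funext fun h => ?_) (funext fun h => ?_)
  · simp [relParam_fst]
  · simp [relParam_snd]

/-- Together with `tr_relParam_fst_sub`, this recovers the two digon parameters from the values on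
the zero relations by linear functionals. Those functionals also make sense for an arbitrary
bimodule map. -/
theorem tr_socle_mul_relParam_fst (hV : ∀ h, Γ.s h ∈ V₁ ↔ Γ.s (Γ.ι h) ∉ V₁)
    (q : Subalgebra.center k (Γ.Alg k) × (Γ.Digon V₁ → k) × (Γ.Digon V₁ → k)) (h : Γ.Digon V₁) :
    Γ.tr k (Γ.p k (Γ.ρ h) (Γ.len h.1) * (Γ.relParam k V₁ q).1 h) = q.2.1 h := by
  rw [relParam_fst, digonExt_apply, digonExt_apply, Γ.digonExt_of_not _ fun h' =>
    (Γ.side_face hV).1 h'.2 h.2.2, add_zero, mul_add, mul_smul_comm, mul_smul_comm,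
    Γ.p_mul_p_len _ _ (Γ.len_pos _), Γ.p_mul_zero_of_edge_eq k
    ((Γ.edge_face_eq_iff hV).2 h.2.1).symm, smul_zero, add_zero, map_smul, ← len_ρ, tr_p_len,
    smul_eq_mul, mul_one]

theorem tr_relParam_fst_sub (hV : ∀ h, Γ.s h ∈ V₁ ↔ Γ.s (Γ.ι h) ∉ V₁)
    (q : Subalgebra.center k (Γ.Alg k) × (Γ.Digon V₁ → k) × (Γ.Digon V₁ → k)) (h : Γ.Digon V₁) :
    Γ.tr k ((Γ.relParam k V₁ q).1 h) - Γ.tr k ((Γ.relParam k V₁ q).1 (Γ.face h)) = q.2.2 h := by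
  rw [relParam_fst, relParam_fst, Γ.digonExt_apply q.2.2, Γ.digonExt_of_not q.2.2 fun h' =>
    (Γ.side_face hV).1 h'.2 h.2.2]
  simp only [map_add, map_smul, tr_p_len, Γ.tr_p_of_ne k (Γ.len_pos _).ne, smul_eq_mul,
    mul_one, zero_smul, mul_zero, map_zero, zero_add, sub_zero]

/-- Subtracting the explicit deformation with the same digon parameters makes the obstructions to
`exists_derivation_relVal_fst` vanish; after a derivation only a central element remains. -/
theorem exists_relVal_eq_add (hV : ∀ h, Γ.s h ∈ V₁ ↔ Γ.s (Γ.ι h) ∉ V₁)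
    (hlen : ∀ h, Γ.face (Γ.face h) = h → 2 ≤ Γ.len h) (t : PathAlgebra k Γ.Edge →ₗ[k] Γ.Alg k)
    (ht : t ∈ kernelBimodule (Γ.proj k)) :
    ∃ D ∈ derivations (Γ.proj k), ∃ q, Γ.relVal t = Γ.relVal D + Γ.relParam k V₁ q := by
  let a : Γ.Digon V₁ → k := fun h => Γ.tr k (Γ.p k (Γ.ρ h) (Γ.len h.1) * (Γ.relVal t).1 h)
  let b : Γ.Digon V₁ → k := fun h => Γ.tr k ((Γ.relVal t).1 h) - Γ.tr k ((Γ.relVal t).1 (Γ.face h))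
  obtain ⟨t₁, ht₁, h₁⟩ := Γ.exists_relVal_eq_relParam hV hlen (0, a, b)
  obtain ⟨D, hD, hDt⟩ := Γ.exists_derivation_relVal_fst (sub_mem ht ht₁) hV
    (by
      intro h e hh
      have := Γ.tr_socle_mul_relParam_fst hV (0, a, b) ⟨h, e, hh⟩
      rw [map_sub, h₁, Prod.fst_sub, Pi.sub_apply, mul_sub, map_sub, this, sub_self])
    (by
      intro h e hh
      have := Γ.tr_relParam_fst_sub hV (0, a, b) ⟨h, e, hh⟩
      rw [map_sub, h₁, Prod.fst_sub, Pi.sub_apply, Pi.sub_apply, map_sub, map_sub,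
        sub_eq_sub_iff_sub_eq_sub, this])
  obtain ⟨z, hz, hz'⟩ := Γ.exists_central_of_relVal_fst_eq_zero hV
    (sub_mem (sub_mem ht ht₁) (derivations_le_kernelBimodule _ hD)) (by
      rw [map_sub, Prod.fst_sub, hDt, sub_self])
  refine ⟨D, hD, (⟨z, Subalgebra.mem_center_iff.2 hz⟩, a, b), ?_⟩
  have h2 : Γ.relVal (t - t₁ - D) =
      Γ.relParam k V₁ (⟨z, Subalgebra.mem_center_iff.2 hz⟩, 0, 0) := by
    refine Prod.ext ?_ (funext hz')
    rw [map_sub, Prod.fst_sub, hDt, sub_self]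
    funext h
    simp [relParam_fst]
  have h3 : Γ.relParam k V₁ (⟨z, Subalgebra.mem_center_iff.2 hz⟩, a, b) =
      Γ.relParam k V₁ (⟨z, Subalgebra.mem_center_iff.2 hz⟩, 0, 0) + Γ.relParam k V₁ (0, a, b) := by
    rw [← map_add, Prod.mk_add_mk, Prod.mk_add_mk, add_zero, zero_add, zero_add]
  rw [h3, ← h2, ← h₁, map_sub, map_sub]
  abel

end Param

end BrauerGraph

end

/-! ### The parameters that come from derivations -/

noncomputable section

namespace BrauerGraph

open Hochschild

variable {V H : Type*} {k : Type*} [Field k] [Finite H] (Γ : BrauerGraph V H) {V₁ : Set V}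

/-- Up to inner derivations, derivations vanish on the idempotents of the edges. -/
theorem exists_derivation_idem_eq_zero {D : PathAlgebra k Γ.Edge →ₗ[k] Γ.Alg k}
    (hD : D ∈ derivations (Γ.proj k)) :
    ∃ D' ∈ derivations (Γ.proj k), (∀ i, D' (Γ.idem k i) = 0) ∧ Γ.relVal D' = Γ.relVal D := by
  -- On the span of the idempotents, a separable algebra, `D` is the inner derivation by this `b`.
  -- Inner derivations vanish on the kernel of the projection, so `relVal` does not change.
  obtain ⟨b, hb⟩ : ∃ b, b = ∑ i, D (Γ.idem k i) * Γ.proj k (Γ.idem k i) := ⟨_, rfl⟩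
  let A : PathAlgebra k Γ.Edge →ₗ[k] Γ.Alg k :=
    (LinearMap.mulLeft k b - LinearMap.mulRight k b) ∘ₗ (Γ.proj k).toLinearMap
  have hA : ∀ x, A x = b * Γ.proj k x - Γ.proj k x * b := fun x => rfl
  have hAD : A ∈ derivations (Γ.proj k) := by
    intro x y
    rw [hA, hA, hA, map_mul, mul_sub, sub_mul]
    simp only [mul_assoc]
    abel
  refine ⟨D - A, sub_mem hD hAD, fun j => ?_, ?_⟩
  · have h1 : b * Γ.proj k (Γ.idem k j) = D (Γ.idem k j) * Γ.proj k (Γ.idem k j) := by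
      rw [hb, Finset.sum_mul, Finset.sum_eq_single j]
      · rw [mul_assoc, ← map_mul, Γ.idem_mul_self]
      · intro i _ hi
        rw [mul_assoc, ← map_mul, Γ.idem_mul_of_ne k hi, map_zero, mul_zero]
      · exact fun hi => absurd (Finset.mem_univ _) hi
    have h2 : Γ.proj k (Γ.idem k j) * b =
        D (Γ.idem k j) * Γ.proj k (Γ.idem k j) - D (Γ.idem k j) := by
      have e : ∀ i, Γ.proj k (Γ.idem k j) * (D (Γ.idem k i) * Γ.proj k (Γ.idem k i)) =
          D (Γ.idem k j * Γ.idem k i) * Γ.proj k (Γ.idem k i) -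
            D (Γ.idem k j) * Γ.proj k (Γ.idem k i) := by
        intro i
        rw [hD, add_mul, mul_assoc _ _ (Γ.proj k (Γ.idem k i)), mul_assoc (D _), ← map_mul,
          Γ.idem_mul_self, add_sub_cancel_right]
      rw [hb, Finset.mul_sum, Finset.sum_congr rfl fun i _ => e i, Finset.sum_sub_distrib,
        ← Finset.mul_sum, Γ.sum_idem_eq_one k, mul_one, Finset.sum_eq_single j]
      · rw [Γ.idem_mul_self]
      · intro i _ hi
        rw [Γ.idem_mul_of_ne k hi.symm, map_zero, zero_mul]
      · exact fun hi => absurd (Finset.mem_univ _) hi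
    rw [LinearMap.sub_apply, hA, h1, h2, sub_sub_cancel, sub_self]
  · have hz : Γ.relVal A = 0 :=
      (Γ.relVal_eq_zero_iff A (derivations_le_kernelBimodule _ hAD)).2 fun y hy => by
        rw [hA, hy, mul_zero, zero_mul, sub_zero]
    rw [map_sub, hz, sub_zero]

theorem relVal_fst_of_derivation {D : PathAlgebra k Γ.Edge →ₗ[k] Γ.Alg k}
    (hD : D ∈ derivations (Γ.proj k)) (h : H) : (Γ.relVal D).1 h =
      Γ.p k h 1 * D (Γ.arrow k (Γ.face h)) + D (Γ.arrow k h) * Γ.p k (Γ.face h) 1 := by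
  rw [← proj_arrow, ← proj_arrow]
  exact hD _ _

/-- On a product of two arrows a derivation has no idempotent coefficient, as every term contains an
arrow. Its traces on the two products along a digon agree because the trace is symmetric. -/
theorem snd_eq_zero_of_relVal_eq_relParam (hV : ∀ h, Γ.s h ∈ V₁ ↔ Γ.s (Γ.ι h) ∉ V₁)
    {D : PathAlgebra k Γ.Edge →ₗ[k] Γ.Alg k} (hD : D ∈ derivations (Γ.proj k))
    {q : Subalgebra.center k (Γ.Alg k) × (Γ.Digon V₁ → k) × (Γ.Digon V₁ → k)}
    (hq : Γ.relVal D = Γ.relParam k V₁ q) : q.2 = 0 := by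
  refine Prod.ext (funext fun h => ?_) (funext fun h => ?_)
  · rw [← Γ.tr_socle_mul_relParam_fst hV, ← hq, Γ.relVal_fst_of_derivation hD, mul_add, map_add,
      ← mul_assoc, Γ.p_mul_p k (by rw [pow_one]), Γ.p_eq_zero k (by omega), zero_mul, map_zero,
      zero_add, ← mul_assoc, tr_mul_comm, ← mul_assoc, ← Γ.len_ρ h,
      Γ.p_mul_p_len _ _ Nat.one_pos, zero_mul, map_zero]
    rfl
  · rw [← Γ.tr_relParam_fst_sub hV, ← hq, Γ.relVal_fst_of_derivation hD,
      Γ.relVal_fst_of_derivation hD, h.2.1, map_add, map_add, Γ.tr_mul_comm k (Γ.p k h 1),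
      Γ.tr_mul_comm k (Γ.p k (Γ.face h) 1), add_comm, sub_self]
    rfl

section Potential

variable {D : PathAlgebra k Γ.Edge →ₗ[k] Γ.Alg k}

theorem p_zero_mul_derivation_arrow (hD : D ∈ derivations (Γ.proj k))
    (h0 : ∀ i, D (Γ.idem k i) = 0) (h : H) :
    Γ.p k (Γ.ρ h) 0 * D (Γ.arrow k h) = D (Γ.arrow k h) := by
  have := hD (Γ.idem k (Γ.edge (Γ.ρ h))) (Γ.arrow k h)
  rwa [Γ.idem_mul_arrow, h0, zero_mul, add_zero, proj_idem, eq_comm] at this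

theorem derivation_arrow_mul_p_zero (hD : D ∈ derivations (Γ.proj k))
    (h0 : ∀ i, D (Γ.idem k i) = 0) (h : H) :
    D (Γ.arrow k h) * Γ.p k h 0 = D (Γ.arrow k h) := by
  have := hD (Γ.arrow k h) (Γ.idem k (Γ.edge h))
  rwa [Γ.arrow_mul_idem, h0, mul_zero, zero_add, proj_idem, eq_comm] at this

/-- Thus the image of an arrow has no idempotent component. By bipartiteness only an arrow fixed by
ρ needs proof; there the zero relation with `face h`, multiplied by a path completing the arrow of
`face h` to a socle element, isolates the coefficient. -/
theorem tr_socle_mul_derivation (hV : ∀ h, Γ.s h ∈ V₁ ↔ Γ.s (Γ.ι h) ∉ V₁)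
    (hlen : ∀ h, Γ.face (Γ.face h) = h → 2 ≤ Γ.len h) (hD : D ∈ derivations (Γ.proj k))
    (h0 : ∀ i, D (Γ.idem k i) = 0) (hr : (Γ.relVal D).1 = 0) (h h' : H) :
    Γ.tr k (Γ.p k h' (Γ.len h') * D (Γ.arrow k h)) = 0 := by
  by_cases e1 : Γ.edge h' = Γ.edge (Γ.ρ h)
  swap
  · rw [← Γ.p_zero_mul_derivation_arrow hD h0, ← mul_assoc, Γ.p_mul_zero_of_edge_ne k e1, zero_mul,
      map_zero]
  by_cases e2 : Γ.edge h = Γ.edge h'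
  swap
  · rw [← Γ.derivation_arrow_mul_p_zero hD h0, ← mul_assoc, tr_mul_comm, ← mul_assoc,
      Γ.p_zero_mul_of_edge_ne k (by rwa [Γ.ρ_pow_len]), zero_mul, map_zero]
  rw [Γ.p_len_congr (e2.symm)]
  have e3 : Γ.ρ h = h := by
    rcases Γ.edge_eq_edge_iff.1 (e2.trans e1) with e | e
    · exact e
    · have h1 := hV h
      rw [← e, Γ.s_ρ] at h1
      tauto
  have h2 := congrArg (fun x => Γ.tr k (x * Γ.p k (Γ.ι h) (Γ.len (Γ.ι h) - 1))) (congrFun hr h)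
  simp only [Pi.zero_apply, zero_mul, map_zero, Γ.relVal_fst_of_derivation hD, add_mul,
    map_add] at h2
  rw [mul_assoc (D _), Γ.p_mul_p k (Γ.ρ_pow_len_sub_one h), Nat.sub_add_cancel (Γ.len_pos _),
    tr_mul_comm, ← mul_assoc, Γ.tr_mul_comm k (D _), p_len] at h2
  by_cases e4 : Γ.len (Γ.ι h) = 1
  · exfalso
    have e5 : Γ.face h = Γ.ι h := by
      rw [← Γ.ρ_pow_len_sub_one, e4, Nat.sub_self, pow_zero]
      rfl
    have e6 : Γ.face (Γ.ι h) = h := by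
      rw [face_eq_iff, Γ.ι_involutive, e3]
    have := hlen (Γ.ι h) (by rw [e6, e5])
    omega
  · have := Γ.len_pos (Γ.ι h)
    rwa [Γ.p_mul_p_of_ne k (by rw [pow_one, e3]; exact (Γ.ι_ne h).symm) Nat.one_pos (by omega),
      zero_mul, map_zero, zero_add] at h2

theorem tr_p_mul_derivation_eq_zero_of_len_le (hV : ∀ h, Γ.s h ∈ V₁ ↔ Γ.s (Γ.ι h) ∉ V₁)
    (hlen : ∀ h, Γ.face (Γ.face h) = h → 2 ≤ Γ.len h) (hD : D ∈ derivations (Γ.proj k))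
    (h0 : ∀ i, D (Γ.idem k i) = 0) (hr : (Γ.relVal D).1 = 0) (h : H) {h' : H} {l : ℕ}
    (hl : Γ.len h' ≤ l) : Γ.tr k (Γ.p k h' l * D (Γ.arrow k h)) = 0 := by
  rcases hl.eq_or_lt with rfl | hl
  · exact Γ.tr_socle_mul_derivation hV hlen hD h0 hr h h'
  · rw [Γ.p_eq_zero k hl, zero_mul, map_zero]

/-- When the arrow is itself a socle element, its image is a multiple of itself. A path reaching it
from the other end of the edge ends with the arrow of `face h`, and the zero relation moves the
derivation onto that arrow, where the socle factor kills it. -/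
theorem tr_p_mul_derivation_eq_zero_of_len_eq_one (hV : ∀ h, Γ.s h ∈ V₁ ↔ Γ.s (Γ.ι h) ∉ V₁)
    (hlen : ∀ h, Γ.face (Γ.face h) = h → 2 ≤ Γ.len h) (hD : D ∈ derivations (Γ.proj k))
    (h0 : ∀ i, D (Γ.idem k i) = 0) (hr : (Γ.relVal D).1 = 0) {h : H} (h1 : Γ.len h = 1)
    (h' : H) {i : ℕ} (hi : 0 < i) : Γ.tr k (Γ.p k h' i * D (Γ.arrow k h)) = 0 := by
  have e3 : Γ.ρ h = h := by
    have := Γ.ρ_pow_len h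
    rwa [h1, pow_one] at this
  by_cases e : Γ.edge h = Γ.edge ((Γ.ρ ^ i) h')
  swap
  · rw [← Γ.derivation_arrow_mul_p_zero hD h0, ← mul_assoc, tr_mul_comm, ← mul_assoc,
      Γ.p_zero_mul_of_edge_ne k e, zero_mul, map_zero]
  obtain ⟨j, rfl⟩ := Nat.exists_eq_succ_of_ne_zero hi.ne'
  rcases Γ.edge_eq_edge_iff.1 e with e | e
  · refine Γ.tr_p_mul_derivation_eq_zero_of_len_le hV hlen hD h0 hr h ?_
    rw [← Γ.len_ρ_pow h' j.succ, e, h1]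
    exact hi
  · have e4 : (Γ.ρ ^ j) h' = Γ.face h := by
      rw [eq_comm, face_eq_iff, ← e, pow_succ']
      rfl
    have h2 := congrFun hr h
    rw [Γ.relVal_fst_of_derivation hD] at h2
    have h3 : Γ.p k h 1 * D (Γ.arrow k (Γ.face h)) = 0 := by
      have := Γ.p_len_mul h (D (Γ.arrow k (Γ.face h)))
      rwa [Γ.tr_socle_mul_derivation hV hlen hD h0 hr, zero_smul, h1] at this
    rw [h3, zero_add] at h2
    rw [tr_mul_comm, ← Γ.p_mul_p k e4 1, ← mul_assoc, h2, Pi.zero_apply, zero_mul, map_zero]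

theorem p_mul_p_eq_zero_or (h h' : H) {i : ℕ} (j : ℕ) (hi : 0 < i) :
    Γ.p k h j * Γ.p k h' i = 0 ∨
      (Γ.p k h j * Γ.p k h' i = Γ.p k h' (i + j) ∧ (0 < j → (Γ.ρ ^ i) h' = h)) := by
  rcases Nat.eq_zero_or_pos j with rfl | hj
  · by_cases e : Γ.edge h = Γ.edge ((Γ.ρ ^ i) h')
    · exact Or.inr ⟨Γ.p_zero_mul_of_edge_eq k e, fun h => absurd h (lt_irrefl 0)⟩
    · exact Or.inl (Γ.p_zero_mul_of_edge_ne k e)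
  · by_cases e : (Γ.ρ ^ i) h' = h
    · exact Or.inr ⟨Γ.p_mul_p k e j, fun _ => e⟩
    · exact Or.inl (Γ.p_mul_p_of_ne k e hi hj)

/-- Replacing one arrow of a maximal path by its image under `D` gives a multiple of the socle
element, the factor being the coefficient of that arrow in its own image. The proof pairs both sides
with all paths: non-trivial ones produce paths at least as long as the maximal one, or the case of
length 1. -/
theorem p_mul_derivation_mul_p (hV : ∀ h, Γ.s h ∈ V₁ ↔ Γ.s (Γ.ι h) ∉ V₁)
    (hlen : ∀ h, Γ.face (Γ.face h) = h → 2 ≤ Γ.len h) (hD : D ∈ derivations (Γ.proj k))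
    (h0 : ∀ i, D (Γ.idem k i) = 0) (hr : (Γ.relVal D).1 = 0) {g h : H} {a j : ℕ}
    (e : (Γ.ρ ^ j) h = g) (hj : a + j + 1 = Γ.len h) :
    Γ.p k (Γ.ρ g) a * D (Γ.arrow k g) * Γ.p k h j =
      Γ.tr k (Γ.p k (Γ.ρ g) (a + j) * D (Γ.arrow k g)) • Γ.p k h (Γ.len h) := by
  have hg : Γ.len g = Γ.len h := by rw [← e, len_ρ_pow]
  have ha : (Γ.ρ ^ a) (Γ.ρ g) = h := by
    rw [← e, ← Equiv.Perm.mul_apply, ← Equiv.Perm.mul_apply, ← pow_succ, ← pow_add]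
    convert Γ.ρ_pow_len h using 3
    omega
  refine Γ.eq_of_tr_p_mul_eq fun h' i => ?_
  rcases Nat.eq_zero_or_pos i with rfl | hi
  · by_cases e' : Γ.edge h' = Γ.edge h
    · rw [mul_smul_comm, ← mul_assoc, ← mul_assoc, Γ.p_zero_mul_of_edge_eq k (by rw [ha, e']),
        Γ.p_zero_mul_of_edge_eq k (by rw [ρ_pow_len, e']), map_smul, tr_p_len, smul_eq_mul, mul_one,
        tr_mul_comm, ← mul_assoc, Γ.p_mul_p k ha]
    · rw [mul_smul_comm, ← mul_assoc, ← mul_assoc, Γ.p_zero_mul_of_edge_ne k (by rwa [ha]),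
        Γ.p_zero_mul_of_edge_ne k (by rwa [ρ_pow_len]), zero_mul, zero_mul, smul_zero]
  · rw [mul_smul_comm, Γ.p_mul_p_len _ _ hi, smul_zero, map_zero, ← mul_assoc, tr_mul_comm,
      ← mul_assoc, ← mul_assoc]
    rcases Γ.p_mul_p_eq_zero_or (k := k) h h' j hi with e1 | ⟨e1, e2⟩
    · rw [e1, zero_mul, zero_mul, map_zero]
    rw [e1]
    rcases Nat.eq_zero_or_pos a with rfl | ha'
    · rw [mul_assoc, Γ.p_zero_mul_derivation_arrow hD h0]
      rcases Nat.eq_zero_or_pos j with rfl | hj'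
      · exact Γ.tr_p_mul_derivation_eq_zero_of_len_eq_one hV hlen hD h0 hr (by omega) _ (by omega)
      · refine Γ.tr_p_mul_derivation_eq_zero_of_len_le hV hlen hD h0 hr g ?_
        rw [← Γ.len_ρ_pow h' i, e2 hj']
        omega
    · rcases Γ.p_mul_p_eq_zero_or (k := k) h' (Γ.ρ g) (i + j) ha' with e3 | ⟨e3, -⟩
      · rw [e3, zero_mul, map_zero]
      · rw [e3]
        refine Γ.tr_p_mul_derivation_eq_zero_of_len_le hV hlen hD h0 hr g ?_
        rw [len_ρ]
        omega

/-- A derivation which vanishes on the zero relations scales the maximal paths around a vertex. -/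
theorem exists_derivation_path_len_eq_smul (hV : ∀ h, Γ.s h ∈ V₁ ↔ Γ.s (Γ.ι h) ∉ V₁)
    (hlen : ∀ h, Γ.face (Γ.face h) = h → 2 ≤ Γ.len h) (hD : D ∈ derivations (Γ.proj k))
    (h0 : ∀ i, D (Γ.idem k i) = 0) (hr : (Γ.relVal D).1 = 0) :
    ∃ X : V → k, ∀ h, D (Γ.path k h (Γ.len h)) = X (Γ.s h) • Γ.p k h (Γ.len h) := by
  obtain ⟨x, hx⟩ : ∃ x : H → k, ∀ g, x g = Γ.tr k (Γ.p k (Γ.ρ g) (Γ.len g - 1) *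
    D (Γ.arrow k g)) := ⟨_, fun _ => rfl⟩
  -- The sum over a whole maximal path runs round the vertex as often as its multiplicity; it is
  -- invariant under ρ, hence a function of the vertex.
  obtain ⟨X, hX⟩ : ∃ X : H → k, ∀ h, X h = ∑ i ∈ Finset.range (Γ.len h), x ((Γ.ρ ^ i) h) :=
    ⟨_, fun _ => rfl⟩
  have hXρ : ∀ h, X (Γ.ρ h) = X h := by
    intro h
    have h1 := Finset.sum_range_succ (fun i => x ((Γ.ρ ^ i) h)) (Γ.len h)
    rw [Finset.sum_range_succ', ρ_pow_len, pow_zero, Equiv.Perm.one_apply, add_left_inj] at h1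
    rw [hX, hX, len_ρ, ← h1]
    rfl
  have hXs : ∀ h h', Γ.s h = Γ.s h' → X h = X h' := by
    intro h h' e
    obtain ⟨i, rfl⟩ := ((Γ.sameCycle_iff h h').2 e).exists_nat_pow_eq
    clear e
    induction i with
    | zero => rfl
    | succ i ih => rw [pow_succ', Equiv.Perm.mul_apply, hXρ, ih]
  have hpath : ∀ h j a, a + j = Γ.len h → Γ.p k ((Γ.ρ ^ j) h) a * D (Γ.path k h j) =
      (∑ i ∈ Finset.range j, x ((Γ.ρ ^ i) h)) • Γ.p k h (Γ.len h) := by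
    intro h j
    induction j with
    | zero => intro a _; rw [Γ.path_zero, h0, mul_zero, Finset.sum_range_zero, zero_smul]
    | succ j ih =>
      intro a ha
      rw [Γ.path_succ, hD, proj_arrow, proj_path, mul_add, ← mul_assoc, ← mul_assoc, pow_succ',
        Equiv.Perm.mul_apply, Γ.p_mul_p k (by rw [pow_one]), add_comm 1 a, ih (a + 1) (by omega),
        Γ.p_mul_derivation_mul_p hV hlen hD h0 hr rfl (by omega), Finset.sum_range_succ, add_smul,
        hx, len_ρ_pow, ← ha, ← add_assoc, Nat.add_sub_cancel]
  choose r hrs using Γ.s_surjective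
  refine ⟨X ∘ r, fun h => ?_⟩
  have h1 := hpath h (Γ.len h) 0 (zero_add _)
  rw [ρ_pow_len, ← hX] at h1
  have h2 := hD (Γ.idem k (Γ.edge h)) (Γ.path k h (Γ.len h))
  have h3 := Γ.idem_mul_path k h (Γ.len h)
  rw [ρ_pow_len] at h3
  rw [h3, h0, zero_mul, add_zero, proj_idem, h1] at h2
  rw [h2, Function.comp_apply, hXs _ _ (hrs (Γ.s h))]

end Potential

end BrauerGraph

end

/-! ### The dimension in terms of the centre -/

noncomputable section

theorem RibbonGraph.Connected.apply_eq {V H : Type*} {Γ : RibbonGraph V H} (hΓ : Γ.Connected)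
    {α : Type*} {f : V → α} (hf : ∀ h, f (Γ.s h) = f (Γ.s (Γ.ι h))) (v w : V) : f v = f w := by
  obtain ⟨walk⟩ := hΓ.preconnected v w
  induction walk with
  | nil => rfl
  | cons hadj _ ih =>
    rw [← ih]
    obtain ⟨-, ⟨h, rfl, rfl⟩ | ⟨h, rfl, rfl⟩⟩ := (SimpleGraph.fromRel_adj _ _ _).1 hadj
    · exact hf h
    · exact (hf h).symm

namespace BrauerGraph

open Hochschild

variable {V H : Type*} {k : Type*} [Field k] (Γ : BrauerGraph V H) {V₁ : Set V}

instance [Finite H] : Module.Finite k (Γ.Alg k) := by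
  have hfin : (Set.range fun x : Σ h, Fin (Γ.len h + 1) => Γ.p k x.1 x.2).Finite :=
    Set.finite_range _
  refine ⟨⟨hfin.toFinset, ?_⟩⟩
  rw [Set.Finite.coe_toFinset, eq_top_iff]
  rintro b -
  induction b using Γ.alg_induction with
  | hzero => exact zero_mem _
  | hadd x y hx hy => exact add_mem hx hy
  | hsmul c x hx => exact Submodule.smul_mem _ c hx
  | hp h j hj => exact Submodule.subset_span ⟨⟨h, j, Nat.lt_succ_of_le hj⟩, rfl⟩

variable [Fintype H]

theorem p_zero_mul_sum_socle (y : H → k) (h : H) :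
    Γ.p k h 0 * ∑ h', y h' • Γ.p k h' (Γ.len h') =
      (y h + y (Γ.ι h)) • Γ.p k h (Γ.len h) := by
  rw [Finset.mul_sum, Fintype.sum_eq_add h (Γ.ι h) (Γ.ι_ne h).symm]
  · rw [mul_smul_comm, mul_smul_comm, p_len, Γ.p_zero_mul_of_edge_eq k (by rw [ρ_pow_len]),
      add_smul]
  · rintro h' ⟨h1, h2⟩
    rw [mul_smul_comm, Γ.p_zero_mul_of_edge_ne k, smul_zero]
    rw [ρ_pow_len]
    intro e
    rcases Γ.edge_eq_edge_iff.1 e with e | e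
    exacts [h1 e, h2 e]

theorem sum_socle_mem_center (y : H → k) :
    ∑ h', y h' • Γ.p k h' (Γ.len h') ∈ Subalgebra.center k (Γ.Alg k) := by
  refine Subalgebra.mem_center_iff.2 (Γ.central_of_arrow (fun h => ?_) fun h => ?_)
  · rw [p_zero_mul_sum_socle, smul_mul_assoc, Γ.p_mul_zero_of_edge_eq k rfl]
  · rw [p_zero_mul_sum_socle, p_zero_mul_sum_socle, mul_smul_comm, smul_mul_assoc,
      Γ.p_mul_p_len _ _ Nat.one_pos, Γ.p_mul_p k (by rw [pow_one]), Γ.p_eq_zero k, smul_zero,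
      smul_zero]
    rw [len_ρ]
    omega

variable (k) in
/-- The central elements of the socle given by functions on the vertices. -/
def vertexSocle : (V → k) →ₗ[k] Subalgebra.center k (Γ.Alg k) where
  toFun y := ⟨_, Γ.sum_socle_mem_center fun h => y (Γ.s h)⟩
  map_add' y y' := Subtype.ext (by
    simp only [Pi.add_apply, add_smul, Finset.sum_add_distrib, Subalgebra.coe_add])
  map_smul' c y := Subtype.ext (by
    simp only [Pi.smul_apply, smul_eq_mul, mul_smul, Finset.smul_sum, Subalgebra.coe_smul,
      RingHom.id_apply])

theorem p_zero_mul_vertexSocle (y : V → k) (h : H) :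
    Γ.p k h 0 * (Γ.vertexSocle k y : Γ.Alg k) =
      (y (Γ.s h) + y (Γ.s (Γ.ι h))) • Γ.p k h (Γ.len h) :=
  Γ.p_zero_mul_sum_socle (fun h => y (Γ.s h)) h

/-- The derivation multiplies the socle element by the difference of the scaling factors at the two
ends of an edge. Twisting the factors by the bipartition sign turns differences into the sums that
define `vertexSocle`. -/
theorem exists_vertexSocle_eq (hV : ∀ h, Γ.s h ∈ V₁ ↔ Γ.s (Γ.ι h) ∉ V₁)
    (hlen : ∀ h, Γ.face (Γ.face h) = h → 2 ≤ Γ.len h)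
    {D : PathAlgebra k Γ.Edge →ₗ[k] Γ.Alg k} (hD : D ∈ derivations (Γ.proj k))
    {q : Subalgebra.center k (Γ.Alg k) × (Γ.Digon V₁ → k) × (Γ.Digon V₁ → k)}
    (hq : Γ.relVal D = Γ.relParam k V₁ q) : ∃ y, Γ.vertexSocle k y = q.1 := by
  classical
  have hq2 := Γ.snd_eq_zero_of_relVal_eq_relParam hV hD hq
  obtain ⟨D', hD', h0, hD'q⟩ := Γ.exists_derivation_idem_eq_zero hD
  rw [hq] at hD'q
  have hr : (Γ.relVal D').1 = 0 := by
    rw [hD'q]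
    funext h
    simp [relParam_fst, hq2]
  obtain ⟨X, hX⟩ := Γ.exists_derivation_path_len_eq_smul hV hlen hD' h0 hr
  have hsgn : ∃ σ : V → k, ∀ h, ((Γ.sign V₁ h : ℤ) : k) = σ (Γ.s h) :=
    ⟨fun v => (((if v ∈ V₁ then 1 else -1 : ℤˣ) : ℤ) : k), fun h => by
      rw [sign]⟩
  obtain ⟨σ, hσ⟩ := hsgn
  refine ⟨fun v => σ v * X v, Subtype.ext (Γ.eq_of_p_zero_mul_eq fun h => ?_)⟩
  have h1 : (Γ.relVal D').2 h = X (Γ.s h) • Γ.p k h (Γ.len h) -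
      X (Γ.s (Γ.ι h)) • Γ.p k h (Γ.len h) := by
    rw [← hX h, ← p_len, ← hX (Γ.ι h), ← map_sub]
    rfl
  rw [hD'q, relParam_snd] at h1
  rw [← Γ.sign_smul_sign_smul (V₁ := V₁) h (Γ.p k h 0 * (q.1 : Γ.Alg k)), h1,
    p_zero_mul_vertexSocle, ← hσ, ← hσ, Γ.sign_ι hV, ← sub_smul, ← mul_smul]
  congr 1
  push_cast
  ring

/-- Scale the arrows at each vertex by a constant. A maximal path is then scaled by its length times
that constant, so characteristic 0 is what allows every factor to be reached. -/
theorem exists_derivation_relVal_eq_vertexSocle [CharZero k]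
    (hV : ∀ h, Γ.s h ∈ V₁ ↔ Γ.s (Γ.ι h) ∉ V₁) (y : V → k) :
    ∃ D ∈ derivations (Γ.proj k), Γ.relVal D = Γ.relParam k V₁ (Γ.vertexSocle k y, 0, 0) := by
  obtain ⟨c, hc⟩ : ∃ c : H → k, ∀ h, c h = ((Γ.sign V₁ h : ℤ) : k) * y (Γ.s h) / Γ.len h :=
    ⟨_, fun _ => rfl⟩
  have hcρ : ∀ h j, c ((Γ.ρ ^ j) h) = c h := by
    intro h j
    rw [hc, hc, Γ.s_ρ_pow, len_ρ_pow, sign, sign, Γ.s_ρ_pow]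
  obtain ⟨D, hD, h0, h1⟩ := Γ.exists_derivation (fun h => c h • Γ.p k h 1)
    (fun h => by rw [mul_smul_comm, Γ.p_zero_mul_of_edge_eq k (by rw [pow_one])])
    (fun h => by rw [smul_mul_assoc, Γ.p_mul_zero_of_edge_eq k rfl])
  have hpath : ∀ h j, D (Γ.path k h j) = (j * c h) • Γ.p k h j := by
    intro h j
    induction j with
    | zero => rw [Γ.path_zero, h0, Nat.cast_zero, zero_mul, zero_smul]
    | succ j ih =>
      rw [Γ.path_succ, hD, ih, h1, proj_arrow, proj_path, smul_mul_assoc, mul_smul_comm,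
        Γ.p_one_mul k rfl, ← add_smul, hcρ, Nat.cast_succ, add_mul, one_mul]
  have hlen' : ∀ h, (Γ.len h : k) * c h = ((Γ.sign V₁ h : ℤ) : k) * y (Γ.s h) := by
    intro h
    rw [hc, mul_div_cancel₀]
    exact Nat.cast_ne_zero.2 (Γ.len_pos h).ne'
  refine ⟨D, hD, Prod.ext (funext fun h => ?_) (funext fun h => ?_)⟩
  · rw [Γ.relVal_fst_of_derivation hD, h1, h1, mul_smul_comm, smul_mul_assoc,
      Γ.p_one_mul_p_one k (by rw [ρ_face]; exact Γ.ι_ne h), relParam_fst]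
    simp
  · change D (Γ.path k h (Γ.len h) - Γ.path k (Γ.ι h) (Γ.len (Γ.ι h))) = _
    rw [map_sub, hpath, hpath, hlen', hlen', p_len, ← sub_smul, relParam_snd,
      p_zero_mul_vertexSocle, ← mul_smul, Γ.sign_ι hV]
    congr 1
    push_cast
    ring

theorem comap_relParam_eq_range [CharZero k] (hV : ∀ h, Γ.s h ∈ V₁ ↔ Γ.s (Γ.ι h) ∉ V₁)
    (hlen : ∀ h, Γ.face (Γ.face h) = h → 2 ≤ Γ.len h) :
    ((derivations (Γ.proj k)).map Γ.relVal).comap (Γ.relParam k V₁) =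
      LinearMap.range (LinearMap.inl k (Subalgebra.center k (Γ.Alg k))
        ((Γ.Digon V₁ → k) × (Γ.Digon V₁ → k)) ∘ₗ Γ.vertexSocle k) := by
  ext q
  constructor
  · rintro ⟨D, hD, hq⟩
    obtain ⟨y, hy⟩ := Γ.exists_vertexSocle_eq hV hlen hD hq
    exact ⟨y, Prod.ext hy (Γ.snd_eq_zero_of_relVal_eq_relParam hV hD hq).symm⟩
  · rintro ⟨y, rfl⟩
    exact Γ.exists_derivation_relVal_eq_vertexSocle hV y

theorem vertexSocle_eq_zero_iff {y : V → k} :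
    Γ.vertexSocle k y = 0 ↔ ∀ h, y (Γ.s h) + y (Γ.s (Γ.ι h)) = 0 := by
  constructor
  · intro hy h
    have h1 := congrArg (Γ.tr k) (Γ.p_zero_mul_vertexSocle y h)
    rw [hy, ZeroMemClass.coe_zero, mul_zero, map_zero, map_smul, tr_p_len, smul_eq_mul,
      mul_one] at h1
    exact h1.symm
  · intro hy
    refine Subtype.ext (Γ.eq_of_p_zero_mul_eq fun h => ?_)
    rw [p_zero_mul_vertexSocle, hy, zero_smul, ZeroMemClass.coe_zero, mul_zero]

/-- A function in the kernel changes sign along every edge. After multiplication by the bipartition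
sign it is constant, by connectedness. -/
theorem finrank_ker_vertexSocle (hΓ : Γ.Connected) (hV : ∀ h, Γ.s h ∈ V₁ ↔ Γ.s (Γ.ι h) ∉ V₁) :
    Module.finrank k (LinearMap.ker (Γ.vertexSocle k)) = 1 := by
  classical
  obtain ⟨σ, hσ⟩ : ∃ σ : V → k, ∀ v, σ v = if v ∈ V₁ then 1 else -1 := ⟨_, fun _ => rfl⟩
  have hσι : ∀ h, σ (Γ.s (Γ.ι h)) = -σ (Γ.s h) := by
    intro h
    rw [hσ, hσ]
    by_cases hh : Γ.s h ∈ V₁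
    · rw [if_pos hh, if_neg ((hV h).1 hh)]
    · rw [if_neg hh, if_pos (by rwa [hV, Γ.ι_involutive]), neg_neg]
  have hσσ : ∀ v, σ v * σ v = 1 := by
    intro v
    rw [hσ]
    split_ifs <;> simp
  obtain ⟨v⟩ := hΓ.nonempty
  have hker : LinearMap.ker (Γ.vertexSocle k) = Submodule.span k {σ} := by
    ext y
    rw [LinearMap.mem_ker, vertexSocle_eq_zero_iff, Submodule.mem_span_singleton]
    constructor
    · intro hy
      refine ⟨σ v * y v, funext fun w => ?_⟩
      have := hΓ.apply_eq (f := fun v => σ v * y v) (fun h => by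
        rw [hσι, eq_neg_of_add_eq_zero_left (hy h)]
        ring) v w
      rw [Pi.smul_apply, this, smul_eq_mul, mul_right_comm, hσσ, one_mul]
    · rintro ⟨c, rfl⟩ h
      rw [Pi.smul_apply, Pi.smul_apply, hσι, smul_neg, add_neg_cancel]
  rw [hker, finrank_span_singleton]
  intro h0
  have := hσσ v
  rw [h0] at this
  simp at this

/-- The dimension of the second Hochschild cohomology in terms of the centre. -/
theorem finrank_HH2_add_card [CharZero k] [Fintype V] (hΓ : Γ.Connected)
    (hV : ∀ h, Γ.s h ∈ V₁ ↔ Γ.s (Γ.ι h) ∉ V₁)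
    (hlen : ∀ h, Γ.face (Γ.face h) = h → 2 ≤ Γ.len h) :
    Module.Finite k (HH2 k (Γ.Alg k)) ∧ Module.finrank k (HH2 k (Γ.Alg k)) + Nat.card V =
      Module.finrank k (Subalgebra.center k (Γ.Alg k)) + 2 * Nat.card (Γ.Digon V₁) + 1 := by
  classical
  obtain ⟨e⟩ := nonempty_HH2_equiv (Γ.proj_surjective k) Γ.liftsCocycles_proj Γ.relVal
    (Γ.relParam k V₁) Γ.relVal_eq_zero_iff (Γ.exists_relVal_eq_relParam hV hlen)
    (Γ.exists_relVal_eq_add hV hlen)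
  refine ⟨Module.Finite.equiv e.symm, ?_⟩
  have hker : LinearMap.ker (LinearMap.inl k (Subalgebra.center k (Γ.Alg k))
      ((Γ.Digon V₁ → k) × (Γ.Digon V₁ → k)) ∘ₗ Γ.vertexSocle k) =
      LinearMap.ker (Γ.vertexSocle k) :=
    LinearMap.ker_comp_of_ker_eq_bot _ (LinearMap.ker_eq_bot.2 LinearMap.inl_injective)
  have h1 := LinearMap.finrank_range_add_finrank_ker
    (LinearMap.inl k (Subalgebra.center k (Γ.Alg k))
      ((Γ.Digon V₁ → k) × (Γ.Digon V₁ → k)) ∘ₗ Γ.vertexSocle k)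
  rw [hker, Γ.finrank_ker_vertexSocle hΓ hV, Module.finrank_fintype_fun_eq_card] at h1
  have h2 := Submodule.finrank_quotient_add_finrank
    (((derivations (Γ.proj k)).map Γ.relVal).comap (Γ.relParam k V₁))
  rw [← e.finrank_eq, Γ.comap_relParam_eq_range hV hlen, Module.finrank_prod, Module.finrank_prod,
    Module.finrank_fintype_fun_eq_card] at h2
  rw [Nat.card_eq_fintype_card, Nat.card_eq_fintype_card]
  omega

end BrauerGraph

end

/-! ### Two-cycles, the centre and the general formula -/

noncomputable section

namespace BrauerGraph

open Hochschild

variable {V H : Type*} {k : Type*} [Field k] (Γ : BrauerGraph V H) {V₁ : Set V}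

section Finite

variable [Finite H]

theorem ρ_pow_ne_ι (hV : ∀ h, Γ.s h ∈ V₁ ↔ Γ.s (Γ.ι h) ∉ V₁) (h : H) (j : ℕ) :
    (Γ.ρ ^ j) h ≠ Γ.ι h := by
  intro e
  have h1 := hV h
  rw [← e, Γ.s_ρ_pow] at h1
  tauto

theorem p_ne_zero {h : H} {j : ℕ} (hj : j ≤ Γ.len h) : Γ.p k h j ≠ 0 := by
  intro h0
  have h1 := Γ.tr_p_mul_p_eq_one k (rfl : (Γ.ρ ^ j) h = _) (Nat.add_sub_cancel' hj)
  rw [h0, mul_zero, map_zero] at h1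
  exact zero_ne_one h1

/-- A composable product of two distinct arrows lies in the ideal only if the second factor is
`face` of the first: otherwise it is a path around one vertex, nonzero unless the vertex has maximal
path length 1, in which case the arrows coincide. Each digon gives two ordered 2-cycles. -/
theorem ncard_twoCycles (hV : ∀ h, Γ.s h ∈ V₁ ↔ Γ.s (Γ.ι h) ∉ V₁) :
    (Γ.twoCycles k).ncard = 2 * Nat.card (Γ.Digon V₁) := by
  have key : ∀ h h', h ≠ h' → Γ.edge (Γ.ρ h') = Γ.edge h →
      Γ.arrow k h * Γ.arrow k h' ∈ Γ.relIdeal k → Γ.face h = h' := by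
    intro h h' hne he hI
    rcases Γ.edge_eq_edge_iff.1 he.symm with e | e
    · exfalso
      rw [← proj_eq_zero_iff, map_mul, proj_arrow, proj_arrow,
        Γ.p_mul_p k (by rw [pow_one, e])] at hI
      have h1 : Γ.len h' < 2 := by
        by_contra hlt
        exact Γ.p_ne_zero (not_lt.1 hlt) hI
      have h2 := Γ.len_pos h'
      have h3 := Γ.ρ_pow_len h'
      rw [show Γ.len h' = 1 by omega, pow_one, e] at h3
      exact hne h3
    · rw [face_eq_iff, e]
  have h1 : Γ.twoCycles k = (fun h => (h, Γ.face h)) '' {h | Γ.face (Γ.face h) = h} := by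
    ext ⟨h, h'⟩
    constructor
    · rintro ⟨hne, he, he', hI, hI'⟩
      have e1 := key h h' hne he hI
      have e2 := key h' h hne.symm he' hI'
      exact ⟨h, (congrArg Γ.face e1).trans e2, congrArg (Prod.mk h) e1⟩
    · rintro ⟨g, hg, hgh⟩
      obtain ⟨rfl, rfl⟩ := Prod.mk.inj hgh
      have h3 := Γ.proj_eq_zero_iff.1 (Γ.proj_arrow_mul_arrow_face (k := k) (Γ.face g))
      refine ⟨fun e => ?_, ?_, ?_, Γ.proj_eq_zero_iff.1 (Γ.proj_arrow_mul_arrow_face g), ?_⟩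
      · have h2 := Γ.side_face hV (h := g)
        have e' : g = Γ.face g := e
        rw [← e'] at h2
        tauto
      · change Γ.edge (Γ.ρ (Γ.face g)) = Γ.edge g
        rw [ρ_face, Γ.edge_ι]
      · exact ((Γ.edge_face_eq_iff hV).2 hg).symm
      · rw [hg] at h3
        exact h3
  have h2 : {h | Γ.face (Γ.face h) = h} = {h | Γ.face (Γ.face h) = h ∧ Γ.s h ∈ V₁} ∪
      Γ.face '' {h | Γ.face (Γ.face h) = h ∧ Γ.s h ∈ V₁} := by
    ext h
    constructor
    · intro e
      by_cases hh : Γ.s h ∈ V₁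
      · exact Or.inl ⟨e, hh⟩
      · exact Or.inr ⟨Γ.face h, ⟨congrArg Γ.face e, (Γ.side_face hV).2 hh⟩, e⟩
    · rintro (⟨e, -⟩ | ⟨g, ⟨e, -⟩, rfl⟩)
      · exact e
      · exact congrArg Γ.face e
  have hdisj : Disjoint {h | Γ.face (Γ.face h) = h ∧ Γ.s h ∈ V₁}
      (Γ.face '' {h | Γ.face (Γ.face h) = h ∧ Γ.s h ∈ V₁}) := by
    rw [Set.disjoint_right]
    rintro _ ⟨g, ⟨-, hg⟩, rfl⟩ ⟨-, hg'⟩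
    exact (Γ.side_face hV).1 hg' hg
  rw [h1, Set.ncard_image_of_injective _ fun a b hab => (Prod.mk.inj hab).1, h2,
    Set.ncard_union_eq hdisj, Set.ncard_image_of_injective _ Γ.face_injective, two_mul]
  rfl

/-- A central element has no components between different edges. By bipartiteness a path around a
vertex that returns to its edge returns to its half-edge. -/
theorem tr_p_mul_central_eq_zero (hV : ∀ h, Γ.s h ∈ V₁ ↔ Γ.s (Γ.ι h) ∉ V₁) {z : Γ.Alg k}
    (hz : ∀ b, b * z = z * b) {h : H} {j : ℕ} (e : (Γ.ρ ^ j) h ≠ h) :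
    Γ.tr k (Γ.p k h j * z) = 0 := by
  have e' : Γ.edge h ≠ Γ.edge ((Γ.ρ ^ j) h) := by
    intro e'
    rcases Γ.edge_eq_edge_iff.1 e' with e'' | e''
    exacts [e e'', Γ.ρ_pow_ne_ι hV h j e'']
  rw [← Γ.p_zero_mul_of_edge_eq k (rfl : Γ.edge ((Γ.ρ ^ j) h) = _), mul_assoc, tr_mul_comm,
    mul_assoc, ← hz, ← mul_assoc, Γ.p_mul_zero_of_edge_ne k e', zero_mul, map_zero]

/-- Centrality and symmetry of the trace allow a closed path to be rotated by one arrow. So the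
pairing depends only on the vertex and the length of the path. -/
theorem tr_p_ρ_mul_central {z : Γ.Alg k} (hz : ∀ b, b * z = z * b) {h : H} {j : ℕ} (hj : 0 < j)
    (e : (Γ.ρ ^ j) h = h) : Γ.tr k (Γ.p k (Γ.ρ h) j * z) = Γ.tr k (Γ.p k h j * z) := by
  obtain ⟨i, rfl⟩ := Nat.exists_eq_succ_of_ne_zero hj.ne'
  have e' : (Γ.ρ ^ i) (Γ.ρ h) = h := by
    rw [← Equiv.Perm.mul_apply, ← pow_succ]
    exact e
  rw [← Γ.p_mul_p k e' 1, mul_assoc, tr_mul_comm, mul_assoc, ← hz, ← mul_assoc,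
    Γ.p_mul_p k (by rw [pow_one]), add_comm 1 i]

theorem tr_p_mul_central_congr {z : Γ.Alg k} (hz : ∀ b, b * z = z * b) {h h' : H} {j : ℕ}
    (hj : 0 < j) (e : (Γ.ρ ^ j) h = h) (hs : Γ.s h = Γ.s h') :
    Γ.tr k (Γ.p k h' j * z) = Γ.tr k (Γ.p k h j * z) := by
  obtain ⟨i, rfl⟩ := ((Γ.sameCycle_iff h h').2 hs).exists_nat_pow_eq
  clear hs
  induction i with
  | zero => rfl
  | succ i ih =>
    rw [pow_succ', Equiv.Perm.mul_apply, Γ.tr_p_ρ_mul_central hz hj, ih]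
    rw [← Equiv.Perm.mul_apply, ← pow_add, add_comm, pow_add, Equiv.Perm.mul_apply, e]

/-- The pairing with the socle reads off the coefficient of an idempotent. It is constant at each
vertex by rotation, and the two ends of an edge share their socle element. -/
theorem tr_socle_mul_central_congr (hΓ : Γ.Connected) {z : Γ.Alg k} (hz : ∀ b, b * z = z * b)
    (h h' : H) :
    Γ.tr k (Γ.p k h (Γ.len h) * z) = Γ.tr k (Γ.p k h' (Γ.len h') * z) := by
  have hs : ∀ h h', Γ.s h = Γ.s h' →
      Γ.tr k (Γ.p k h' (Γ.len h') * z) = Γ.tr k (Γ.p k h (Γ.len h) * z) := by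
    intro h h' hs
    rw [← Γ.len_eq_of_s_eq hs]
    exact Γ.tr_p_mul_central_congr hz (Γ.len_pos h) (Γ.ρ_pow_len h) hs
  choose r hr using Γ.s_surjective
  have := hΓ.apply_eq (f := fun v => Γ.tr k (Γ.p k (r v) (Γ.len (r v)) * z)) (fun h => by
    rw [hs _ _ (hr _).symm, hs _ _ (hr (Γ.s (Γ.ι h))).symm, p_len]) (Γ.s h) (Γ.s h')
  rwa [hs _ _ (hr _).symm, hs _ _ (hr (Γ.s h')).symm] at this

end Finite

section Centre

variable [Fintype H]

theorem p_zero_mul_sum (u : H → Γ.Alg k) (hu : ∀ h, Γ.p k h 0 * u h = u h) (h : H) :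
    Γ.p k h 0 * ∑ h', u h' = u h + u (Γ.ι h) := by
  rw [Finset.mul_sum, Fintype.sum_eq_add h (Γ.ι h) (Γ.ι_ne h).symm, hu, ← Γ.p_ι_zero k h, hu]
  rintro h' ⟨h1, h2⟩
  rw [← hu h', ← mul_assoc, Γ.p_mul_zero_of_edge_ne k, zero_mul]
  intro e
  rcases Γ.edge_eq_edge_iff.1 e with e | e
  exacts [h1 e, h2 e]

variable (k) in
/-- The linear combination of the powers of the cycle of a half-edge `h` at `v`, except for the
zeroth and the highest one, with given coefficients. -/
def cycleSum (b : (Σ v, Fin (Γ.m v - 1)) → k) (v : V) (h : H) : Γ.Alg k :=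
  ∑ i : Fin (Γ.m v - 1), b ⟨v, i⟩ • Γ.p k h (Γ.val v * (Γ.m v - (i + 1)))

theorem cycleExp_pos (h : H) (i : Fin (Γ.m (Γ.s h) - 1)) :
    0 < Γ.val (Γ.s h) * (Γ.m (Γ.s h) - (i + 1)) :=
  Nat.mul_pos (Γ.val_pos h) (by have := i.2; omega)

theorem cycleExp_lt (h : H) (i : Fin (Γ.m (Γ.s h) - 1)) :
    Γ.val (Γ.s h) * (Γ.m (Γ.s h) - (i + 1)) < Γ.len h :=
  Nat.mul_lt_mul_of_pos_left (by have := i.2; omega) (Γ.val_pos h)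

theorem ρ_pow_val_mul (h : H) (l : ℕ) : (Γ.ρ ^ (Γ.val (Γ.s h) * l)) h = h :=
  Γ.ρ_pow_eq_self_iff.2 ⟨l, rfl⟩

variable (b : (Σ v, Fin (Γ.m v - 1)) → k)

theorem p_zero_mul_cycleSum (h : H) :
    Γ.p k h 0 * Γ.cycleSum k b (Γ.s h) h = Γ.cycleSum k b (Γ.s h) h := by
  rw [cycleSum, Finset.mul_sum]
  refine Finset.sum_congr rfl fun i _ => ?_
  rw [mul_smul_comm, Γ.p_zero_mul_of_edge_eq k (by rw [ρ_pow_val_mul])]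

theorem cycleSum_mul_p_zero (h : H) :
    Γ.cycleSum k b (Γ.s h) h * Γ.p k h 0 = Γ.cycleSum k b (Γ.s h) h := by
  rw [cycleSum, Finset.sum_mul]
  refine Finset.sum_congr rfl fun i _ => ?_
  rw [smul_mul_assoc, Γ.p_mul_zero_of_edge_eq k rfl]

theorem sum_cycleSum_mem_center :
    ∑ h, Γ.cycleSum k b (Γ.s h) h ∈ Subalgebra.center k (Γ.Alg k) := by
  have h0 := Γ.p_zero_mul_sum _ (Γ.p_zero_mul_cycleSum b)
  refine Subalgebra.mem_center_iff.2 (Γ.central_of_arrow (fun h => ?_) fun h => ?_)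
  · rw [h0, add_mul, cycleSum_mul_p_zero, ← Γ.p_ι_zero k h, cycleSum_mul_p_zero]
  · have e1 : Γ.p k h 1 * Γ.cycleSum k b (Γ.s (Γ.ι h)) (Γ.ι h) = 0 := by
      rw [cycleSum, Finset.mul_sum]
      refine Finset.sum_eq_zero fun i _ => ?_
      rw [mul_smul_comm, Γ.p_mul_p_of_ne k (by rw [ρ_pow_val_mul]; exact Γ.ι_ne h)
        (Γ.cycleExp_pos _ i) Nat.one_pos, smul_zero]
    have e2 : Γ.cycleSum k b (Γ.s (Γ.ι (Γ.ρ h))) (Γ.ι (Γ.ρ h)) * Γ.p k h 1 = 0 := by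
      rw [cycleSum, Finset.sum_mul]
      refine Finset.sum_eq_zero fun i _ => ?_
      rw [smul_mul_assoc, Γ.p_mul_p_of_ne k (by rw [pow_one]; exact (Γ.ι_ne _).symm) Nat.one_pos
        (Γ.cycleExp_pos _ i), smul_zero]
    rw [h0, h0, mul_add, add_mul, e1, e2, add_zero, add_zero, Γ.s_ρ, cycleSum, cycleSum,
      Finset.mul_sum, Finset.sum_mul]
    refine Finset.sum_congr rfl fun i _ => ?_
    rw [mul_smul_comm, smul_mul_assoc, Γ.p_one_mul k (Γ.ρ_pow_val_mul h _),
      Γ.p_mul_p k (by rw [pow_one]), add_comm 1]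

theorem tr_p_mul_cycleSum_of_ne {h h' : H} (hne : h' ≠ h) {j : ℕ} (hj : 0 < j) :
    Γ.tr k (Γ.p k h j * Γ.cycleSum k b (Γ.s h') h') = 0 := by
  rw [cycleSum, Finset.mul_sum, Finset.sum_eq_zero, map_zero]
  intro i _
  rw [mul_smul_comm, Γ.p_mul_p_of_ne k (by rwa [ρ_pow_val_mul]) (Γ.cycleExp_pos _ i) hj, smul_zero]

/-- The exponents in `cycleSum` are complementary to those of the test paths, so the two families
are dual for the trace. -/
theorem tr_p_mul_cycleSum {v : V} {h : H} (hv : Γ.s h = v) (i : Fin (Γ.m v - 1)) :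
    Γ.tr k (Γ.p k h (Γ.val v * (i + 1)) * Γ.cycleSum k b v h) = b ⟨v, i⟩ := by
  subst hv
  have hi := i.2
  rw [cycleSum, Finset.mul_sum, map_sum, Finset.sum_eq_single i]
  · rw [mul_smul_comm, map_smul, Γ.tr_p_mul_p_eq_one k (Γ.ρ_pow_val_mul h _), smul_eq_mul, mul_one]
    rw [← mul_add, Nat.sub_add_cancel (by omega)]
    rfl
  · intro i' _ hne
    rw [mul_smul_comm, map_smul, Γ.tr_p_mul_p_eq_zero_of_len k (Γ.cycleExp_pos _ i'), smul_zero]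
    rw [← mul_add]
    intro e
    have h1 := Nat.eq_of_mul_eq_mul_left (Γ.val_pos h) e
    have := i'.2
    exact hne (Fin.ext (by omega))
  · exact fun hi => absurd (Finset.mem_univ _) hi

theorem tr_p_zero_mul_cycleSum (h h' : H) :
    Γ.tr k (Γ.p k h 0 * Γ.cycleSum k b (Γ.s h') h') = 0 := by
  rw [cycleSum, Finset.mul_sum, map_sum]
  refine Finset.sum_eq_zero fun i _ => ?_
  rw [mul_smul_comm, map_smul, Γ.tr_p_mul_p_eq_zero_of_len k (Γ.cycleExp_pos _ i), smul_zero]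
  exact (Γ.cycleExp_lt h' i).ne

theorem tr_socle_mul_cycleSum (h h' : H) :
    Γ.tr k (Γ.p k h (Γ.len h) * Γ.cycleSum k b (Γ.s h') h') = 0 := by
  by_cases e : h' = h
  · subst e
    rw [cycleSum, Finset.mul_sum, map_sum]
    refine Finset.sum_eq_zero fun i _ => ?_
    have := Γ.cycleExp_pos _ i
    rw [mul_smul_comm, map_smul, Γ.tr_p_mul_p_eq_zero_of_len k this, smul_zero]
    omega
  · exact Γ.tr_p_mul_cycleSum_of_ne b e (Γ.len_pos h)

/-- Pairing with one socle element, with the intermediate cycle powers at one half-edge per vertex,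
and with the idempotents gives coordinates on the centre. They are dual to 1, to the sums of cycle
powers around vertices, and to the socle elements. -/
theorem finrank_center [CharZero k] [Fintype V] (hΓ : Γ.Connected)
    (hV : ∀ h, Γ.s h ∈ V₁ ↔ Γ.s (Γ.ι h) ∉ V₁) :
    Module.finrank k (Subalgebra.center k (Γ.Alg k)) =
      1 + ∑ v, (Γ.m v - 1) + Nat.card Γ.Edge := by
  classical
  obtain ⟨v₀⟩ := hΓ.nonempty
  choose r hr using Γ.s_surjective
  let ε : Γ.Edge → H := fun i => (Γ.edge_surjective i).choose
  have hε : ∀ i, Γ.edge (ε i) = i := fun i => (Γ.edge_surjective i).choose_spec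
  let τ (x : Γ.Alg k) : Subalgebra.center k (Γ.Alg k) →ₗ[k] k :=
    Γ.tr k ∘ₗ LinearMap.mulLeft k x ∘ₗ (Subalgebra.center k (Γ.Alg k)).toSubmodule.subtype
  have hτ : ∀ x z, τ x z = Γ.tr k (x * z) := fun _ _ => rfl
  let F : Subalgebra.center k (Γ.Alg k) →ₗ[k]
      k × ((Σ v, Fin (Γ.m v - 1)) → k) × (Γ.Edge → k) :=
    (τ (Γ.p k (r v₀) (Γ.len (r v₀)))).prod
      ((LinearMap.pi fun x => τ (Γ.p k (r x.1) (Γ.val x.1 * (x.2 + 1)))).prod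
        (LinearMap.pi fun i => τ (Γ.p k (ε i) 0)))
  have hF1 : ∀ z, (F z).1 = Γ.tr k (Γ.p k (r v₀) (Γ.len (r v₀)) * z) := fun _ => rfl
  have hF2 : ∀ z x, (F z).2.1 x = Γ.tr k (Γ.p k (r x.1) (Γ.val x.1 * (x.2 + 1)) * z) :=
    fun _ _ => rfl
  have hF3 : ∀ z i, (F z).2.2 i = Γ.tr k (Γ.p k (ε i) 0 * z) := fun _ _ => rfl
  have hinj : Function.Injective F := by
    rw [← LinearMap.ker_eq_bot, LinearMap.ker_eq_bot']
    intro z hz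
    have hc := fun b => Subalgebra.mem_center_iff.1 z.2 b
    refine Subtype.ext (Γ.eq_of_tr_p_mul_eq fun h j => ?_)
    rw [ZeroMemClass.coe_zero, mul_zero, map_zero]
    by_cases e : (Γ.ρ ^ j) h = h
    swap
    · exact Γ.tr_p_mul_central_eq_zero hV hc e
    obtain ⟨t, rfl⟩ := Γ.ρ_pow_eq_self_iff.1 e
    rcases Nat.eq_zero_or_pos t with rfl | ht
    · rw [mul_zero, Γ.p_zero_congr k (hε (Γ.edge h)).symm, ← hF3, hz]
      rfl
    have hpos := Nat.mul_pos (Γ.val_pos h) ht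
    rcases lt_trichotomy t (Γ.m (Γ.s h)) with hlt | rfl | hlt
    · rw [← Γ.tr_p_mul_central_congr hc hpos e (hr (Γ.s h)).symm]
      have h1 := hF2 z ⟨Γ.s h, ⟨t - 1, by omega⟩⟩
      rw [hz] at h1
      rw [Nat.sub_add_cancel ht] at h1
      exact h1.symm
    · have h1 := hF1 z
      rw [hz, Γ.tr_socle_mul_central_congr hΓ hc _ h] at h1
      exact h1.symm
    · rw [Γ.p_eq_zero k (Nat.mul_lt_mul_of_pos_left hlt (Γ.val_pos h)), zero_mul, map_zero]
  have hsurj : Function.Surjective F := by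
    rintro ⟨a, b, c⟩
    -- The sum over half-edges meets each socle element twice, hence the factor 1/2.
    obtain ⟨y, hy⟩ : ∃ y : H → k, ∀ h, y h = c (Γ.edge h) / 2 := ⟨_, fun _ => rfl⟩
    have hsoc : ∀ h j, 0 < j →
        Γ.p k h j * ∑ h', y h' • Γ.p k h' (Γ.len h') = 0 := by
      intro h j hj
      rw [Finset.mul_sum]
      exact Finset.sum_eq_zero fun h' _ => by
        rw [mul_smul_comm, Γ.p_mul_p_len _ _ hj, smul_zero]
    refine ⟨algebraMap k _ a + ⟨_, Γ.sum_cycleSum_mem_center b⟩ +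
      ⟨_, Γ.sum_socle_mem_center y⟩, ?_⟩
    refine Prod.ext ?_ (Prod.ext (funext fun x => ?_) (funext fun i => ?_))
    · rw [hF1, Subalgebra.coe_add, Subalgebra.coe_add, Subalgebra.coe_algebraMap, mul_add, mul_add,
        map_add, map_add, hsoc _ _ (Γ.len_pos _), map_zero, add_zero, Finset.mul_sum, map_sum,
        Finset.sum_eq_zero fun h' _ => Γ.tr_socle_mul_cycleSum b _ h', add_zero, ← Algebra.commutes,
        ← Algebra.smul_def, map_smul, tr_p_len, smul_eq_mul, mul_one]
    · obtain ⟨v, i⟩ := x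
      have hi := i.2
      have hval : 0 < Γ.val v := by
        rw [← hr v]
        exact Γ.val_pos _
      have hpos : 0 < Γ.val v * (i + 1) := Nat.mul_pos hval (Nat.succ_pos _)
      rw [hF2, Subalgebra.coe_add, Subalgebra.coe_add, Subalgebra.coe_algebraMap, mul_add, mul_add,
        map_add, map_add, hsoc _ _ hpos, map_zero, add_zero, ← Algebra.commutes,
        ← Algebra.smul_def, map_smul, tr_p_of_ne, smul_zero, zero_add, Finset.mul_sum, map_sum,
        Finset.sum_eq_single (r v)]
      · rw [hr]
        exact Γ.tr_p_mul_cycleSum b (hr v) i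
      · exact fun h' _ hne => Γ.tr_p_mul_cycleSum_of_ne b hne hpos
      · exact fun h => absurd (Finset.mem_univ _) h
      · rw [len, hr]
        exact (Nat.mul_lt_mul_of_pos_left (by omega) hval).ne
    · rw [hF3, Subalgebra.coe_add, Subalgebra.coe_add, Subalgebra.coe_algebraMap, mul_add, mul_add,
        map_add, map_add, ← Algebra.commutes, ← Algebra.smul_def, map_smul,
        Γ.tr_p_of_ne k (Γ.len_pos _).ne, smul_zero, zero_add, Finset.mul_sum, map_sum,
        Finset.sum_eq_zero fun h' _ => Γ.tr_p_zero_mul_cycleSum b _ h', zero_add,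
        p_zero_mul_sum_socle, map_smul, tr_p_len, smul_eq_mul, mul_one, hy, hy, Γ.edge_ι, hε,
        add_halves]
  rw [(LinearEquiv.ofBijective F ⟨hinj, hsurj⟩).finrank_eq, Module.finrank_prod,
    Module.finrank_prod, Module.finrank_fintype_fun_eq_card, Module.finrank_fintype_fun_eq_card,
    Module.finrank_self, Fintype.card_sigma, Nat.card_eq_fintype_card, add_assoc]
  simp only [Fintype.card_fin]

/-- The dimension of the second Hochschild cohomology of a Brauer graph algebra of a bipartite
graph. -/
theorem finrank_HH2 [CharZero k] [Fintype V] (hΓ : Γ.Connected)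
    (hV : ∀ h, Γ.s h ∈ V₁ ↔ Γ.s (Γ.ι h) ∉ V₁)
    (hlen : ∀ h, Γ.face (Γ.face h) = h → 2 ≤ Γ.len h) :
    Module.Finite k (HH2 k (Γ.Alg k)) ∧ (Module.finrank k (HH2 k (Γ.Alg k)) : ℤ) =
      2 + ∑ v : V, ((Γ.m v : ℤ) - 1) + (Nat.card Γ.Edge : ℤ) - (Nat.card V : ℤ) +
        ((Γ.twoCycles k).ncard : ℤ) := by
  obtain ⟨h1, h2⟩ := Γ.finrank_HH2_add_card (k := k) hΓ hV hlen
  refine ⟨h1, ?_⟩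
  rw [Γ.finrank_center hΓ hV, ← Γ.ncard_twoCycles (k := k) hV] at h2
  have h3 : ∑ v : V, ((Γ.m v : ℤ) - 1) = ((∑ v, (Γ.m v - 1) : ℕ) : ℤ) := by
    rw [Nat.cast_sum]
    exact Finset.sum_congr rfl fun v _ => by rw [Nat.cast_sub (Γ.m_pos v), Nat.cast_one]
  rw [h3]
  omega

end Centre

end BrauerGraph

end

/-! ### Truncated polynomial algebras -/

noncomputable section

namespace Hochschild

open Polynomial

variable {k B : Type*} [Field k] [Ring B] [Algebra k B]

/-- The polynomial ring in one variable is quasi-free. -/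
theorem liftsCocycles_polynomial (π : k[X] →ₐ[k] B) : LiftsCocycles π := by
  intro f hf
  have hone : ∀ b, f 1 b = f 1 1 * b := by
    intro b
    have := hf 1 1 b
    rwa [one_mul, one_mul, one_mul, sub_self, zero_add, sub_eq_zero] at this
  -- The recursion is forced by the required equation with `X` as first argument. The initial value
  -- is `f 1 1` and not 0, since the cocycle has not been normalised.
  let τ : ℕ → B := fun i =>
    Nat.rec (f 1 1) (fun i b => π X * b - f (π X) (π (X ^ i))) i
  have hτ0 : τ 0 = f 1 1 := rfl
  have hτ : ∀ i, τ (i + 1) = π X * τ i - f (π X) (π (X ^ i)) := fun _ => rfl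
  let t : k[X] →ₗ[k] B := (basisMonomials k).constr k τ
  have ht : ∀ i, t (X ^ i) = τ i := by
    intro i
    rw [X_pow_eq_monomial]
    have := (basisMonomials k).constr_basis k τ i
    rwa [coe_basisMonomials] at this
  have ht1 : t 1 = f 1 1 := by rw [← pow_zero X, ht, hτ0]
  have htX : ∀ y, t (X * y) = π X * t y - f (π X) (π y) := by
    intro y
    induction y using Polynomial.induction_on' with
    | add y z hy hz => rw [mul_add, map_add, hy, hz, map_add, map_add, map_add, mul_add]; abel
    | monomial i c =>
      rw [← smul_X_eq_monomial, mul_smul_comm, map_smul, map_smul, map_smul, map_smul,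
        ← pow_succ', ht, ht, hτ, mul_smul_comm, smul_sub]
  refine ⟨t, fun x y => ?_⟩
  have hmain : ∀ i : ℕ, f (π (X ^ i)) (π y) =
      π (X ^ i) * t y - t (X ^ i * y) + t (X ^ i) * π y := by
    intro i
    induction i with
    | zero => rw [pow_zero, map_one, one_mul, one_mul, sub_self, zero_add, ht1, hone]
    | succ i ih =>
      have h1 := hf (π X) (π (X ^ i)) (π y)
      rw [ih] at h1
      rw [pow_succ', mul_assoc, htX, htX, map_mul π, map_mul π, ← sub_eq_zero, ← neg_eq_zero,
        ← h1]
      simp only [mul_add, mul_sub, sub_mul, mul_assoc]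
      abel
  induction x using Polynomial.induction_on' with
  | add x z hx hz =>
    rw [add_mul, map_add, map_add, map_add, map_add, LinearMap.add_apply, hx, hz, add_mul, add_mul]
    abel
  | monomial i c =>
    rw [← smul_X_eq_monomial, smul_mul_assoc, map_smul,
      map_smul, map_smul, map_smul, LinearMap.smul_apply, hmain, smul_mul_assoc,
      smul_mul_assoc, smul_add, smul_sub]

/-- The second Hochschild cohomology of the truncated polynomial algebra. -/
theorem finrank_HH2_truncated [CharZero k] {n : ℕ}
    (e : B ≃ₐ[k] (k[X] ⧸ Ideal.span {(X : k[X]) ^ (n + 1)})) :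
    Module.Finite k (HH2 k B) ∧ Module.finrank k (HH2 k B) = n := by
  let π : k[X] →ₐ[k] B := e.symm.toAlgHom.comp (Ideal.Quotient.mkₐ k _)
  have hπ : Function.Surjective π :=
    e.symm.surjective.comp (Ideal.Quotient.mkₐ_surjective k _)
  have hπ0 : ∀ y, π y = 0 ↔ X ^ (n + 1) ∣ y := by
    intro y
    change e.symm (Ideal.Quotient.mk _ y) = 0 ↔ _
    rw [map_eq_zero_iff _ e.symm.injective, Ideal.Quotient.eq_zero_iff_mem,
      Ideal.mem_span_singleton]
  have hcomm : ∀ a b : B, a * b = b * a := by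
    intro a b
    apply e.injective
    rw [map_mul, map_mul, mul_comm]
  have hfin : Module.Finite k (k[X] ⧸ Ideal.span {(X : k[X]) ^ (n + 1)}) :=
    (monic_X_pow (n + 1)).finite_quotient
  have hfinB : Module.Finite k B := Module.Finite.equiv e.symm.toLinearEquiv
  have hrank : Module.finrank k B = n + 1 := by
    rw [e.toLinearEquiv.finrank_eq, finrank_quotient_span_eq_natDegree, natDegree_X_pow]
  have hker : π (X ^ (n + 1)) = 0 := (hπ0 _).2 dvd_rfl
  obtain ⟨E⟩ := nonempty_HH2_equiv hπ (liftsCocycles_polynomial π)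
    (LinearMap.applyₗ (X ^ (n + 1) : k[X])) (LinearMap.id : B →ₗ[k] B)
    (by
      intro t ht
      refine ⟨fun h y hy => ?_, fun h => h _ hker⟩
      obtain ⟨g, rfl⟩ := (hπ0 y).1 hy
      change t (X ^ (n + 1)) = 0 at h
      rw [(ht g _ hker).2, h, zero_mul])
    (by
      intro q
      -- The kernel is free of rank one on the power of `X`, and `L` is division by this generator;
      -- so the value `q` there can be chosen at will.
      obtain ⟨L, hL⟩ := LinearMap.exists_leftInverse_of_injective
        (LinearMap.mulLeft k ((X : k[X]) ^ (n + 1)))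
        (LinearMap.ker_eq_bot.2 (mul_right_injective₀ (pow_ne_zero _ X_ne_zero)))
      have hL' : ∀ g, L (X ^ (n + 1) * g) = g := fun g => LinearMap.congr_fun hL g
      refine ⟨LinearMap.mulRight k q ∘ₗ π.toLinearMap ∘ₗ L, fun x y hy => ?_, ?_⟩
      · obtain ⟨g, rfl⟩ := (hπ0 y).1 hy
        change π (L (x * (X ^ (n + 1) * g))) * q = π x * (π (L (X ^ (n + 1) * g)) * q) ∧
          π (L (X ^ (n + 1) * g * x)) * q = π (L (X ^ (n + 1) * g)) * q * π x
        rw [mul_left_comm, mul_assoc, hL', hL', hL', map_mul, map_mul, mul_assoc, mul_assoc,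
          mul_assoc, hcomm q]
        exact ⟨rfl, rfl⟩
      · change π (L (X ^ (n + 1))) * q = q
        rw [← mul_one (X ^ (n + 1)), hL', map_one, one_mul])
    (fun t _ => ⟨0, zero_mem _, t (X ^ (n + 1)), by rw [map_zero, zero_add]; rfl⟩)
  refine ⟨Module.Finite.equiv E.symm, ?_⟩
  have hpow : ∀ D ∈ derivations π, ∀ j : ℕ,
      D (X ^ (j + 1)) = ((j + 1 : ℕ) : k) • (π (X ^ j) * D X) := by
    intro D hD j
    induction j with
    | zero => rw [zero_add, pow_one, pow_zero, map_one, one_mul, Nat.cast_one, one_smul]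
    | succ j ih =>
      rw [pow_succ, hD, ih, smul_mul_assoc, mul_assoc, hcomm (D X), ← mul_assoc, ← map_mul,
        ← pow_succ, Nat.cast_succ (j + 1), add_smul, one_smul, add_comm]
  have hsoc : ∀ b, ∃ c : k, π (X ^ n) * b = c • π (X ^ n) := by
    intro b
    obtain ⟨f, rfl⟩ := hπ b
    refine ⟨f.coeff 0, ?_⟩
    rw [← map_mul, ← map_smul, ← sub_eq_zero, ← map_sub, hπ0]
    refine ⟨f.divX, ?_⟩
    conv_lhs => rw [← divX_mul_X_add f]
    rw [coeff_add, coeff_C_zero, coeff_mul_X_zero, zero_add, smul_eq_C_mul]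
    ring
  -- A derivation sends the generator to n + 1 times the n-th power of `X` times the image of `X`,
  -- which always lies in the one-dimensional socle. Characteristic 0 makes the usual derivative
  -- reach a generator of it.
  have hN : ((derivations π).map (LinearMap.applyₗ (X ^ (n + 1) : k[X]))).comap
      (LinearMap.id : B →ₗ[k] B) = Submodule.span k {π (X ^ n)} := by
    rw [Submodule.comap_id]
    apply le_antisymm
    · rintro _ ⟨D, hD, rfl⟩
      obtain ⟨c, hc⟩ := hsoc (D X)
      refine Submodule.mem_span_singleton.2 ⟨((n + 1 : ℕ) : k) * c, ?_⟩
      change _ = D (X ^ (n + 1))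
      rw [hpow D hD, hc, mul_smul]
    · rw [Submodule.span_singleton_le_iff_mem]
      refine ⟨((n + 1 : ℕ) : k)⁻¹ • (π.toLinearMap ∘ₗ derivative),
        Submodule.smul_mem _ _ fun x y => ?_, ?_⟩
      · change π (derivative (x * y)) = π x * π (derivative y) + π (derivative x) * π y
        rw [derivative_mul, map_add, map_mul, map_mul, add_comm]
      · change ((n + 1 : ℕ) : k)⁻¹ • π (derivative (X ^ (n + 1))) = _
        rw [derivative_X_pow, ← smul_eq_C_mul, map_smul, Nat.add_sub_cancel,
          inv_smul_smul₀ (Nat.cast_ne_zero.2 n.succ_ne_zero)]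
  have hne : π (X ^ n) ≠ 0 := by
    rw [Ne, hπ0, pow_dvd_pow_iff X_ne_zero not_isUnit_X]
    omega
  have h1 := Submodule.finrank_quotient_add_finrank (Submodule.span k {π (X ^ n)})
  rw [finrank_span_singleton hne, hrank] at h1
  rw [E.finrank_eq, hN]
  omega

end Hochschild

/-- Needed to exclude the exceptional graphs from the non-local case: a polynomial with nonzero
constant term is coprime to every power of the variable, hence a unit in the quotient. -/
theorem isLocalRing_truncated (k : Type*) [Field k] (n : ℕ) :
    IsLocalRing (Polynomial k ⧸ Ideal.span {(Polynomial.X : Polynomial k) ^ (n + 1)}) := by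
  have : Nontrivial (Polynomial k ⧸ Ideal.span {(Polynomial.X : Polynomial k) ^ (n + 1)}) :=
    Ideal.Quotient.nontrivial_iff.2 fun h => by
      rw [Ideal.span_singleton_eq_top, isUnit_pow_succ_iff] at h
      exact Polynomial.not_isUnit_X h
  have key : ∀ f : Polynomial k, f.coeff 0 ≠ 0 →
      IsUnit (Ideal.Quotient.mk (Ideal.span {(Polynomial.X : Polynomial k) ^ (n + 1)}) f) := by
    intro f hf
    have h1 : IsCoprime f (Polynomial.X ^ (n + 1)) :=
      ((Polynomial.irreducible_X.coprime_iff_not_dvd.2 fun h =>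
        hf (Polynomial.X_dvd_iff.1 h)).pow_left).symm
    obtain ⟨a, b, hab⟩ := h1
    refine IsUnit.of_mul_eq_one_right (Ideal.Quotient.mk _ a) ?_
    rw [← map_mul, ← map_one (Ideal.Quotient.mk _), Ideal.Quotient.eq, Ideal.mem_span_singleton]
    exact ⟨-b, by rw [← hab]; ring⟩
  refine IsLocalRing.of_isUnit_or_isUnit_one_sub_self fun a => ?_
  obtain ⟨f, rfl⟩ := Ideal.Quotient.mk_surjective a
  by_cases hf : f.coeff 0 = 0
  · right
    rw [← map_one (Ideal.Quotient.mk _), ← map_sub]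
    refine key _ ?_
    rw [Polynomial.coeff_sub, hf, Polynomial.coeff_one_zero, sub_zero]
    exact one_ne_zero
  · exact Or.inl (key f hf)

end

/-! ### Local algebras and graphs with one edge -/

noncomputable section

namespace BrauerGraph

open Polynomial

variable {V H : Type*} {k : Type*} [Field k] [Finite H] (Γ : BrauerGraph V H) {V₁ : Set V}

/-- In a local ring an idempotent or its complement is a unit, whereas two distinct edges would give
nonzero orthogonal idempotents. -/
theorem card_edge_eq_one (hΓ : Γ.Connected) [IsLocalRing (Γ.Alg k)] : Nat.card Γ.Edge = 1 := by
  obtain ⟨v⟩ := hΓ.nonempty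
  obtain ⟨h₀, -⟩ := Γ.s_surjective v
  refine Nat.card_eq_one_iff_unique.2 ⟨⟨fun i j => ?_⟩, ⟨Γ.edge h₀⟩⟩
  obtain ⟨h, rfl⟩ := Γ.edge_surjective i
  obtain ⟨h', rfl⟩ := Γ.edge_surjective j
  by_contra hne
  have hid : Γ.p k h 0 * Γ.p k h 0 = Γ.p k h 0 := Γ.p_mul_zero_of_edge_eq k rfl 0
  rcases IsLocalRing.isUnit_or_isUnit_of_add_one (add_sub_cancel (Γ.p k h 0) 1) with hu | hu
  · have h1 : Γ.p k h 0 * Γ.p k h' 0 = Γ.p k h 0 * 0 := by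
      rw [Γ.p_mul_zero_of_edge_ne k hne, mul_zero]
    exact Γ.p_ne_zero (Nat.zero_le _) (hu.mul_left_cancel h1)
  · have h1 : Γ.p k h 0 * (1 - Γ.p k h 0) = 0 * (1 - Γ.p k h 0) := by
      rw [mul_sub, mul_one, hid, sub_self, zero_mul]
    exact Γ.p_ne_zero (Nat.zero_le _) (hu.mul_right_cancel h1)

section OneEdge

variable [Subsingleton Γ.Edge]

theorem eq_or_eq_ι (h h' : H) : h' = h ∨ h' = Γ.ι h :=
  Γ.edge_eq_edge_iff.1 (Subsingleton.elim _ _)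

theorem ρ_eq_self (hV : ∀ h, Γ.s h ∈ V₁ ↔ Γ.s (Γ.ι h) ∉ V₁) (h : H) : Γ.ρ h = h := by
  rcases Γ.eq_or_eq_ι h (Γ.ρ h) with e | e
  · exact e
  · exact absurd e (Γ.ρ_pow_ne_ι hV h 1)

theorem len_eq_m (hV : ∀ h, Γ.s h ∈ V₁ ↔ Γ.s (Γ.ι h) ∉ V₁) (h : H) :
    Γ.len h = Γ.m (Γ.s h) := by
  have h1 : Γ.val (Γ.s h) ∣ 1 := Γ.ρ_pow_eq_self_iff.1 (by rw [pow_one, Γ.ρ_eq_self hV])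
  rw [len, Nat.dvd_one.1 h1, one_mul]

theorem face_eq_ι (hV : ∀ h, Γ.s h ∈ V₁ ↔ Γ.s (Γ.ι h) ∉ V₁) (h : H) : Γ.face h = Γ.ι h :=
  Γ.face_eq_iff.2 (Γ.ρ_eq_self hV _).symm

theorem s_ι_ne (hV : ∀ h, Γ.s h ∈ V₁ ↔ Γ.s (Γ.ι h) ∉ V₁) (h : H) : Γ.s (Γ.ι h) ≠ Γ.s h := by
  intro e
  have := hV h
  rw [e] at this
  tauto

theorem exists_half_edge {v w : V} (hvw : v ≠ w) : ∃ h, Γ.s h = v ∧ Γ.s (Γ.ι h) = w := by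
  obtain ⟨h, rfl⟩ := Γ.s_surjective v
  obtain ⟨h', rfl⟩ := Γ.s_surjective w
  rcases Γ.eq_or_eq_ι h h' with rfl | rfl
  · exact absurd rfl hvw
  · exact ⟨h, rfl, rfl⟩

theorem card_vertices_eq_two (hΓ : Γ.Connected) (hV : ∀ h, Γ.s h ∈ V₁ ↔ Γ.s (Γ.ι h) ∉ V₁) :
    Nat.card V = 2 := by
  obtain ⟨v⟩ := hΓ.nonempty
  obtain ⟨h, -⟩ := Γ.s_surjective v
  refine Nat.card_eq_two_iff.2 ⟨Γ.s h, Γ.s (Γ.ι h), (Γ.s_ι_ne hV h).symm, ?_⟩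
  refine Set.eq_univ_of_forall fun w => ?_
  obtain ⟨h', rfl⟩ := Γ.s_surjective w
  rcases Γ.eq_or_eq_ι h h' with rfl | rfl
  · exact Or.inl rfl
  · exact Or.inr rfl

theorem card_digon_eq_one (hΓ : Γ.Connected) (hV : ∀ h, Γ.s h ∈ V₁ ↔ Γ.s (Γ.ι h) ∉ V₁) :
    Nat.card (Γ.Digon V₁) = 1 := by
  obtain ⟨v⟩ := hΓ.nonempty
  obtain ⟨h, -⟩ := Γ.s_surjective v
  have hface : ∀ h, Γ.face (Γ.face h) = h := fun h => by
    rw [Γ.face_eq_ι hV, Γ.face_eq_ι hV, Γ.ι_involutive]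
  refine Nat.card_eq_one_iff_unique.2 ⟨⟨fun x y => Subtype.ext ?_⟩, ?_⟩
  · rcases Γ.eq_or_eq_ι y.1 x.1 with e | e
    · exact e
    · have := x.2.2
      rw [e] at this
      exact absurd this ((hV y.1).1 y.2.2)
  · by_cases hh : Γ.s h ∈ V₁
    · exact ⟨⟨h, hface h, hh⟩⟩
    · exact ⟨⟨Γ.ι h, hface _, by rwa [hV, Γ.ι_involutive]⟩⟩

/-- The local Brauer tree algebra. -/
theorem nonempty_algEquiv_truncated (hV : ∀ h, Γ.s h ∈ V₁ ↔ Γ.s (Γ.ι h) ∉ V₁) {h : H}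
    (h1 : Γ.len (Γ.ι h) = 1) : Nonempty (Γ.Alg k ≃ₐ[k]
      (k[X] ⧸ Ideal.span {(X : k[X]) ^ (Γ.len h + 1)})) := by
  have hone : Γ.p k h 0 = 1 := by
    have := Γ.sum_idem_eq_one k
    rwa [Fintype.sum_subsingleton _ (Γ.edge h), proj_idem] at this
  have hρ : ∀ j, (Γ.ρ ^ j) h = h := by
    intro j
    induction j with
    | zero => rfl
    | succ j ih => rw [pow_succ', Equiv.Perm.mul_apply, ih, Γ.ρ_eq_self hV]
  have hpow : ∀ j, Γ.p k h 1 ^ j = Γ.p k h j := by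
    intro j
    induction j with
    | zero => rw [pow_zero, hone]
    | succ j ih => rw [pow_succ', ih, Γ.p_one_mul k (hρ j)]
  let π : k[X] →ₐ[k] Γ.Alg k := aeval (Γ.p k h 1)
  have hπX : ∀ j, π (X ^ j) = Γ.p k h j := fun j => by rw [map_pow, aeval_X, hpow]
  have hsurj : Function.Surjective π := by
    have hp : ∀ j, Γ.p k h j ∈ π.range := fun j => ⟨X ^ j, hπX j⟩
    intro b
    change b ∈ π.range
    induction b using Γ.alg_induction with
    | hzero => exact zero_mem _
    | hadd x y hx hy => exact add_mem hx hy
    | hsmul c x hx => exact Subalgebra.smul_mem _ hx c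
    | hp h' j hj =>
      rcases Γ.eq_or_eq_ι h h' with rfl | rfl
      · exact hp j
      · rw [h1] at hj
        interval_cases j
        · rw [p_ι_zero]
          exact hp 0
        · have := Γ.p_len k h
          rw [h1] at this
          rw [this]
          exact hp _
  -- The trace against the complementary power of the generator extracts a coefficient, so no
  -- polynomial outside the expected ideal lies in the kernel.
  have hcoeff : ∀ d, d ≤ Γ.len h → ∀ f : k[X],
      Γ.tr k (Γ.p k h (Γ.len h - d) * π f) = f.coeff d := by
    intro d hd f
    induction f using Polynomial.induction_on' with
    | add f g hf hg => rw [map_add, mul_add, map_add, hf, hg, coeff_add]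
    | monomial i c =>
      rw [← smul_X_eq_monomial, map_smul, mul_smul_comm, map_smul, hπX, Γ.p_mul_p k (hρ i), tr_p,
        coeff_smul, coeff_X_pow]
      congr 1
      by_cases e : d = i
      · rw [if_pos e, if_pos (by omega)]
      · rw [if_neg e, if_neg (by omega)]
  have hker : RingHom.ker π = Ideal.span {(X : k[X]) ^ (Γ.len h + 1)} := by
    ext f
    rw [RingHom.mem_ker, Ideal.mem_span_singleton]
    constructor
    · intro hf
      refine X_pow_dvd_iff.2 fun d hd => ?_
      rw [← hcoeff d (by omega), hf, mul_zero, map_zero]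
    · rintro ⟨g, rfl⟩
      rw [map_mul, hπX, Γ.p_eq_zero k (Nat.lt_succ_self _), zero_mul]
  exact ⟨(Ideal.quotientKerAlgEquivOfSurjective hsurj).symm.trans
    (Ideal.quotientEquivAlgOfEq k hker)⟩

end OneEdge

/-- Apart from the local Brauer tree algebras, faces of length two only have arrows which are not
in the socle. -/
theorem exists_len_eq_one (hΓ : Γ.Connected)
    (hlen : ¬∀ h, Γ.face (Γ.face h) = h → 2 ≤ Γ.len h) :
    Subsingleton Γ.Edge ∧ ∃ h, Γ.len (Γ.ι h) = 1 := by
  push Not at hlen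
  obtain ⟨h, hf, hl⟩ := hlen
  have h1 : Γ.len h = 1 := by
    have := Γ.len_pos h
    omega
  have hρ : Γ.ρ h = h := by
    have := Γ.ρ_pow_len h
    rwa [h1, pow_one] at this
  have hι : Γ.ι (Γ.face h) = h := by rw [Γ.face_eq_iff.1 hf, hρ]
  have hρι : Γ.ρ (Γ.ι h) = Γ.ι h := by
    have := Γ.ρ_face h
    rwa [← Γ.ι_involutive (Γ.face h), hι] at this
  -- Both half-edges of the edge turn out to be fixed by ρ, so each is alone at its vertex; by
  -- connectedness the graph consists of this one edge.
  have huniq : ∀ g, Γ.ρ g = g → ∀ h', Γ.s h' = Γ.s g → h' = g := by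
    intro g hg h' e
    obtain ⟨i, rfl⟩ := ((Γ.sameCycle_iff g h').2 e.symm).exists_nat_pow_eq
    clear e
    induction i with
    | zero => rfl
    | succ i ih => rw [pow_succ', Equiv.Perm.mul_apply, ih, hg]
  have hall : ∀ h', h' = h ∨ h' = Γ.ι h := by
    intro h'
    have key : ∀ g, (Γ.s g = Γ.s h ∨ Γ.s g = Γ.s (Γ.ι h)) → g = h ∨ g = Γ.ι h := fun g hg =>
      hg.imp (huniq h hρ g) (huniq _ hρι g)
    have key' : ∀ g, (Γ.s g = Γ.s h ∨ Γ.s g = Γ.s (Γ.ι h)) →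
        Γ.s (Γ.ι g) = Γ.s h ∨ Γ.s (Γ.ι g) = Γ.s (Γ.ι h) := by
      intro g hg
      rcases key g hg with rfl | rfl
      · exact Or.inr rfl
      · exact Or.inl (by rw [Γ.ι_involutive])
    have := hΓ.apply_eq (f := fun v => v = Γ.s h ∨ v = Γ.s (Γ.ι h)) (fun g => propext
      ⟨key' g, fun hg => by have := key' _ hg; rwa [Γ.ι_involutive] at this⟩) (Γ.s h) (Γ.s h')
    exact key h' (this.mp (Or.inl rfl))
  refine ⟨⟨fun i j => ?_⟩, Γ.ι h, by rwa [Γ.ι_involutive]⟩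
  have hedge : ∀ i, i = Γ.edge h := by
    intro i
    obtain ⟨g, rfl⟩ := Γ.edge_surjective i
    exact (Γ.edge_eq_edge_iff.2 (hall g)).symm
  rw [hedge i, hedge j]

end BrauerGraph

end

theorem mainTheorem1 {k : Type*} [Field k] [IsAlgClosed k] [CharZero k]
    {V H : Type*} [Fintype V] [Fintype H] (Γ : BrauerGraph V H)
    (hconn : Γ.Connected) (hbip : Γ.IsBipartite) :
    (¬ IsLocalRing (Γ.Alg k) →
      Module.Finite k (Hochschild.HH2 k (Γ.Alg k)) ∧
      (Module.finrank k (Hochschild.HH2 k (Γ.Alg k)) : ℤ) =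
        2 + ∑ v : V, ((Γ.m v : ℤ) - 1) + (Nat.card Γ.Edge : ℤ) - (Nat.card V : ℤ)
          + ((Γ.twoCycles k).ncard : ℤ)) ∧
    (IsLocalRing (Γ.Alg k) →
      Nat.card Γ.Edge = 1 ∧ Nat.card V = 2 ∧
      Module.Finite k (Hochschild.HH2 k (Γ.Alg k)) ∧
      ∀ v w : V, v ≠ w →
        (Γ.m v ≠ 1 → Γ.m w ≠ 1 →
          Module.finrank k (Hochschild.HH2 k (Γ.Alg k)) = Γ.m v + Γ.m w + 1) ∧
        (Γ.m w = 1 →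
          Nonempty (Γ.Alg k ≃ₐ[k]
            (Polynomial k ⧸ Ideal.span {(Polynomial.X : Polynomial k) ^ (Γ.m v + 1)})) ∧
          Module.finrank k (Hochschild.HH2 k (Γ.Alg k)) = Γ.m v)) := by
  obtain ⟨V₁, hV⟩ := hbip
  constructor
  · intro hloc
    by_cases hlen : ∀ h, Γ.face (Γ.face h) = h → 2 ≤ Γ.len h
    · exact Γ.finrank_HH2 hconn hV hlen
    -- The excluded graphs give truncated polynomial algebras, which are local.
    · obtain ⟨hE, h, h1⟩ := Γ.exists_len_eq_one hconn hlen
      obtain ⟨e⟩ := Γ.nonempty_algEquiv_truncated (k := k) hV h1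
      have := isLocalRing_truncated k (Γ.len h)
      exact absurd e.symm.toRingEquiv.isLocalRing hloc
  · intro hloc
    have hcard := Γ.card_edge_eq_one (k := k) hconn
    have hE : Subsingleton Γ.Edge := (Nat.card_eq_one_iff_unique.1 hcard).1
    have hcardV := Γ.card_vertices_eq_two hconn hV
    refine ⟨hcard, hcardV, ?_, fun v w hvw => ⟨fun hv hw => ?_, fun hw => ?_⟩⟩
    · by_cases hlen : ∀ h, Γ.face (Γ.face h) = h → 2 ≤ Γ.len h
      · exact (Γ.finrank_HH2 hconn hV hlen).1
      · obtain ⟨-, h, h1⟩ := Γ.exists_len_eq_one hconn hlen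
        obtain ⟨e⟩ := Γ.nonempty_algEquiv_truncated (k := k) hV h1
        exact (Hochschild.finrank_HH2_truncated e).1
    · obtain ⟨h, rfl, rfl⟩ := Γ.exists_half_edge hvw
      have hlen : ∀ g, Γ.face (Γ.face g) = g → 2 ≤ Γ.len g := by
        intro g _
        have hpos := Γ.m_pos (Γ.s g)
        rw [Γ.len_eq_m hV]
        rcases Γ.eq_or_eq_ι h g with rfl | rfl <;> omega
      -- The dimension is counted through the centre: it has dimension m₁ + m₂, there is one digon
      -- and there are two vertices, which gives m₁ + m₂ + 2 + 1 - 2.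
      have h1 := (Γ.finrank_HH2_add_card (k := k) hconn hV hlen).2
      have hsum : ∑ v, (Γ.m v - 1) = (Γ.m (Γ.s h) - 1) + (Γ.m (Γ.s (Γ.ι h)) - 1) := by
        refine Fintype.sum_eq_add _ _ hvw fun x hx => ?_
        obtain ⟨g, rfl⟩ := Γ.s_surjective x
        rcases Γ.eq_or_eq_ι h g with rfl | rfl
        exacts [absurd rfl hx.1, absurd rfl hx.2]
      have hpos := Γ.m_pos (Γ.s h)
      have hpos' := Γ.m_pos (Γ.s (Γ.ι h))
      rw [Γ.finrank_center hconn hV, hsum, hcard, hcardV, Γ.card_digon_eq_one hconn hV] at h1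
      omega
    · obtain ⟨h, rfl, rfl⟩ := Γ.exists_half_edge hvw
      obtain ⟨e⟩ := Γ.nonempty_algEquiv_truncated (k := k) hV
        ((Γ.len_eq_m hV (Γ.ι h)).trans hw)
      rw [Γ.len_eq_m hV] at e
      exact ⟨⟨e⟩, (Hochschild.finrank_HH2_truncated e).2⟩
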